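/- **Setting.** All systems are finite-dimensional, $d_A\ge 1$ is the dimension of a system $A$, and $n_A=\log_2 d_A$ is its number of qubits. Let $f:\{0,1\}^n\times\{0,1\}^n\to\{0,1\}$. Alice holds $x\in\{0,1\}^n$, a quantum system $Q$ and $L$; Bob holds $y\in\{0,1\}^n$ and $R$; the state $\Psi_{LR}$ (possibly mixed) is the resource state. The diamond norm distance of channels is $\|\mathcal N-\mathcal M\|_\diamond=\sup_d\max_{\Psi}\|(\mathcal I_d\otimes\mathcal N)(\Psi)-(\mathcal I_d\otimes\mathcal M)(\Psi)\|_1$, over states $\Psi$ of the input and a $d$-dimensional ancilla, with $\|X\|_1=\mathrm{tr}|X|$. *$f$-routing.* Alice applies a channel $QL\to M_0M_0'$ depending on $x$, keeps $M_0'$ and sends $M_0$ to Bob; Bob applies a channel $R\to M_1M_1'$ depending on $y$, keeps $M_1$ and sends $M_1'$ to Alice. Let $\mathcal N^{x,y}:Q\to MM'$, with $M=M_0M_1$ and $M'=M_0'M_1'$, be the resulting channel. The protocol is $(\epsilon_0,\epsilon_1)$-correct if for all $(x,y)$ with $f(x,y)=1$ there is a channel $\mathcal D:M\to Q$ with $\|\mathcal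 D\circ\mathrm{tr}_{M'}\circ\mathcal N^{x,y}-\mathcal I_Q\|_\diamond\le\epsilon_1$, and for all $(x,y)$ with $f(x,y)=0$ there is a channel $\mathcal D:M'\to Q$ with $\|\mathcal D\circ\mathrm{tr}_{M}\circ\mathcal N^{x,y}-\mathcal I_Q\|_\diamond\le\epsilon_0$. *CDQS (conditional disclosure of secrets with quantum resources).* Alice applies a channel $QL\to M_A$ depending on $x$, Bob applies a channel $R\to M_B$ depending on $y$, and both outputs are sent to a referee; let $\mathcal N^{x,y}:Q\to M_AM_B$ be the resulting channel. The protocol is $\epsilon$-correct if for all $(x,y)$ with $f(x,y)=1$ there is a channel $\mathcal D:M_AM_B\to Q$ with $\|\mathcal D\circ\mathcal N^{x,y}-\mathcal I_Q\|_\diamond\le\epsilon$, and $\delta$-secure if for all $(x,y)$ with $f(x,y)=0$ there is a state $\sigma$ of $M_AM_B$ with $\|\mathrm{tr}_Q(\cdot)\,\sigma-\mathcal N^{x,y}\|_\diamond\le\delta$. *Costs.* For $Q$ one qubit, let $\mathsf{CDQS}(f)$ be the infimum of $\min(n_L,n_R)$ over all $0.09$-correct and $0.09$-secure CDQS protocols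 for $f$, and let $\mathsf{FR}(f)$ be the infimum of the log dimension $n_L+n_R$ of the resource system over all $(0.09,0.09)$-correct $f$-routing protocols for $f$. **Theorem.** Let $\epsilon_0,\epsilon_1,\epsilon,\delta\ge 0$. 1. For every $(\epsilon_0,\epsilon_1)$-correct $f$-routing protocol there is an $\epsilon_1$-correct and $2\sqrt{\epsilon_0}$-secure CDQS protocol for the same $f$ and $Q$, with the same resource state $\Psi_{LR}$, and with messages $M_A=M_0$, $M_B=M_1$ (the systems that Bob receives or keeps in the $f$-routing protocol). 2. Consider an $\epsilon$-correct and $\delta$-secure CDQS protocol for $f$ with secret $Q$, in which $LR$ has at most $n_E$ qubits and each of the two messages has at most $n_M$ qubits. (a) If the resource state is pure, then there is a $(2\sqrt\delta,\epsilon)$-correct $f$-routing protocol for $f$ and $Q$ with the same resource state, in which the exchanged systems $M_0,M_1'$ have in total at most $4(n_M+n_E)$ qubits; if moreover $n_Q\le 3n_E$, then even $M_0,M_0',M_1,M_1'$ together (the kept systems included) have at most $4(n_M+n_E)$ qubits. (b) For an arbitrary resource state $\Psi_{LR}$, the same holds with the resource state replaced by a purification $|\Psi\rangle_{LRR'}$,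 where $n_{R'}\le n_E$ and Bob holds $RR'$, and with $n_Q\le 2n_E$ in place of $n_Q\le 3n_E$. 3. $\mathsf{FR}(f)=\Theta(\mathsf{CDQS}(f))$: there are universal constants $c,C>0$ with $c\,\mathsf{CDQS}(f)\le\mathsf{FR}(f)\le C\,\mathsf{CDQS}(f)$ for all $n$ and all $f:\{0,1\}^n\times\{0,1\}^n\to\{0,1\}$. The same holds if $\mathsf{FR}(f)$ is measured by $\min(n_L,n_R)$ instead of $n_L+n_R$. -/

import Mathlib

open scoped NNReal ENNReal Kronecker ComplexOrder

noncomputable section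

namespace NLQC

/-! ### Finite-dimensional quantum systems

A system `A` with Hilbert space of dimension `d` is represented by a finite index type with `d`
elements (an orthonormal basis); operators are complex matrices indexed by it, and the tensor
product of two systems is the product of the index types. -/

section Channels

variable {A B C D : Type*} [Fintype A] [DecidableEq A] [Fintype B] [DecidableEq B]
  [Fintype C] [DecidableEq C] [Fintype D] [DecidableEq D]

/-- The number of qubits `n_A = log₂ d_A` of a system. -/
def qubits (A : Type*) [Fintype A] : ℝ := Real.logb 2 (Fintype.card A)

/-- Density matrices. -/
def IsDensity (ρ : Matrix A A ℂ) : Prop := ρ.PosSemidef ∧ ρ.trace = 1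

/-- Pure states, that is, the rank one operators `|ψ⟩⟨ψ|`. -/
def IsPure (ρ : Matrix A A ℂ) : Prop :=
  IsDensity ρ ∧ ∃ ψ : A → ℂ, ρ = Matrix.vecMulVec ψ (star ψ)

/-- Linear maps from operators on `A` to operators on `B`. -/
abbrev SuperOp (A B : Type*) : Type _ := Matrix A A ℂ →ₗ[ℂ] Matrix B B ℂ

/-- The tensor product `Φ ⊗ Ψ`: the linear map with `(Φ ⊗ Ψ)(X ⊗ Y) = Φ(X) ⊗ Ψ(Y)`,
see `tensorMap_kronecker`. -/
def tensorMap (Φ : SuperOp A B) (Ψ : SuperOp C D) : SuperOp (A × C) (B × D) where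
  toFun X := ∑ i, ∑ j, ∑ k, ∑ l, X (i, k) (j, l) •
    (Φ (Matrix.single i j 1) ⊗ₖ Ψ (Matrix.single k l 1))
  map_add' X Y := by simp only [Matrix.add_apply, add_smul, Finset.sum_add_distrib]
  map_smul' c X := by
    simp only [Matrix.smul_apply, smul_eq_mul, mul_smul, Finset.smul_sum, RingHom.id_apply]

/-- `id_A ⊗ Φ` preserves positivity for every finite-dimensional ancilla `A`. -/
def IsCompletelyPositive (Φ : SuperOp A B) : Prop :=
  ∀ (k : ℕ) (X : Matrix (Fin k × A) (Fin k × A) ℂ), X.PosSemidef →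
    (tensorMap (LinearMap.id : SuperOp (Fin k) (Fin k)) Φ X).PosSemidef

/-- Quantum channels: completely positive trace preserving maps. -/
structure IsChannel (Φ : SuperOp A B) : Prop where
  completelyPositive : IsCompletelyPositive Φ
  trace_preserving : ∀ X : Matrix A A ℂ, (Φ X).trace = X.trace

/-- The partial trace over the first factor, `tr_A : AB → B`. -/
def traceFst : SuperOp (A × B) B where
  toFun X := Matrix.of fun b b' => ∑ a, X (a, b) (a, b')
  map_add' X Y := by ext; simp [Finset.sum_add_distrib]
  map_smul' c X := by ext; simp [Finset.mul_sum]

/-- The partial trace over the second factor, `tr_B : AB → A`. -/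
def traceSnd : SuperOp (A × B) A where
  toFun X := Matrix.of fun a a' => ∑ b, X (a, b) (a', b)
  map_add' X Y := by ext; simp [Finset.sum_add_distrib]
  map_smul' c X := by ext; simp [Finset.mul_sum]

/-- The map `X ↦ tr(X) σ` which discards the input and prepares the state `σ`, that is
`S ∘ tr_A` with `S` the preparation of `σ`. -/
def replaceMap (σ : Matrix B B ℂ) : SuperOp A B where
  toFun X := X.trace • σ
  map_add' X Y := by rw [Matrix.trace_add, add_smul]
  map_smul' c X := by rw [Matrix.trace_smul, smul_assoc, RingHom.id_apply]

/-- The trace norm `‖X‖₁ = tr |X|`, `|X| = √(X† X)`, as the sum of the singular values of `X`. -/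
def traceNorm (X : Matrix A A ℂ) : ℝ :=
  ∑ i, Real.sqrt ((Matrix.isHermitian_conjTranspose_mul_self X).eigenvalues i)

/-- The diamond norm distance `‖Φ - Ψ‖_⋄`: the supremum, over all ancilla dimensions `d` and all
states `ρ` of ancilla and input, of `‖(id ⊗ Φ)(ρ) - (id ⊗ Ψ)(ρ)‖₁`. -/
def diamondDist (Φ Ψ : SuperOp A B) : ℝ≥0∞ :=
  ⨆ (d : ℕ) (ρ : Matrix (Fin d × A) (Fin d × A) ℂ) (_ : IsDensity ρ),
    ENNReal.ofReal (traceNorm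
      (tensorMap (LinearMap.id : SuperOp (Fin d) (Fin d)) Φ ρ -
        tensorMap (LinearMap.id : SuperOp (Fin d) (Fin d)) Ψ ρ))

end Channels

theorem tensorMap_kronecker {A B C D : Type*} [Fintype A] [DecidableEq A]
    [Fintype C] [DecidableEq C] (Φ : SuperOp A B) (Ψ : SuperOp C D)
    (X : Matrix A A ℂ) (Y : Matrix C C ℂ) :
    tensorMap Φ Ψ (X ⊗ₖ Y) = Φ X ⊗ₖ Ψ Y := by
  have hX : Φ X = ∑ i, ∑ j, X i j • Φ (Matrix.single i j 1) := by
    conv_lhs => rw [Matrix.matrix_eq_sum_single X]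
    simp only [map_sum]
    refine Finset.sum_congr rfl fun i _ => Finset.sum_congr rfl fun j _ => ?_
    rw [← map_smul, Matrix.smul_single, smul_eq_mul, mul_one]
  have hY : Ψ Y = ∑ k, ∑ l, Y k l • Ψ (Matrix.single k l 1) := by
    conv_lhs => rw [Matrix.matrix_eq_sum_single Y]
    simp only [map_sum]
    refine Finset.sum_congr rfl fun i _ => Finset.sum_congr rfl fun j _ => ?_
    rw [← map_smul, Matrix.smul_single, smul_eq_mul, mul_one]
  rw [hX, hY]
  ext ⟨b, d⟩ ⟨b', d'⟩
  simp only [tensorMap, LinearMap.coe_mk, AddHom.coe_mk, Matrix.sum_apply, Matrix.smul_apply,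
    Matrix.kroneckerMap_apply, smul_eq_mul, Finset.sum_mul]
  simp only [Finset.mul_sum]
  refine Finset.sum_congr rfl fun i _ => Finset.sum_congr rfl fun j _ => ?_
  refine Finset.sum_congr rfl fun k _ => Finset.sum_congr rfl fun l _ => ?_
  ring

/-! ### Protocols

Classical inputs are bit strings `x, y : Fin n → Bool`. The resource state on `L` (Alice) and `R`
(Bob) may be mixed. -/

/-- `X ↦ X_Q ⊗ Ψ_LR`, with the systems grouped as `(Q L) R`. -/
def withResource {Q L R : Type*} (Ψ : Matrix (L × R) (L × R) ℂ) : SuperOp Q ((Q × L) × R) where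
  toFun X := (X ⊗ₖ Ψ).submatrix (Equiv.prodAssoc Q L R) (Equiv.prodAssoc Q L R)
  map_add' X Y := by ext; simp [add_mul]
  map_smul' c X := by ext; simp [mul_assoc]

/-- The first round of a one-round protocol for `f`-routing. Alice, holding `x`, `Q` and `L`,
applies a channel `Q L → M₀ M₀'`, keeps `M₀'` and sends `M₀` to Bob. Bob, holding `y` and `R`,
applies a channel `R → M₁ M₁'`, keeps `M₁` and sends `M₁'` to Alice. -/
structure FRProtocol (n : ℕ) (Q L R M₀ M₀' M₁ M₁' : Type*)
    [Fintype Q] [DecidableEq Q] [Fintype L] [DecidableEq L] [Fintype R] [DecidableEq R]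
    [Fintype M₀] [DecidableEq M₀] [Fintype M₀'] [DecidableEq M₀']
    [Fintype M₁] [DecidableEq M₁] [Fintype M₁'] [DecidableEq M₁'] where
  state : Matrix (L × R) (L × R) ℂ
  state_isDensity : IsDensity state
  alice : (Fin n → Bool) → SuperOp (Q × L) (M₀ × M₀')
  alice_isChannel : ∀ x, IsChannel (alice x)
  bob : (Fin n → Bool) → SuperOp R (M₁ × M₁')
  bob_isChannel : ∀ y, IsChannel (bob y)

namespace FRProtocol

variable {n : ℕ} {Q L R M₀ M₀' M₁ M₁' : Type*}
  [Fintype Q] [DecidableEq Q] [Fintype L] [DecidableEq L] [Fintype R] [DecidableEq R]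
  [Fintype M₀] [DecidableEq M₀] [Fintype M₀'] [DecidableEq M₀']
  [Fintype M₁] [DecidableEq M₁] [Fintype M₁'] [DecidableEq M₁']

/-- The combined first-round channel `N^{x,y} : Q → (M₀ M₀') (M₁ M₁')`. -/
def channel (P : FRProtocol n Q L R M₀ M₀' M₁ M₁') (x y : Fin n → Bool) :
    SuperOp Q ((M₀ × M₀') × (M₁ × M₁')) :=
  tensorMap (P.alice x) (P.bob y) ∘ₗ withResource P.state

/-- `tr_{M'} ∘ N^{x,y}`: what is available on Bob's side (`M = M₀ M₁`) after communication. -/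
def toBob (P : FRProtocol n Q L R M₀ M₀' M₁ M₁') (x y : Fin n → Bool) : SuperOp Q (M₀ × M₁) :=
  tensorMap (traceSnd : SuperOp (M₀ × M₀') M₀) (traceSnd : SuperOp (M₁ × M₁') M₁) ∘ₗ
    P.channel x y

/-- `tr_M ∘ N^{x,y}`: what is available on Alice's side (`M' = M₀' M₁'`) after communication. -/
def toAlice (P : FRProtocol n Q L R M₀ M₀' M₁ M₁') (x y : Fin n → Bool) :
    SuperOp Q (M₀' × M₁') :=
  tensorMap (traceFst : SuperOp (M₀ × M₀') M₀') (traceFst : SuperOp (M₁ × M₁') M₁') ∘ₗ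
    P.channel x y

/-- The protocol completes `f`-routing `(ε₀, ε₁)`-correctly: Bob can recover `Q` if `f(x,y) = 1`,
and Alice can recover `Q` if `f(x,y) = 0`. -/
def IsCorrect (P : FRProtocol n Q L R M₀ M₀' M₁ M₁')
    (f : (Fin n → Bool) → (Fin n → Bool) → Bool) (ε₀ ε₁ : ℝ≥0) : Prop :=
  (∀ x y, f x y = true → ∃ D : SuperOp (M₀ × M₁) Q, IsChannel D ∧
    diamondDist (D ∘ₗ P.toBob x y) LinearMap.id ≤ ε₁) ∧
  (∀ x y, f x y = false → ∃ D : SuperOp (M₀' × M₁') Q, IsChannel D ∧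
    diamondDist (D ∘ₗ P.toAlice x y) LinearMap.id ≤ ε₀)

end FRProtocol

/-- A protocol for conditional disclosure of secrets with quantum resources. Alice, holding `x`,
the secret `Q` and `L`, sends `M_A` to the referee; Bob, holding `y` and `R`, sends `M_B`. -/
structure CDQSProtocol (n : ℕ) (Q L R MA MB : Type*)
    [Fintype Q] [DecidableEq Q] [Fintype L] [DecidableEq L] [Fintype R] [DecidableEq R]
    [Fintype MA] [DecidableEq MA] [Fintype MB] [DecidableEq MB] where
  state : Matrix (L × R) (L × R) ℂ
  state_isDensity : IsDensity state
  alice : (Fin n → Bool) → SuperOp (Q × L) MA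
  alice_isChannel : ∀ x, IsChannel (alice x)
  bob : (Fin n → Bool) → SuperOp R MB
  bob_isChannel : ∀ y, IsChannel (bob y)

namespace CDQSProtocol

variable {n : ℕ} {Q L R MA MB : Type*}
  [Fintype Q] [DecidableEq Q] [Fintype L] [DecidableEq L] [Fintype R] [DecidableEq R]
  [Fintype MA] [DecidableEq MA] [Fintype MB] [DecidableEq MB]

/-- The combined channel `N^{x,y} : Q → M_A M_B` from the secret to the referee. -/
def channel (P : CDQSProtocol n Q L R MA MB) (x y : Fin n → Bool) : SuperOp Q (MA × MB) :=
  tensorMap (P.alice x) (P.bob y) ∘ₗ withResource P.state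

/-- `ε`-correctness: if `f(x,y) = 1` the referee can recover the secret. -/
def IsCorrect (P : CDQSProtocol n Q L R MA MB)
    (f : (Fin n → Bool) → (Fin n → Bool) → Bool) (ε : ℝ≥0) : Prop :=
  ∀ x y, f x y = true → ∃ D : SuperOp (MA × MB) Q, IsChannel D ∧
    diamondDist (D ∘ₗ P.channel x y) LinearMap.id ≤ ε

/-- `δ`-security: if `f(x,y) = 0` the messages are simulated by a state independent of the
secret. -/
def IsSecure (P : CDQSProtocol n Q L R MA MB)
    (f : (Fin n → Bool) → (Fin n → Bool) → Bool) (δ : ℝ≥0) : Prop :=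
  ∀ x y, f x y = false → ∃ σ : Matrix (MA × MB) (MA × MB) ℂ, IsDensity σ ∧
    diamondDist (replaceMap σ) (P.channel x y) ≤ δ

end CDQSProtocol

/-! ### Entanglement cost, for one-qubit systems `Q` -/

/-- `FR_{ε₀,ε₁}(f)`, with entanglement cost the log dimension of the resource system `LR`. -/
def frCost {n : ℕ} (ε₀ ε₁ : ℝ≥0) (f : (Fin n → Bool) → (Fin n → Bool) → Bool) : ℝ≥0∞ :=
  ⨅ (l : ℕ) (r : ℕ) (m₀ : ℕ) (m₀' : ℕ) (m₁ : ℕ) (m₁' : ℕ)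
    (P : FRProtocol n (Fin 2) (Fin l) (Fin r) (Fin m₀) (Fin m₀') (Fin m₁) (Fin m₁'))
    (_ : P.IsCorrect f ε₀ ε₁), ENNReal.ofReal (qubits (Fin l × Fin r))

/-- The variant of `frCost` in which the entanglement cost is the log dimension of the smaller one
of `L` and `R`. -/
def frMinCost {n : ℕ} (ε₀ ε₁ : ℝ≥0) (f : (Fin n → Bool) → (Fin n → Bool) → Bool) : ℝ≥0∞ :=
  ⨅ (l : ℕ) (r : ℕ) (m₀ : ℕ) (m₀' : ℕ) (m₁ : ℕ) (m₁' : ℕ)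
    (P : FRProtocol n (Fin 2) (Fin l) (Fin r) (Fin m₀) (Fin m₀') (Fin m₁) (Fin m₁'))
    (_ : P.IsCorrect f ε₀ ε₁), ENNReal.ofReal (min (qubits (Fin l)) (qubits (Fin r)))

/-- `CDQS_{ε,δ}(f)`, with entanglement cost the log dimension of the smaller one of `L` and
`R`. -/
def cdqsCost {n : ℕ} (ε δ : ℝ≥0) (f : (Fin n → Bool) → (Fin n → Bool) → Bool) : ℝ≥0∞ :=
  ⨅ (l : ℕ) (r : ℕ) (mA : ℕ) (mB : ℕ)
    (P : CDQSProtocol n (Fin 2) (Fin l) (Fin r) (Fin mA) (Fin mB))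
    (_ : P.IsCorrect f ε) (_ : P.IsSecure f δ),
    ENNReal.ofReal (min (qubits (Fin l)) (qubits (Fin r)))

end NLQC

end

/-!
Both comparisons of `f`-routing with conditional disclosure of secrets rest on the complementarity
of information and disturbance. Let `V` be a Stinespring dilation of a channel `Q → B` with
environment `E`. The input can be recovered from `E` if and only if the channel to `B` forgets its
input. The quantitative form used here is the continuity of the Stinespring dilation: two channels
at diamond distance `ε` have dilations which, after a suitable contraction of the environment,
have overlap at least `1 - ε / 2` on every input state. For a fixed input state the overlap is
bounded by Uhlmann's theorem and the Powers–Størmer inequality (`exists_overlap_ge`); the minimax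
theorem makes the contraction independent of the state (`exists_uniform_overlap_ge`). Conversely,
channels whose dilations have overlap at least `1 - ε / 2` on every state are at distance at most
`2 √ε` (`diamondDist_le_of_overlap`). This gives `exists_decoder_of_diamondDist_replaceMap_le` and
`exists_replaceMap_of_decoder`, both with the loss `ε ↦ 2 √ε`.

In an `f`-routing protocol, let the systems that end up with Bob be the messages to the referee.
Where `f = 1` Bob decodes, hence so does the referee; where `f = 0` Alice decodes, hence the
referee learns nothing. Conversely, if the resource of a disclosure protocol is pure and the
players use isometric dilations of their channels, then the messages together with the two
environments purify the protocol; Bob receives the messages and Alice the environments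
(`CDQSProtocol.toFR`). The number of Kraus operators in Choi's theorem bounds the size of the
environments. A mixed resource is first purified, with the purifying system held by Bob.

For the equivalence of the costs at the fixed error `0.09`, the error has to be reduced to a
smaller constant before the square root is applied. The secret is encoded into the five-qubit
code, and the protocol is run once for each of the five qubits. The code corrects one arbitrary
error and its two-qubit marginals carry no information; both are consequences of the
Knill–Laflamme condition `codeMatrix_mul_piKron_mul`. Hence the error of decoding is of second
order, and the leakage of third order, in the error of a single run: both are at most `codeError`,
an explicit polynomial with `codeError ε < ε` at `0.09`. Iterating the construction a constant
number of times makes the error so small that `2 √ε ≤ 0.09`, while the number of qubits of `L` and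
`R` grows by a constant factor. Finally, a state of `L R` is the image of a pure state of two
copies of the smaller system under a local channel, which its owner can apply
(`exists_isPure_tensorMap`); hence the cost of `f`-routing, measured by `L R`, is bounded by twice
the smaller one of the two systems of the disclosure protocol.
-/

set_option linter.unusedSectionVars false

noncomputable section

namespace NLQC

/-! ### Super-operators and their Kraus representations -/

section SuperOps

variable {A B C D A' B' C' D' E F : Type*}
  [Fintype A] [DecidableEq A] [Fintype B] [DecidableEq B]
  [Fintype C] [DecidableEq C] [Fintype D] [DecidableEq D] [Fintype C'] [DecidableEq C']
  [Fintype A'] [DecidableEq A'] [Fintype E] [Fintype F]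

theorem superOp_ext {Φ Ψ : SuperOp A B}
    (h : ∀ i j, Φ (Matrix.single i j 1) = Ψ (Matrix.single i j 1)) : Φ = Ψ := by
  refine LinearMap.ext fun X => ?_
  rw [Matrix.matrix_eq_sum_single X]
  simp only [map_sum]
  refine Finset.sum_congr rfl fun i _ => Finset.sum_congr rfl fun j _ => ?_
  have : Matrix.single i j (X i j) = X i j • Matrix.single i j (1 : ℂ) := by
    rw [Matrix.smul_single, smul_eq_mul, mul_one]
  rw [this, map_smul, map_smul, h]

theorem superOp_apply (Φ : SuperOp A B) (X : Matrix A A ℂ) (b b' : B) :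
    Φ X b b' = ∑ i, ∑ j, X i j * Φ (Matrix.single i j 1) b b' := by
  have hX : Φ X = ∑ i, ∑ j, X i j • Φ (Matrix.single i j 1) := by
    conv_lhs => rw [Matrix.matrix_eq_sum_single X]
    simp only [map_sum]
    refine Finset.sum_congr rfl fun i _ => Finset.sum_congr rfl fun j _ => ?_
    rw [← map_smul, Matrix.smul_single, smul_eq_mul, mul_one]
  rw [hX]
  simp only [Matrix.sum_apply, Matrix.smul_apply, smul_eq_mul]

theorem single_prod (i j : A) (k l : C) :
    (Matrix.single (i, k) (j, l) 1 : Matrix (A × C) (A × C) ℂ)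
      = Matrix.single i j 1 ⊗ₖ Matrix.single k l 1 := by
  rw [Matrix.single_kronecker_single, mul_one]

theorem superOp_prod_ext {Φ Ψ : SuperOp (A × C) B}
    (h : ∀ (X : Matrix A A ℂ) (Y : Matrix C C ℂ), Φ (X ⊗ₖ Y) = Ψ (X ⊗ₖ Y)) : Φ = Ψ := by
  refine superOp_ext fun ⟨i, k⟩ ⟨j, l⟩ => ?_
  rw [single_prod, h]

theorem tensorMap_apply (Φ : SuperOp A B) (Ψ : SuperOp C D) (X : Matrix (A × C) (A × C) ℂ)
    (b b' : B) (d d' : D) :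
    tensorMap Φ Ψ X (b, d) (b', d') = ∑ i, ∑ j, ∑ k, ∑ l, X (i, k) (j, l) *
      (Φ (Matrix.single i j 1) b b' * Ψ (Matrix.single k l 1) d d') := by
  simp only [tensorMap, LinearMap.coe_mk, AddHom.coe_mk, Matrix.sum_apply, Matrix.smul_apply,
    Matrix.kroneckerMap_apply, smul_eq_mul]

theorem tensorMap_comp (Φ : SuperOp A B) (Ψ : SuperOp C D) (Φ' : SuperOp A' A)
    (Ψ' : SuperOp C' C) :
    tensorMap (Φ ∘ₗ Φ') (Ψ ∘ₗ Ψ') = tensorMap Φ Ψ ∘ₗ tensorMap Φ' Ψ' := by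
  refine superOp_prod_ext fun X Y => ?_
  simp only [tensorMap_kronecker, LinearMap.comp_apply]

theorem tensorMap_id_id :
    tensorMap (LinearMap.id : SuperOp A A) (LinearMap.id : SuperOp C C) = LinearMap.id := by
  refine superOp_prod_ext fun X Y => ?_
  simp only [tensorMap_kronecker, LinearMap.id_apply]

theorem tensorMap_sub_right (Φ : SuperOp A B) (Ψ Ψ' : SuperOp C D) :
    tensorMap Φ (Ψ - Ψ') = tensorMap Φ Ψ - tensorMap Φ Ψ' := by
  refine superOp_prod_ext fun X Y => ?_
  simp only [tensorMap_kronecker, LinearMap.sub_apply]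
  ext ⟨i, j⟩ ⟨i', j'⟩
  simp [mul_sub]

theorem tensorMap_add_right (Φ : SuperOp A B) (Ψ Ψ' : SuperOp C D) :
    tensorMap Φ (Ψ + Ψ') = tensorMap Φ Ψ + tensorMap Φ Ψ' := by
  refine superOp_prod_ext fun X Y => ?_
  simp only [tensorMap_kronecker, LinearMap.add_apply]
  ext ⟨i, j⟩ ⟨i', j'⟩
  simp [mul_add]

/-- The completely positive map `X ↦ ∑ₑ kₑ X kₑ†` with Kraus operators `k`. -/
def krausMap (k : E → Matrix B A ℂ) : SuperOp A B where
  toFun X := ∑ e, k e * X * (k e).conjTranspose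
  map_add' X Y := by simp only [Matrix.mul_add, Matrix.add_mul, Finset.sum_add_distrib]
  map_smul' c X := by
    simp only [Matrix.mul_smul, Matrix.smul_mul, Finset.smul_sum, RingHom.id_apply]

theorem krausMap_apply (k : E → Matrix B A ℂ) (X : Matrix A A ℂ) :
    krausMap k X = ∑ e, k e * X * (k e).conjTranspose := rfl

theorem krausMap_apply_apply (k : E → Matrix B A ℂ) (X : Matrix A A ℂ) (b b' : B) :
    krausMap k X b b' = ∑ e, ∑ a, ∑ a', k e b a * X a a' * star (k e b' a') := by
  simp only [krausMap_apply, Matrix.sum_apply]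
  refine Finset.sum_congr rfl fun e _ => ?_
  simp only [Matrix.mul_apply, Matrix.conjTranspose_apply, Finset.sum_mul]
  rw [Finset.sum_comm]

/-- The Kraus operators of the complementary channel: `B` is the environment and `E` is the
output. -/
def krausCompl (k : E → Matrix B A ℂ) : B → Matrix E A ℂ :=
  fun b => Matrix.of fun e a => k e b a

theorem krausMap_id : krausMap (fun _ : Unit => (1 : Matrix A A ℂ)) = LinearMap.id := by
  refine LinearMap.ext fun X => ?_
  simp [krausMap_apply]

theorem krausMap_equiv (e : F ≃ E) (k : E → Matrix B A ℂ) :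
    krausMap (fun f => k (e f)) = krausMap k := by
  refine LinearMap.ext fun X => ?_
  simp only [krausMap_apply]
  exact e.sum_comp (fun f => k f * X * (k f).conjTranspose)

theorem krausMap_comp (k : E → Matrix C B ℂ) (l : F → Matrix B A ℂ) :
    krausMap k ∘ₗ krausMap l = krausMap (fun p : E × F => k p.1 * l p.2) := by
  refine LinearMap.ext fun X => ?_
  simp only [krausMap_apply, LinearMap.comp_apply, Fintype.sum_prod_type,
    Matrix.mul_sum, Matrix.sum_mul, Matrix.conjTranspose_mul, Matrix.mul_assoc]

theorem tensorMap_krausMap (k : E → Matrix B A ℂ) (l : F → Matrix D C ℂ) :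
    tensorMap (krausMap k) (krausMap l) = krausMap (fun p : E × F => k p.1 ⊗ₖ l p.2) := by
  refine superOp_prod_ext fun X Y => ?_
  rw [tensorMap_kronecker]
  simp only [krausMap_apply, Fintype.sum_prod_type, Matrix.conjTranspose_kronecker,
    ← Matrix.mul_kronecker_mul]
  ext ⟨i, j⟩ ⟨i', j'⟩
  simp [Matrix.sum_apply, Finset.sum_mul_sum]

theorem tensorMap_id_krausMap (l : F → Matrix D C ℂ) :
    tensorMap (LinearMap.id : SuperOp A A) (krausMap l)
      = krausMap (fun f => (1 : Matrix A A ℂ) ⊗ₖ l f) := by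
  rw [← krausMap_id, tensorMap_krausMap, ← krausMap_equiv (Equiv.punitProd F).symm]
  rfl

theorem krausMap_posSemidef (k : E → Matrix B A ℂ) {X : Matrix A A ℂ} (hX : X.PosSemidef) :
    (krausMap k X).PosSemidef :=
  Matrix.posSemidef_sum _ fun e _ => hX.mul_mul_conjTranspose_same (k e)

theorem trace_krausMap (k : E → Matrix B A ℂ) (X : Matrix A A ℂ) :
    (krausMap k X).trace = ((∑ e, (k e).conjTranspose * k e) * X).trace := by
  simp only [krausMap_apply, Matrix.trace_sum, Matrix.sum_mul]
  refine Finset.sum_congr rfl fun e _ => ?_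
  rw [Matrix.trace_mul_comm, Matrix.mul_assoc]

theorem eq_one_of_trace_mul {M : Matrix A A ℂ} (h : ∀ X : Matrix A A ℂ, (M * X).trace = X.trace) :
    M = 1 := by
  ext i j
  have h1 : M i j = (Matrix.single j i (1 : ℂ)).trace := by
    rw [← h (Matrix.single j i 1)]
    simp [Matrix.trace_mul_single]
  rw [h1]
  by_cases hij : i = j
  · subst hij; simp
  · rw [Matrix.trace_single_eq_of_ne _ _ _ (Ne.symm hij), Matrix.one_apply_ne hij]

/-- A Kraus family defines a trace preserving map. -/
def IsTP (k : E → Matrix B A ℂ) : Prop := ∑ e, (k e).conjTranspose * k e = 1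

theorem IsTP.isChannel {k : E → Matrix B A ℂ} (h : IsTP k) : IsChannel (krausMap k) where
  completelyPositive n X hX := by
    rw [tensorMap_id_krausMap]
    exact krausMap_posSemidef _ hX
  trace_preserving X := by
    rw [trace_krausMap, show ∑ e, (k e).conjTranspose * k e = 1 from h, Matrix.one_mul]

theorem isTP_of_trace_preserving {k : E → Matrix B A ℂ}
    (h : ∀ X, (krausMap k X).trace = X.trace) : IsTP k :=
  eq_one_of_trace_mul fun X => by rw [← trace_krausMap, h]

theorem exists_eq_mul_conjTranspose {P : Matrix A A ℂ} (hP : P.PosSemidef) :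
    ∃ S : Matrix A A ℂ, P = S * S.conjTranspose := by
  open scoped MatrixOrder in
  have h0 : 0 ≤ P := Matrix.nonneg_iff_posSemidef.mpr hP
  obtain ⟨b, hb⟩ := CStarAlgebra.nonneg_iff_eq_mul_star_self.mp h0
  exact ⟨b, hb⟩

/-- Choi's theorem: a completely positive map has a Kraus representation with `d_A d_B` Kraus
operators. -/
theorem IsCompletelyPositive.exists_kraus {Φ : SuperOp A B} (h : IsCompletelyPositive Φ) :
    ∃ k : A × B → Matrix B A ℂ, Φ = krausMap k := by
  set e : A ≃ Fin (Fintype.card A) := Fintype.equivFin A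
  set ω : Fin (Fintype.card A) × A → ℂ := fun p => if p.1 = e p.2 then 1 else 0 with hω
  have hpos := h _ _ (Matrix.posSemidef_vecMulVec_self_star ω)
  obtain ⟨S, hS⟩ := exists_eq_mul_conjTranspose hpos
  have key : ∀ (a a' : A) (b b' : B),
      Φ (Matrix.single a a' 1) b b' = ∑ p, S (e a, b) p * star (S (e a', b') p) := by
    intro a a' b b'
    have h1 := congrFun (congrFun hS (e a, b)) (e a', b')
    rw [tensorMap_apply, Matrix.mul_apply] at h1
    simp only [Matrix.conjTranspose_apply] at h1
    rw [← h1]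
    simp [hω, Matrix.vecMulVec_apply, Matrix.single_apply, ite_and]
  refine ⟨fun p => Matrix.of fun b a => S (e a, b) (e p.1, p.2), ?_⟩
  refine superOp_ext fun a a' => ?_
  ext b b'
  rw [key, krausMap_apply_apply, ← (e.prodCongr (Equiv.refl B)).sum_comp]
  refine Finset.sum_congr rfl fun p _ => ?_
  simp [Matrix.single_apply, ite_and, Prod.map]

theorem IsChannel.exists_kraus {Φ : SuperOp A B} (h : IsChannel Φ) :
    ∃ k : A × B → Matrix B A ℂ, Φ = krausMap k ∧ IsTP k := by
  obtain ⟨k, rfl⟩ := h.completelyPositive.exists_kraus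
  exact ⟨k, rfl, isTP_of_trace_preserving h.trace_preserving⟩

theorem IsTP.comp {k : E → Matrix C B ℂ} {l : F → Matrix B A ℂ} (hk : IsTP k) (hl : IsTP l) :
    IsTP (fun p : E × F => k p.1 * l p.2) := by
  refine isTP_of_trace_preserving fun X => ?_
  rw [← krausMap_comp, LinearMap.comp_apply, hk.isChannel.trace_preserving,
    hl.isChannel.trace_preserving]

theorem IsTP.kronecker {k : E → Matrix B A ℂ} {l : F → Matrix D C ℂ} (hk : IsTP k) (hl : IsTP l) :
    IsTP (fun p : E × F => k p.1 ⊗ₖ l p.2) := by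
  simp only [IsTP, Matrix.conjTranspose_kronecker, ← Matrix.mul_kronecker_mul,
    Fintype.sum_prod_type] at hk hl ⊢
  rw [← Matrix.one_kronecker_one, ← hk, ← hl]
  ext ⟨i, j⟩ ⟨i', j'⟩
  simp [Matrix.sum_apply, Finset.sum_mul_sum]

theorem IsTP.one_kronecker {l : F → Matrix D C ℂ} (hl : IsTP l) :
    IsTP (fun f => (1 : Matrix A A ℂ) ⊗ₖ l f) := by
  simp only [IsTP, Matrix.conjTranspose_kronecker, ← Matrix.mul_kronecker_mul] at hl ⊢
  rw [← Matrix.one_kronecker_one, ← hl]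
  ext ⟨i, j⟩ ⟨i', j'⟩
  simp [Matrix.sum_apply, Finset.mul_sum]

theorem IsChannel.comp {Φ : SuperOp B C} {Ψ : SuperOp A B} (hΦ : IsChannel Φ)
    (hΨ : IsChannel Ψ) : IsChannel (Φ ∘ₗ Ψ) := by
  obtain ⟨k, rfl, hk⟩ := hΦ.exists_kraus
  obtain ⟨l, rfl, hl⟩ := hΨ.exists_kraus
  rw [krausMap_comp]
  exact (hk.comp hl).isChannel

theorem IsChannel.tensorMap {Φ : SuperOp A B} {Ψ : SuperOp C D} (hΦ : IsChannel Φ)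
    (hΨ : IsChannel Ψ) : IsChannel (tensorMap Φ Ψ) := by
  obtain ⟨k, rfl, hk⟩ := hΦ.exists_kraus
  obtain ⟨l, rfl, hl⟩ := hΨ.exists_kraus
  rw [tensorMap_krausMap]
  exact (hk.kronecker hl).isChannel

theorem isChannel_id : IsChannel (LinearMap.id : SuperOp A A) := by
  rw [← krausMap_id]
  exact IsTP.isChannel (by simp [IsTP])

theorem IsChannel.isDensity {Φ : SuperOp A B} (h : IsChannel Φ) {ρ : Matrix A A ℂ}
    (hρ : IsDensity ρ) : IsDensity (Φ ρ) := by
  obtain ⟨k, rfl, hk⟩ := h.exists_kraus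
  exact ⟨krausMap_posSemidef k hρ.1, by rw [h.trace_preserving, hρ.2]⟩

theorem IsDensity.nonempty {ρ : Matrix A A ℂ} (h : IsDensity ρ) : Nonempty A := by
  by_contra hA
  rw [not_nonempty_iff] at hA
  have := h.2
  simp [Matrix.trace] at this

theorem IsChannel.nonempty [Nonempty A] {Φ : SuperOp A B} (h : IsChannel Φ) : Nonempty B := by
  obtain ⟨a⟩ := ‹Nonempty A›
  refine (h.isDensity (ρ := Matrix.single a a 1) ⟨?_, by simp⟩).nonempty
  have : (Matrix.single a a 1 : Matrix A A ℂ)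
      = Matrix.vecMulVec (Pi.single a 1) (star (Pi.single a 1)) := by
    ext i j
    simp only [Matrix.vecMulVec_apply, Matrix.single_apply, Pi.single_apply, Pi.star_apply]
    by_cases h1 : a = i <;> by_cases h2 : a = j <;> simp [h1, h2, eq_comm]
  rw [this]
  exact Matrix.posSemidef_vecMulVec_self_star _

/-! ### Relabelling of bases, partial traces, adjoining a resource -/

/-- The relabelling of the basis of a system by a bijection. -/
def reindexMap (e : A ≃ B) : SuperOp A B where
  toFun X := X.submatrix e.symm e.symm
  map_add' _ _ := rfl
  map_smul' _ _ := rfl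

@[simp] theorem reindexMap_apply (e : A ≃ B) (X : Matrix A A ℂ) (b b' : B) :
    reindexMap e X b b' = X (e.symm b) (e.symm b') := rfl

theorem reindexMap_symm_comp (e : A ≃ B) : reindexMap e.symm ∘ₗ reindexMap e = LinearMap.id := by
  refine LinearMap.ext fun X => ?_
  ext; simp

theorem reindexMap_eq_krausMap (e : A ≃ B) :
    reindexMap e = krausMap (fun _ : Unit => Matrix.of fun b a => if b = e a then 1 else 0) := by
  refine LinearMap.ext fun X => ?_
  ext b b'
  simp [krausMap_apply_apply, ← Equiv.symm_apply_eq]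

theorem isChannel_reindexMap (e : A ≃ B) : IsChannel (reindexMap e) := by
  have h := reindexMap_eq_krausMap e
  have : IsTP (fun _ : Unit => (Matrix.of fun b a => if b = e a then 1 else 0 : Matrix B A ℂ)) := by
    refine isTP_of_trace_preserving fun X => ?_
    rw [← h]
    exact e.symm.sum_comp fun a => X a a
  rw [h]
  exact this.isChannel

theorem traceFst_apply (X : Matrix (A × B) (A × B) ℂ) (b b' : B) :
    traceFst X b b' = ∑ a, X (a, b) (a, b') := rfl

theorem traceSnd_apply (X : Matrix (A × B) (A × B) ℂ) (a a' : A) :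
    traceSnd X a a' = ∑ b, X (a, b) (a', b) := rfl

theorem traceFst_eq_krausMap : (traceFst : SuperOp (A × B) B) =
    krausMap (fun a : A => Matrix.of fun b p => if a = p.1 ∧ b = p.2 then 1 else 0) := by
  refine LinearMap.ext fun X => ?_
  ext b b'
  simp [krausMap_apply_apply, traceFst_apply, Fintype.sum_prod_type, ite_and, apply_ite]

theorem traceSnd_eq_krausMap : (traceSnd : SuperOp (A × B) A) =
    krausMap (fun b : B => Matrix.of fun a p => if a = p.1 ∧ b = p.2 then 1 else 0) := by
  refine LinearMap.ext fun X => ?_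
  ext b b'
  simp [krausMap_apply_apply, traceSnd_apply, Fintype.sum_prod_type, ite_and, apply_ite]

theorem isChannel_traceFst : IsChannel (traceFst : SuperOp (A × B) B) := by
  have h := traceFst_eq_krausMap (A := A) (B := B)
  rw [h]
  refine IsTP.isChannel (isTP_of_trace_preserving fun X => ?_)
  rw [← h]
  simp [Matrix.trace, traceFst_apply, Fintype.sum_prod_type, Finset.sum_comm (γ := B)]

theorem isChannel_traceSnd : IsChannel (traceSnd : SuperOp (A × B) A) := by
  have h := traceSnd_eq_krausMap (A := A) (B := B)
  rw [h]
  refine IsTP.isChannel (isTP_of_trace_preserving fun X => ?_)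
  rw [← h]
  simp [Matrix.trace, traceSnd_apply, Fintype.sum_prod_type]

theorem replaceMap_mul_conjTranspose (S : Matrix B E ℂ) :
    (replaceMap (S * S.conjTranspose) : SuperOp A B) =
      krausMap (fun p : A × E => Matrix.of fun b a => if a = p.1 then S b p.2 else 0) := by
  refine LinearMap.ext fun X => ?_
  ext b b'
  simp [krausMap_apply_apply, replaceMap, Matrix.mul_apply, Fintype.sum_prod_type, apply_ite,
    Matrix.trace, Finset.sum_mul_sum]
  refine Finset.sum_congr rfl fun i _ => Finset.sum_congr rfl fun j _ => ?_
  ring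

theorem trace_replaceMap {σ : Matrix B B ℂ} (hσ : σ.trace = 1) (X : Matrix A A ℂ) :
    (replaceMap σ X).trace = X.trace := by
  simp [replaceMap, Matrix.trace_smul, hσ]

theorem isChannel_replaceMap {σ : Matrix B B ℂ} (hσ : IsDensity σ) :
    IsChannel (replaceMap σ : SuperOp A B) := by
  obtain ⟨S, rfl⟩ := exists_eq_mul_conjTranspose hσ.1
  rw [replaceMap_mul_conjTranspose]
  refine IsTP.isChannel (isTP_of_trace_preserving fun X => ?_)
  rw [← replaceMap_mul_conjTranspose, trace_replaceMap hσ.2]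

/-- A Kraus family of a trace non-increasing map extends to that of a channel. -/
theorem exists_isTP_sumElim [Nonempty B] {k : E → Matrix B A ℂ}
    (hk : (1 - ∑ e, (k e).conjTranspose * k e).PosSemidef) :
    ∃ l : A → Matrix B A ℂ, IsTP (Sum.elim k l) := by
  obtain ⟨b₀⟩ := ‹Nonempty B›
  obtain ⟨S, hS⟩ := exists_eq_mul_conjTranspose hk
  have h : ∑ a, (Matrix.of fun b a' => if b = b₀ then star (S a' a) else 0 :
      Matrix B A ℂ).conjTranspose * Matrix.of (fun b a' => if b = b₀ then star (S a' a) else 0) =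
      1 - ∑ e, (k e).conjTranspose * k e := by
    rw [hS]
    ext a a'
    simp [Matrix.sum_apply, Matrix.mul_apply, apply_ite]
  refine ⟨fun a => Matrix.of fun b a' => if b = b₀ then star (S a' a) else 0, ?_⟩
  unfold IsTP
  rw [Fintype.sum_sum_type]
  simp only [Sum.elim_inl, Sum.elim_inr]
  rw [h, add_sub_cancel]

end SuperOps

/-! ### Square roots, polar decompositions and contractions -/

section Matrices

variable {m n p : Type*} [Fintype m] [DecidableEq m] [Fintype n] [DecidableEq n]
  [Fintype p] [DecidableEq p]

theorem exists_unitary_diagonal {A : Matrix n n ℂ} (h : A.IsHermitian) :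
    ∃ U : Matrix n n ℂ, U.conjTranspose * U = 1 ∧ U * U.conjTranspose = 1 ∧
      A = U * Matrix.diagonal (fun i => (h.eigenvalues i : ℂ)) * U.conjTranspose := by
  refine ⟨h.eigenvectorUnitary, ?_, ?_, ?_⟩
  · rw [← Matrix.star_eq_conjTranspose]
    exact Unitary.coe_star_mul_self _
  · rw [← Matrix.star_eq_conjTranspose]
    exact Unitary.coe_mul_star_self _
  · conv_lhs => rw [h.spectral_theorem, Unitary.conjStarAlgAut_apply]
    rfl

/-- A positive semidefinite square root `S` of `P`, together with its Moore–Penrose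
pseudo-inverse `G`. -/
theorem exists_sqrt {P : Matrix n n ℂ} (hP : P.PosSemidef) :
    ∃ S G : Matrix n n ℂ, S.PosSemidef ∧ S * S = P ∧ G.IsHermitian ∧ S * G * S = S ∧
      G * S = S * G ∧ (1 - G * S).PosSemidef ∧
      S.trace = ∑ i, ((Real.sqrt (hP.1.eigenvalues i) : ℝ) : ℂ) := by
  obtain ⟨U, hU, hU', hA⟩ := exists_unitary_diagonal hP.1
  set l := hP.1.eigenvalues with hl
  set F : (n → ℝ) → Matrix n n ℂ :=
    fun f => U * Matrix.diagonal (fun i => (f i : ℂ)) * U.conjTranspose with hF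
  have hmul : ∀ f g, F f * F g = F (f * g) := by
    intro f g
    calc F f * F g = U * Matrix.diagonal (fun i => (f i : ℂ)) * (U.conjTranspose * U) *
          Matrix.diagonal (fun i => (g i : ℂ)) * U.conjTranspose := by
            simp only [hF, Matrix.mul_assoc]
      _ = _ := by
            rw [hU, Matrix.mul_one, Matrix.mul_assoc U, Matrix.diagonal_mul_diagonal]
            simp [hF]
  have hpos : ∀ f : n → ℝ, (∀ i, 0 ≤ f i) → (F f).PosSemidef := by
    intro f hf
    refine Matrix.PosSemidef.mul_mul_conjTranspose_same ?_ U
    rw [Matrix.posSemidef_diagonal_iff]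
    intro i
    exact_mod_cast hf i
  have hone : F 1 = 1 := by simp [hF, hU']
  have hsub : ∀ f g, F f - F g = F (f - g) := by
    intro f g
    simp only [hF, ← Matrix.sub_mul, ← Matrix.mul_sub, Matrix.diagonal_sub]
    simp
  have hl0 : ∀ i, 0 ≤ l i := hP.eigenvalues_nonneg
  refine ⟨F fun i => Real.sqrt (l i), F fun i => (Real.sqrt (l i))⁻¹, hpos _ fun i => by positivity,
    ?_, (hpos _ fun i => by positivity).1, ?_, ?_, ?_, ?_⟩
  · rw [hmul]
    conv_rhs => rw [hA]
    simp only [hF, Pi.mul_apply, Real.mul_self_sqrt (hl0 _)]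
  · rw [hmul, hmul]
    congr 1
    ext i
    simp only [Pi.mul_apply]
    by_cases h : Real.sqrt (l i) = 0
    · simp [h]
    · field_simp
  · rw [hmul, hmul, mul_comm]
  · rw [hmul, ← hone, hsub]
    refine hpos _ fun i => ?_
    by_cases h : Real.sqrt (l i) = 0
    · simp [h]
    · simp [h]
  · simp only [hF]
    rw [Matrix.trace_mul_comm, ← Matrix.mul_assoc, hU, Matrix.one_mul, Matrix.trace_diagonal]

/-- Matrices of operator norm at most one. -/
def IsContraction (S : Matrix m n ℂ) : Prop := (1 - S.conjTranspose * S).PosSemidef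

theorem IsContraction.conjTranspose {S : Matrix m n ℂ} (h : IsContraction S) :
    IsContraction S.conjTranspose := by
  have h1 : (1 : Matrix m m ℂ) - S * S.conjTranspose =
      (1 - S * S.conjTranspose) * (1 - S * S.conjTranspose).conjTranspose +
        S * (1 - S.conjTranspose * S) * S.conjTranspose := by
    simp only [Matrix.conjTranspose_sub, Matrix.conjTranspose_one, Matrix.conjTranspose_mul,
      Matrix.conjTranspose_conjTranspose, Matrix.mul_sub, Matrix.sub_mul, Matrix.mul_one,
      Matrix.one_mul, Matrix.mul_assoc]
    abel
  unfold IsContraction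
  rw [Matrix.conjTranspose_conjTranspose, h1]
  exact (Matrix.posSemidef_self_mul_conjTranspose _).add (h.mul_mul_conjTranspose_same S)

theorem IsContraction.mul {S : Matrix m n ℂ} {T : Matrix n p ℂ} (hS : IsContraction S)
    (hT : IsContraction T) : IsContraction (S * T) := by
  have h1 : 1 - (S * T).conjTranspose * (S * T) =
      (1 - T.conjTranspose * T) + T.conjTranspose * (1 - S.conjTranspose * S) * T := by
    rw [Matrix.conjTranspose_mul]
    simp only [Matrix.mul_sub, Matrix.sub_mul, Matrix.mul_one, Matrix.mul_assoc]
    abel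
  unfold IsContraction
  rw [h1]
  exact Matrix.PosSemidef.add hT (hS.conjTranspose_mul_mul_same T)

/-- The (left) polar decomposition `A = S W` with `S = √(A A†)`. -/
theorem exists_polar {P : Matrix m m ℂ} (hP : P.PosSemidef) {A : Matrix m n ℂ}
    (hA : A * A.conjTranspose = P) :
    ∃ (S : Matrix m m ℂ) (W : Matrix m n ℂ), S.PosSemidef ∧ S * S = P ∧ A = S * W ∧
      W * W.conjTranspose * S = S ∧ IsContraction W ∧
      S.trace = ∑ i, ((Real.sqrt (hP.1.eigenvalues i) : ℝ) : ℂ) := by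
  obtain ⟨S, G, hS, hSS, hG, hSGS, hcomm, hcontr, htr⟩ := exists_sqrt hP
  have hWW : G * A * (G * A).conjTranspose = G * S := by
    calc G * A * (G * A).conjTranspose = G * (A * A.conjTranspose) * G := by
          rw [Matrix.conjTranspose_mul, hG.eq]; simp only [Matrix.mul_assoc]
      _ = G * S * (S * G) := by rw [hA, ← hSS]; simp only [Matrix.mul_assoc]
      _ = G * S * (G * S) := by rw [hcomm]
      _ = G * (S * G * S) := by simp only [Matrix.mul_assoc]
      _ = G * S := by rw [hSGS]
  refine ⟨S, G * A, hS, hSS, ?_, ?_, ?_, htr⟩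
  · set D : Matrix m m ℂ := 1 - S * G with hD
    have h0 : (D * A) * (D * A).conjTranspose = 0 := by
      calc (D * A) * (D * A).conjTranspose = D * (A * A.conjTranspose) * D.conjTranspose := by
            rw [Matrix.conjTranspose_mul]; simp only [Matrix.mul_assoc]
        _ = (S - S * G * S) * S * D.conjTranspose := by
            rw [hA, ← hSS, hD]; noncomm_ring
        _ = 0 := by rw [hSGS]; simp
    rw [Matrix.self_mul_conjTranspose_eq_zero, hD, Matrix.sub_mul, Matrix.one_mul, sub_eq_zero] at h0
    rw [← Matrix.mul_assoc]
    exact h0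
  · rw [hWW, hcomm, hSGS]
  · have : IsContraction (G * A).conjTranspose := by
      unfold IsContraction
      rw [Matrix.conjTranspose_conjTranspose, hWW]
      exact hcontr
    simpa using this.conjTranspose

/-! ### The trace norm -/

theorem norm_sum_mul_le {ι : Type*} (s : Finset ι) (f g : ι → ℂ) :
    ‖∑ i ∈ s, f i * g i‖ ≤ Real.sqrt (∑ i ∈ s, ‖f i‖ ^ 2) * Real.sqrt (∑ i ∈ s, ‖g i‖ ^ 2) :=
  (norm_sum_le _ _).trans <| by
    simp only [norm_mul]
    exact Real.sum_mul_le_sqrt_mul_sqrt _ _ _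

theorem IsContraction.trace_mul_le {S : Matrix n n ℂ} (hS : IsContraction S) (X : Matrix n n ℂ) :
    (S * X).trace.re ≤ traceNorm X := by
  have hX := Matrix.isHermitian_conjTranspose_mul_self X
  obtain ⟨U, hU, hU', hA⟩ := exists_unitary_diagonal hX
  have h1 : (S * X).trace = ∑ i, ∑ j, (U.conjTranspose * S) i j * (X * U) j i := by
    have : (S * X).trace = ((U.conjTranspose * S) * (X * U)).trace := by
      rw [Matrix.trace_mul_comm (U.conjTranspose * S), Matrix.mul_assoc,
        ← Matrix.mul_assoc U, hU', Matrix.one_mul, Matrix.trace_mul_comm]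
    rw [this]
    simp only [Matrix.trace, Matrix.diag_apply, Matrix.mul_apply]
  rw [h1, Complex.re_sum]
  refine Finset.sum_le_sum fun i _ => ?_
  refine (Complex.re_le_norm _).trans ((norm_sum_mul_le _ _ _).trans ?_)
  have h2 : ∑ j, ‖(X * U) j i‖ ^ 2 = hX.eigenvalues i := by
    have h3 : ((X * U).conjTranspose * (X * U)) i i = hX.eigenvalues i := by
      have : (X * U).conjTranspose * (X * U) =
          Matrix.diagonal (fun i => (hX.eigenvalues i : ℂ)) := by
        calc (X * U).conjTranspose * (X * U) = U.conjTranspose * (X.conjTranspose * X) * U := by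
              rw [Matrix.conjTranspose_mul]; simp only [Matrix.mul_assoc]
          _ = (U.conjTranspose * U) * Matrix.diagonal (fun i => (hX.eigenvalues i : ℂ)) *
              (U.conjTranspose * U) := by conv_lhs => rw [hA]
                                          simp only [Matrix.mul_assoc]
          _ = _ := by rw [hU, Matrix.one_mul, Matrix.mul_one]
      rw [this, Matrix.diagonal_apply_eq]
    have h4 : ((∑ j, ‖(X * U) j i‖ ^ 2 : ℝ) : ℂ) = hX.eigenvalues i := by
      rw [← h3, Matrix.mul_apply]
      push_cast
      refine Finset.sum_congr rfl fun j _ => ?_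
      rw [Matrix.conjTranspose_apply, ← Complex.conj_mul']
      rfl
    exact_mod_cast h4
  have h5 : ∑ j, ‖(U.conjTranspose * S) i j‖ ^ 2 ≤ 1 := by
    have hc : IsContraction (U.conjTranspose * S).conjTranspose := by
      refine IsContraction.conjTranspose (IsContraction.mul ?_ hS)
      simp [IsContraction, hU', Matrix.PosSemidef.zero]
    have := hc.diag_nonneg (i := i)
    rw [Matrix.conjTranspose_conjTranspose, Matrix.sub_apply, Matrix.one_apply_eq,
      Matrix.mul_apply] at this
    have h4 : ((∑ j, ‖(U.conjTranspose * S) i j‖ ^ 2 : ℝ) : ℂ) =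
        ∑ j, (U.conjTranspose * S) i j * (U.conjTranspose * S).conjTranspose j i := by
      push_cast
      refine Finset.sum_congr rfl fun j _ => ?_
      rw [Matrix.conjTranspose_apply, ← Complex.mul_conj']
      rfl
    rw [← h4] at this
    have h6 : (0 : ℝ) ≤ 1 - ∑ j, ‖(U.conjTranspose * S) i j‖ ^ 2 := by exact_mod_cast this
    linarith
  rw [h2]
  calc _ ≤ 1 * Real.sqrt (hX.eigenvalues i) :=
        mul_le_mul_of_nonneg_right (Real.sqrt_le_one.mpr h5) (Real.sqrt_nonneg _)
    _ = _ := one_mul _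

theorem exists_contraction_trace_mul_eq (X : Matrix n n ℂ) :
    ∃ S : Matrix n n ℂ, IsContraction S ∧ (S * X).trace = traceNorm X := by
  obtain ⟨T, W, hT, -, hA, hW, hc, htr⟩ := exists_polar
    (Matrix.posSemidef_conjTranspose_mul_self X) (A := X.conjTranspose) (by simp)
  refine ⟨W, hc, ?_⟩
  have h1 : X = W.conjTranspose * T := by
    have := congrArg Matrix.conjTranspose hA
    rwa [Matrix.conjTranspose_conjTranspose, Matrix.conjTranspose_mul, hT.1.eq] at this
  have h2 : W * X = T := by
    rw [h1, ← Matrix.mul_assoc, hW]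
  rw [h2, htr, traceNorm]
  push_cast
  rfl

/-- The trace norm is the maximum of `Re tr (S X)` over contractions `S`. -/
theorem traceNorm_le_iff {X : Matrix n n ℂ} {r : ℝ} :
    traceNorm X ≤ r ↔ ∀ S : Matrix n n ℂ, IsContraction S → (S * X).trace.re ≤ r := by
  refine ⟨fun h S hS => (hS.trace_mul_le X).trans h, fun h => ?_⟩
  obtain ⟨S, hS, hSX⟩ := exists_contraction_trace_mul_eq X
  have := h S hS
  rwa [hSX, Complex.ofReal_re] at this

theorem traceNorm_nonneg (X : Matrix n n ℂ) : 0 ≤ traceNorm X :=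
  Finset.sum_nonneg fun _ _ => Real.sqrt_nonneg _

theorem traceNorm_add_le (X Y : Matrix n n ℂ) : traceNorm (X + Y) ≤ traceNorm X + traceNorm Y := by
  rw [traceNorm_le_iff]
  intro S hS
  rw [Matrix.mul_add, Matrix.trace_add, Complex.add_re]
  exact add_le_add (hS.trace_mul_le X) (hS.trace_mul_le Y)

theorem IsContraction.smul_of_norm_le {S : Matrix m n ℂ} (hS : IsContraction S) {c : ℂ}
    (hc : ‖c‖ ≤ 1) : IsContraction (c • S) := by
  have h1 : 1 - (c • S).conjTranspose * (c • S) = ((‖c‖ ^ 2 : ℝ) : ℂ) • (1 - S.conjTranspose * S) +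
      ((1 - ‖c‖ ^ 2 : ℝ) : ℂ) • 1 := by
    rw [Matrix.conjTranspose_smul, Matrix.smul_mul, Matrix.mul_smul, smul_smul,
      show star c * c = ((‖c‖ ^ 2 : ℝ) : ℂ) by push_cast; exact Complex.conj_mul' c, smul_sub]
    push_cast
    rw [sub_smul, one_smul]
    abel
  unfold IsContraction
  rw [h1]
  refine (Matrix.PosSemidef.smul hS ?_).add (Matrix.PosSemidef.one.smul ?_)
  · exact_mod_cast sq_nonneg ‖c‖
  · have : 0 ≤ 1 - ‖c‖ ^ 2 := by nlinarith [norm_nonneg c]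
    exact_mod_cast this

theorem traceNorm_smul_le (c : ℂ) (X : Matrix n n ℂ) : traceNorm (c • X) ≤ ‖c‖ * traceNorm X := by
  rw [traceNorm_le_iff]
  intro S hS
  by_cases hc : c = 0
  · simp [hc]
  have hn : ‖c‖ ≠ 0 := norm_ne_zero_iff.mpr hc
  have h1 := (hS.smul_of_norm_le (c := c / ‖c‖) (by simp [hn])).trace_mul_le X
  have h2 : (S * c • X).trace = (‖c‖ : ℂ) * ((c / ‖c‖) • S * X).trace := by
    rw [Matrix.mul_smul, Matrix.smul_mul, Matrix.trace_smul, Matrix.trace_smul, smul_eq_mul,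
      smul_eq_mul, ← mul_assoc, mul_div_cancel₀]
    exact_mod_cast hn
  rw [h2, Complex.re_ofReal_mul]
  exact mul_le_mul_of_nonneg_left h1 (norm_nonneg c)

theorem traceNorm_neg (X : Matrix n n ℂ) : traceNorm (-X) = traceNorm X := by
  have h : ∀ Y : Matrix n n ℂ, traceNorm (-Y) ≤ traceNorm Y := fun Y => by
    simpa using traceNorm_smul_le (-1) Y
  exact le_antisymm (h X) (by simpa using h (-X))

theorem traceNorm_sum_le {ι : Type*} (s : Finset ι) (X : ι → Matrix n n ℂ) :
    traceNorm (∑ i ∈ s, X i) ≤ ∑ i ∈ s, traceNorm (X i) := by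
  induction s using Finset.cons_induction with
  | empty =>
    rw [Finset.sum_empty, Finset.sum_empty, traceNorm_le_iff]
    intro S _
    simp
  | cons a s ha ih =>
    rw [Finset.sum_cons, Finset.sum_cons]
    exact (traceNorm_add_le _ _).trans (by gcongr)

/-- The sign of a Hermitian matrix, as a contraction: it witnesses that the sum of the absolute
values of the eigenvalues is at most the trace norm. -/
theorem exists_sign {H : Matrix n n ℂ} (hH : H.IsHermitian) :
    ∃ (U R : Matrix n n ℂ) (d : n → ℝ), U.conjTranspose * U = 1 ∧ U * U.conjTranspose = 1 ∧
      H = U * Matrix.diagonal (fun i => (d i : ℂ)) * U.conjTranspose ∧ IsContraction R ∧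
      R * H = U * Matrix.diagonal (fun i => ((|d i| : ℝ) : ℂ)) * U.conjTranspose ∧
      H * R = U * Matrix.diagonal (fun i => ((|d i| : ℝ) : ℂ)) * U.conjTranspose := by
  obtain ⟨U, hU, hU', hA⟩ := exists_unitary_diagonal hH
  set d := hH.eigenvalues
  have hmul : ∀ f g : n → ℂ, U * Matrix.diagonal f * U.conjTranspose *
      (U * Matrix.diagonal g * U.conjTranspose) =
        U * Matrix.diagonal (f * g) * U.conjTranspose := by
    intro f g
    calc _ = U * Matrix.diagonal f * (U.conjTranspose * U) *
          Matrix.diagonal g * U.conjTranspose := by simp only [Matrix.mul_assoc]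
      _ = _ := by
            rw [hU, Matrix.mul_one, Matrix.mul_assoc U, Matrix.diagonal_mul_diagonal]
            rfl
  have hs : ∀ x : ℝ, (SignType.sign x : ℝ) * x = |x| := fun x => by
    rw [mul_comm, self_mul_sign]
  refine ⟨U, U * Matrix.diagonal (fun i => ((SignType.sign (d i) : ℝ) : ℂ)) * U.conjTranspose,
    d, hU, hU', hA, ?_, ?_, ?_⟩
  · have hself : (U * Matrix.diagonal (fun i => ((SignType.sign (d i) : ℝ) : ℂ)) *
        U.conjTranspose).conjTranspose =
        U * Matrix.diagonal (fun i => ((SignType.sign (d i) : ℝ) : ℂ)) * U.conjTranspose := by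
      simp only [Matrix.conjTranspose_mul, Matrix.conjTranspose_conjTranspose,
        Matrix.diagonal_conjTranspose, Matrix.mul_assoc]
      congr 3
      ext i
      simp
    unfold IsContraction
    have h1 : (1 : Matrix n n ℂ) = U * Matrix.diagonal (fun _ => 1) * U.conjTranspose := by
      simp [hU']
    rw [hself, hmul, h1, ← Matrix.sub_mul, ← Matrix.mul_sub, Matrix.diagonal_sub]
    refine Matrix.PosSemidef.mul_mul_conjTranspose_same ?_ U
    rw [Matrix.posSemidef_diagonal_iff]
    intro i
    rcases lt_trichotomy (d i) 0 with h | h | h <;> simp [h]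
  · conv_lhs => rw [hA]
    rw [hmul]
    congr 3
    ext i
    simp only [Pi.mul_apply]
    exact_mod_cast hs (d i)
  · conv_lhs => rw [hA]
    rw [hmul]
    congr 3
    ext i
    simp only [Pi.mul_apply]
    rw [mul_comm]
    exact_mod_cast hs (d i)

theorem trace_unitary_conj {U : Matrix n n ℂ} (hU : U.conjTranspose * U = 1) (M : Matrix n n ℂ) :
    (U * M * U.conjTranspose).trace = M.trace := by
  rw [Matrix.trace_mul_comm, ← Matrix.mul_assoc, hU, Matrix.one_mul]

/-- The Powers–Størmer inequality `‖S - T‖₂² ≤ ‖S² - T²‖₁`. -/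
theorem powers_stormer {S T : Matrix n n ℂ} (hS : S.PosSemidef) (hT : T.PosSemidef) :
    ((S - T) * (S - T)).trace.re ≤ traceNorm (S * S - T * T) := by
  obtain ⟨U, R, d, hU, hU', hH, hR, hRH, hHR⟩ := exists_sign (hS.1.sub hT.1)
  refine le_trans ?_ (hR.trace_mul_le _)
  have h1 : (R * (S * S - T * T)).trace = (R * (S - T) * (S + T)).trace := by
    have e1 : R * (S * S - T * T) + R * (S * S - T * T) =
        R * (S - T) * (S + T) + R * (S + T) * (S - T) := by noncomm_ring
    have e2 : (R * (S + T) * (S - T)).trace = (R * (S - T) * (S + T)).trace := by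
      rw [Matrix.trace_mul_comm, ← Matrix.mul_assoc, hHR, hRH]
    have e3 := congrArg Matrix.trace e1
    rw [Matrix.trace_add, Matrix.trace_add, e2] at e3
    linear_combination e3 / 2
  have conj_apply : ∀ f : n → ℂ, ∀ M : Matrix n n ℂ,
      (U * Matrix.diagonal f * U.conjTranspose * M).trace =
        ∑ i, f i * (U.conjTranspose * M * U) i i := by
    intro f M
    have : (U * Matrix.diagonal f * U.conjTranspose * M).trace =
        (Matrix.diagonal f * (U.conjTranspose * M * U)).trace := by
      rw [Matrix.mul_assoc, Matrix.mul_assoc, Matrix.trace_mul_comm]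
      simp only [Matrix.mul_assoc]
    rw [this]
    simp [Matrix.trace, Matrix.diagonal_mul]
  have hd : ∀ i, (U.conjTranspose * (S - T) * U) i i = d i := by
    intro i
    have : U.conjTranspose * (S - T) * U = Matrix.diagonal (fun i => (d i : ℂ)) := by
      calc U.conjTranspose * (S - T) * U = (U.conjTranspose * U) *
            Matrix.diagonal (fun i => (d i : ℂ)) * (U.conjTranspose * U) := by
              conv_lhs => rw [hH]
              simp only [Matrix.mul_assoc]
        _ = _ := by rw [hU, Matrix.one_mul, Matrix.mul_one]
    rw [this, Matrix.diagonal_apply_eq]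
  rw [h1, hRH, conj_apply]
  have h2 : ((S - T) * (S - T)).trace = ∑ i, (d i : ℂ) * (d i : ℂ) := by
    have : ((S - T) * (S - T)).trace =
      (U * Matrix.diagonal (fun i => (d i : ℂ)) * U.conjTranspose * (S - T)).trace := by
      rw [← hH]
    rw [this, conj_apply]
    simp only [hd]
  rw [h2, Complex.re_sum, Complex.re_sum]
  refine Finset.sum_le_sum fun i _ => ?_
  rw [Complex.re_ofReal_mul, Complex.re_ofReal_mul, Complex.ofReal_re, ← abs_mul_abs_self]
  refine mul_le_mul_of_nonneg_left ?_ (abs_nonneg _)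
  have hSi : 0 ≤ ((U.conjTranspose * S * U) i i).re :=
    (Complex.nonneg_iff.mp (hS.conjTranspose_mul_mul_same U).diag_nonneg).1
  have hTi : 0 ≤ ((U.conjTranspose * T * U) i i).re :=
    (Complex.nonneg_iff.mp (hT.conjTranspose_mul_mul_same U).diag_nonneg).1
  have hdi : ((U.conjTranspose * S * U) i i).re - ((U.conjTranspose * T * U) i i).re = d i := by
    have := congrArg Complex.re (hd i)
    rwa [Matrix.mul_sub, Matrix.sub_mul, Matrix.sub_apply, Complex.sub_re, Complex.ofReal_re]
      at this
  rw [Matrix.mul_add, Matrix.add_mul, Matrix.add_apply, Complex.add_re, abs_le]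
  constructor <;> linarith

end Matrices

/-! ### Trace norm and diamond norm under channels -/

section Diamond

variable {A B C D E F : Type*}
  [Fintype A] [DecidableEq A] [Fintype B] [DecidableEq B]
  [Fintype C] [DecidableEq C] [Fintype D] [DecidableEq D]
  [Fintype E] [DecidableEq E] [Fintype F] [DecidableEq F]

theorem IsContraction.one_kronecker {S : Matrix A B ℂ} (hS : IsContraction S) :
    IsContraction ((1 : Matrix E E ℂ) ⊗ₖ S) := by
  have h : 1 - ((1 : Matrix E E ℂ) ⊗ₖ S).conjTranspose * ((1 : Matrix E E ℂ) ⊗ₖ S) =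
      (1 : Matrix E E ℂ) ⊗ₖ (1 - S.conjTranspose * S) := by
    rw [Matrix.conjTranspose_kronecker, ← Matrix.mul_kronecker_mul, Matrix.conjTranspose_one,
      Matrix.one_mul]
    ext ⟨i, j⟩ ⟨i', j'⟩
    simp only [Matrix.sub_apply, Matrix.kroneckerMap_apply, Matrix.one_apply, Prod.mk.injEq,
      ite_and, mul_sub]
    split_ifs <;> simp
  unfold IsContraction
  rw [h]
  exact Matrix.PosSemidef.one.kronecker hS

/-- The matrix with blocks `kₑ`; it is an isometry if `k` is trace preserving. -/
def stack (k : E → Matrix B A ℂ) : Matrix (E × B) A ℂ := Matrix.of fun p a => k p.1 p.2 a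

theorem stack_mul_mul_stack (k l : E → Matrix B A ℂ) (S : Matrix B B ℂ) :
    (stack k).conjTranspose * ((1 : Matrix E E ℂ) ⊗ₖ S) * stack l
      = ∑ e, (k e).conjTranspose * S * l e := by
  ext a a'
  simp [stack, Matrix.mul_apply, Matrix.sum_apply, Fintype.sum_prod_type, Matrix.one_apply,
    Finset.sum_mul]

theorem stack_mul_stack (k l : E → Matrix B A ℂ) :
    (stack k).conjTranspose * stack l = ∑ e, (k e).conjTranspose * l e := by
  have := stack_mul_mul_stack k l 1
  simpa using this

theorem IsTP.isContraction_stack {k : E → Matrix B A ℂ} (hk : IsTP k) :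
    IsContraction (stack k) := by
  unfold IsContraction
  rw [stack_mul_stack, show ∑ e, (k e).conjTranspose * k e = 1 from hk, sub_self]
  exact Matrix.PosSemidef.zero

theorem trace_mul_krausMap (k : E → Matrix B A ℂ) (S : Matrix B B ℂ) (X : Matrix A A ℂ) :
    (S * krausMap k X).trace = ((∑ e, (k e).conjTranspose * S * k e) * X).trace := by
  simp only [krausMap_apply, Matrix.trace_sum, Matrix.sum_mul, Matrix.mul_sum]
  refine Finset.sum_congr rfl fun e _ => ?_
  rw [← Matrix.mul_assoc, Matrix.trace_mul_comm]
  simp only [Matrix.mul_assoc]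

theorem IsTP.isContraction_dual {k : E → Matrix B A ℂ} (hk : IsTP k) {S : Matrix B B ℂ}
    (hS : IsContraction S) : IsContraction (∑ e, (k e).conjTranspose * S * k e) := by
  rw [← stack_mul_mul_stack]
  exact (hk.isContraction_stack.conjTranspose.mul hS.one_kronecker).mul hk.isContraction_stack

/-- Channels contract the trace norm, since their duals preserve contractions. -/
theorem IsChannel.traceNorm_le {Φ : SuperOp A B} (h : IsChannel Φ) (X : Matrix A A ℂ) :
    traceNorm (Φ X) ≤ traceNorm X := by
  obtain ⟨k, rfl, hk⟩ := h.exists_kraus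
  rw [traceNorm_le_iff]
  intro S hS
  rw [trace_mul_krausMap]
  exact (hk.isContraction_dual hS).trace_mul_le X

theorem IsDensity.traceNorm_le {ρ : Matrix A A ℂ} (h : IsDensity ρ) : traceNorm ρ ≤ 1 := by
  have h1 := (isChannel_replaceMap (A := Unit) h).traceNorm_le 1
  have h2 : replaceMap (A := Unit) ρ 1 = ρ := by simp [replaceMap]
  rw [h2] at h1
  refine h1.trans ?_
  rw [traceNorm_le_iff]
  intro S hS
  have h3 := hS.diag_nonneg (i := ())
  simp only [Matrix.sub_apply, Matrix.one_apply_eq, Matrix.mul_apply, Matrix.conjTranspose_apply,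
    Finset.univ_unique, Finset.sum_singleton] at h3
  have h4 : star (S () ()) * S () () = ((‖S () ()‖ ^ 2 : ℝ) : ℂ) := by
    push_cast
    exact Complex.conj_mul' _
  have h5 : (0 : ℝ) ≤ 1 - ‖S () ()‖ ^ 2 := by
    change (0 : ℂ) ≤ 1 - star (S () ()) * S () () at h3
    rw [h4] at h3
    exact_mod_cast h3
  rw [Matrix.mul_one]
  simp only [Matrix.trace, Matrix.diag_apply, Finset.univ_unique, Finset.sum_singleton]
  change (S () ()).re ≤ 1
  have := Complex.re_le_norm (S () ())
  nlinarith [norm_nonneg (S () ())]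

theorem diamondDist_le_iff {Φ Ψ : SuperOp A B} {ε : ℝ≥0} :
    diamondDist Φ Ψ ≤ ε ↔ ∀ (d : ℕ) (ρ : Matrix (Fin d × A) (Fin d × A) ℂ), IsDensity ρ →
      traceNorm (tensorMap (LinearMap.id : SuperOp (Fin d) (Fin d)) Φ ρ -
        tensorMap (LinearMap.id : SuperOp (Fin d) (Fin d)) Ψ ρ) ≤ ε := by
  simp only [diamondDist, iSup_le_iff]
  refine forall_congr' fun d => forall_congr' fun ρ => forall_congr' fun _ => ?_
  rw [ENNReal.ofReal_le_iff_le_toReal ENNReal.coe_ne_top, ENNReal.coe_toReal]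

/-- Maps with `Φ(X†) = Φ(X)†`. -/
def IsHermitianPreserving (Φ : SuperOp A B) : Prop :=
  ∀ X, Φ X.conjTranspose = (Φ X).conjTranspose

theorem IsChannel.isHermitianPreserving {Φ : SuperOp A B} (h : IsChannel Φ) :
    IsHermitianPreserving Φ := by
  obtain ⟨k, rfl, -⟩ := h.exists_kraus
  intro X
  simp only [krausMap_apply, Matrix.conjTranspose_sum, Matrix.conjTranspose_mul,
    Matrix.conjTranspose_conjTranspose, Matrix.mul_assoc]

theorem IsHermitianPreserving.sub {Φ Ψ : SuperOp A B} (hΦ : IsHermitianPreserving Φ)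
    (hΨ : IsHermitianPreserving Ψ) : IsHermitianPreserving (Φ - Ψ) := fun X => by
  rw [LinearMap.sub_apply, LinearMap.sub_apply, hΦ, hΨ, Matrix.conjTranspose_sub]

theorem IsHermitianPreserving.apply_single {Φ : SuperOp A B} (h : IsHermitianPreserving Φ)
    (i j : A) (b b' : B) :
    star (Φ (Matrix.single i j 1) b b') = Φ (Matrix.single j i 1) b' b := by
  have := congrFun (congrFun (h (Matrix.single i j 1)) b') b
  rw [Matrix.conjTranspose_single, star_one, Matrix.conjTranspose_apply] at this
  exact this.symm

theorem IsHermitianPreserving.tensorMap {Φ : SuperOp A B} {Ψ : SuperOp C D}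
    (hΦ : IsHermitianPreserving Φ) (hΨ : IsHermitianPreserving Ψ) :
    IsHermitianPreserving (tensorMap Φ Ψ) := by
  intro X
  ext ⟨b, d⟩ ⟨b', d'⟩
  rw [Matrix.conjTranspose_apply, tensorMap_apply, tensorMap_apply]
  simp only [star_sum, star_mul', hΦ.apply_single, hΨ.apply_single, Matrix.conjTranspose_apply]
  rw [Finset.sum_comm]
  refine Finset.sum_congr rfl fun i _ => Finset.sum_congr rfl fun j _ => ?_
  rw [Finset.sum_comm]

theorem isHermitianPreserving_id : IsHermitianPreserving (LinearMap.id : SuperOp A A) :=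
  isChannel_id.isHermitianPreserving

theorem IsHermitianPreserving.isHermitian {Φ : SuperOp A B} (h : IsHermitianPreserving Φ)
    {X : Matrix A A ℂ} (hX : X.IsHermitian) : (Φ X).IsHermitian := by
  have := h X
  rw [hX.eq] at this
  exact this.symm

/-- The stabilized trace norm of `Δ` on Hermitian operators is at most `ε`. For the difference of
two channels this says that their diamond norm distance is at most `ε`, see
`diamondDist_le_iff_dBound`. -/
def DBound (Δ : SuperOp A B) (ε : ℝ) : Prop :=
  ∀ (d : ℕ) (X : Matrix (Fin d × A) (Fin d × A) ℂ), X.IsHermitian →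
    traceNorm (tensorMap (LinearMap.id : SuperOp (Fin d) (Fin d)) Δ X) ≤ ε * traceNorm X

/-- A linear map bounded on states is bounded on Hermitian operators, by the spectral
decomposition. -/
theorem traceNorm_map_le_of_isDensity {Φ : SuperOp A B} {ε : ℝ}
    (h : ∀ ρ, IsDensity ρ → traceNorm (Φ ρ) ≤ ε) (hε : 0 ≤ ε) {X : Matrix A A ℂ}
    (hX : X.IsHermitian) : traceNorm (Φ X) ≤ ε * traceNorm X := by
  obtain ⟨U, R, d, hU, hU', hA, hR, hRH, -⟩ := exists_sign hX
  have h1 : ∑ i, |d i| ≤ traceNorm X := by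
    refine le_trans (le_of_eq ?_) (hR.trace_mul_le X)
    rw [hRH, trace_unitary_conj hU, Matrix.trace_diagonal, Complex.re_sum]
    simp
  have h2 : X = ∑ i, (d i : ℂ) • Matrix.vecMulVec (fun j => U j i) (star fun j => U j i) := by
    conv_lhs => rw [hA]
    ext a b
    rw [Matrix.mul_apply]
    simp only [Matrix.mul_diagonal, Matrix.sum_apply, Matrix.smul_apply,
      Matrix.vecMulVec_apply, Matrix.conjTranspose_apply, Pi.star_apply, smul_eq_mul]
    refine Finset.sum_congr rfl fun i _ => ?_
    ring
  have h3 : ∀ i, IsDensity (Matrix.vecMulVec (fun j => U j i) (star fun j => U j i)) := by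
    intro i
    refine ⟨Matrix.posSemidef_vecMulVec_self_star _, ?_⟩
    have := congrFun (congrFun hU i) i
    rw [Matrix.one_apply_eq, Matrix.mul_apply] at this
    rw [← this]
    simp only [Matrix.trace, Matrix.diag_apply, Matrix.vecMulVec_apply, Pi.star_apply,
      Matrix.conjTranspose_apply]
    exact Finset.sum_congr rfl fun j _ => mul_comm _ _
  conv_lhs => rw [h2]
  rw [map_sum]
  calc _ ≤ ∑ i, traceNorm (Φ ((d i : ℂ) •
        Matrix.vecMulVec (fun j => U j i) (star fun j => U j i))) := traceNorm_sum_le _ _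
    _ ≤ ∑ i, |d i| * ε := by
        refine Finset.sum_le_sum fun i _ => ?_
        rw [map_smul]
        refine (traceNorm_smul_le _ _).trans ?_
        rw [Complex.norm_real, Real.norm_eq_abs]
        exact mul_le_mul_of_nonneg_left (h _ (h3 i)) (abs_nonneg _)
    _ = ε * ∑ i, |d i| := by rw [← Finset.sum_mul, mul_comm]
    _ ≤ _ := mul_le_mul_of_nonneg_left h1 hε

theorem diamondDist_le_iff_dBound {Φ Ψ : SuperOp A B} {ε : ℝ≥0} :
    diamondDist Φ Ψ ≤ ε ↔ DBound (Φ - Ψ) ε := by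
  rw [diamondDist_le_iff]
  constructor
  · intro h d X hX
    refine traceNorm_map_le_of_isDensity (fun ρ hρ => ?_) ε.2 hX
    rw [tensorMap_sub_right]
    exact h d ρ hρ
  · intro h d ρ hρ
    have h1 := h d ρ hρ.1.1
    rw [tensorMap_sub_right, LinearMap.sub_apply] at h1
    exact h1.trans (mul_le_of_le_one_right ε.2 hρ.traceNorm_le)

theorem DBound.mono {Δ : SuperOp A B} {ε ε' : ℝ} (h : DBound Δ ε) (hε : ε ≤ ε') : DBound Δ ε' :=
  fun d X hX => (h d X hX).trans (mul_le_mul_of_nonneg_right hε (traceNorm_nonneg X))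

theorem dBound_zero : DBound (0 : SuperOp A B) 0 := fun d X _ => by
  have h : tensorMap (LinearMap.id : SuperOp (Fin d) (Fin d)) (0 : SuperOp A B) X = 0 := by
    have := tensorMap_sub_right (LinearMap.id : SuperOp (Fin d) (Fin d)) (0 : SuperOp A B) 0
    rw [sub_self, sub_self] at this
    rw [this, LinearMap.zero_apply]
  rw [h, zero_mul, traceNorm_le_iff]
  intro S _
  simp

theorem DBound.add {Δ Δ' : SuperOp A B} {ε ε' : ℝ} (h : DBound Δ ε) (h' : DBound Δ' ε') :
    DBound (Δ + Δ') (ε + ε') := fun d X hX => by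
  rw [tensorMap_add_right, LinearMap.add_apply, add_mul]
  exact (traceNorm_add_le _ _).trans (add_le_add (h d X hX) (h' d X hX))

theorem DBound.neg {Δ : SuperOp A B} {ε : ℝ} (h : DBound Δ ε) : DBound (-Δ) ε := fun d X hX => by
  have h0 : tensorMap (LinearMap.id : SuperOp (Fin d) (Fin d)) (-Δ)
      = - tensorMap (LinearMap.id : SuperOp (Fin d) (Fin d)) Δ := by
    refine superOp_prod_ext fun X Y => ?_
    simp only [tensorMap_kronecker, LinearMap.neg_apply]
    ext ⟨i, j⟩ ⟨i', j'⟩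
    simp
  rw [h0, LinearMap.neg_apply, traceNorm_neg]
  exact h d X hX

theorem DBound.sum {ι : Type*} {s : Finset ι} {Δ : ι → SuperOp A B} {ε : ι → ℝ}
    (h : ∀ i ∈ s, DBound (Δ i) (ε i)) : DBound (∑ i ∈ s, Δ i) (∑ i ∈ s, ε i) := by
  induction s using Finset.cons_induction with
  | empty => simpa using dBound_zero
  | cons a s ha ih =>
    rw [Finset.sum_cons, Finset.sum_cons]
    exact (h a (Finset.mem_cons_self a s)).add
      (ih fun i hi => h i (Finset.mem_cons_of_mem hi))

theorem IsChannel.dBound {Φ : SuperOp A B} (h : IsChannel Φ) : DBound Φ 1 := fun d X _ => by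
  rw [one_mul]
  exact (isChannel_id.tensorMap h).traceNorm_le X

theorem DBound.comp {Φ : SuperOp B C} {Ψ : SuperOp A B} {a b : ℝ} (hΦ : DBound Φ a)
    (hΨ : DBound Ψ b) (hh : IsHermitianPreserving Ψ) (ha : 0 ≤ a) :
    DBound (Φ ∘ₗ Ψ) (a * b) := fun d X hX => by
  have h : tensorMap (LinearMap.id : SuperOp (Fin d) (Fin d)) (Φ ∘ₗ Ψ) =
      tensorMap (LinearMap.id : SuperOp (Fin d) (Fin d)) Φ ∘ₗ
        tensorMap (LinearMap.id : SuperOp (Fin d) (Fin d)) Ψ := by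
    rw [← tensorMap_comp, LinearMap.id_comp]
  rw [h, LinearMap.comp_apply, mul_assoc]
  exact (hΦ d _ ((isHermitianPreserving_id.tensorMap hh).isHermitian hX)).trans
    (mul_le_mul_of_nonneg_left (hΨ d X hX) ha)

theorem traceNorm_reindexMap (e : A ≃ B) (X : Matrix A A ℂ) :
    traceNorm (reindexMap e X) = traceNorm X := by
  refine le_antisymm ((isChannel_reindexMap e).traceNorm_le X) ?_
  have h := (isChannel_reindexMap e.symm).traceNorm_le (reindexMap e X)
  rwa [← LinearMap.comp_apply, reindexMap_symm_comp, LinearMap.id_apply] at h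

/-- The ancilla in `DBound` may be any finite type. -/
theorem DBound.apply {Δ : SuperOp A B} {ε : ℝ} (h : DBound Δ ε) {X : Matrix (C × A) (C × A) ℂ}
    (hX : X.IsHermitian) :
    traceNorm (tensorMap (LinearMap.id : SuperOp C C) Δ X) ≤ ε * traceNorm X := by
  set e := Fintype.equivFin C
  have h1 : reindexMap (e.prodCongr (Equiv.refl B)) ∘ₗ tensorMap (LinearMap.id : SuperOp C C) Δ =
      tensorMap LinearMap.id Δ ∘ₗ reindexMap (e.prodCongr (Equiv.refl A)) := by
    refine superOp_prod_ext fun X Y => ?_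
    have h2 : reindexMap (e.prodCongr (Equiv.refl A)) (X ⊗ₖ Y) = reindexMap e X ⊗ₖ Y := rfl
    rw [LinearMap.comp_apply, LinearMap.comp_apply, h2, tensorMap_kronecker, tensorMap_kronecker]
    rfl
  have h2 := h _ (reindexMap (e.prodCongr (Equiv.refl A)) X)
    ((isChannel_reindexMap _).isHermitianPreserving.isHermitian hX)
  rwa [← LinearMap.comp_apply, ← h1, LinearMap.comp_apply, traceNorm_reindexMap,
    traceNorm_reindexMap] at h2

theorem DBound.id_tensorMap {Δ : SuperOp A B} {ε : ℝ} (h : DBound Δ ε) :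
    DBound (tensorMap (LinearMap.id : SuperOp C C) Δ) ε := fun d X hX => by
  have h1 : tensorMap (LinearMap.id : SuperOp (Fin d) (Fin d))
      (tensorMap (LinearMap.id : SuperOp C C) Δ) =
      reindexMap (Equiv.prodAssoc (Fin d) C B) ∘ₗ
        tensorMap (LinearMap.id : SuperOp (Fin d × C) (Fin d × C)) Δ ∘ₗ
          reindexMap (Equiv.prodAssoc (Fin d) C A).symm := by
    refine superOp_ext fun ⟨i, j, k⟩ ⟨i', j', k'⟩ => ?_
    have e1 : reindexMap (Equiv.prodAssoc (Fin d) C A).symm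
        (Matrix.single (i, j, k) (i', j', k') 1) =
        (Matrix.single i i' 1 ⊗ₖ Matrix.single j j' 1) ⊗ₖ Matrix.single k k' (1 : ℂ) := by
      rw [single_prod, single_prod]
      ext ⟨⟨a, b⟩, c⟩ ⟨⟨a', b'⟩, c'⟩
      simp [mul_assoc]
    rw [single_prod, single_prod, tensorMap_kronecker, tensorMap_kronecker, ← single_prod,
      ← single_prod, LinearMap.comp_apply, LinearMap.comp_apply, e1, tensorMap_kronecker]
    ext ⟨a, b, c⟩ ⟨a', b', c'⟩
    simp [mul_assoc]
  rw [h1, LinearMap.comp_apply, LinearMap.comp_apply, traceNorm_reindexMap,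
    ← traceNorm_reindexMap (Equiv.prodAssoc (Fin d) C A).symm X]
  exact h.apply ((isChannel_reindexMap _).isHermitianPreserving.isHermitian hX)

theorem DBound.reindex {Δ : SuperOp A B} {ε : ℝ} (h : DBound Δ ε) (hε : 0 ≤ ε) (e : C ≃ A)
    (f : B ≃ D) : DBound (reindexMap f ∘ₗ Δ ∘ₗ reindexMap e) ε := fun d X hX => by
  have h1 := (h.comp (isChannel_reindexMap e).dBound
    (isChannel_reindexMap e).isHermitianPreserving hε) d X hX
  rw [mul_one] at h1
  have h2 : tensorMap (LinearMap.id : SuperOp (Fin d) (Fin d))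
      (reindexMap f ∘ₗ Δ ∘ₗ reindexMap e) =
      tensorMap (LinearMap.id : SuperOp (Fin d) (Fin d)) (reindexMap f) ∘ₗ
        tensorMap (LinearMap.id : SuperOp (Fin d) (Fin d)) (Δ ∘ₗ reindexMap e) := by
    rw [← tensorMap_comp, LinearMap.id_comp]
  rw [h2, LinearMap.comp_apply]
  exact ((isChannel_id.tensorMap (isChannel_reindexMap f)).traceNorm_le _).trans h1

theorem DBound.tensorMap_id {Δ : SuperOp A B} {ε : ℝ} (h : DBound Δ ε) (hε : 0 ≤ ε) :
    DBound (tensorMap Δ (LinearMap.id : SuperOp C C)) ε := by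
  have h1 : tensorMap Δ (LinearMap.id : SuperOp C C) =
      reindexMap (Equiv.prodComm C B) ∘ₗ tensorMap (LinearMap.id : SuperOp C C) Δ ∘ₗ
        reindexMap (Equiv.prodComm A C) := by
    refine superOp_prod_ext fun X Y => ?_
    have e1 : reindexMap (Equiv.prodComm A C) (X ⊗ₖ Y) = Y ⊗ₖ X := by
      ext ⟨a, b⟩ ⟨a', b'⟩
      simp [mul_comm]
    rw [LinearMap.comp_apply, LinearMap.comp_apply, e1, tensorMap_kronecker, tensorMap_kronecker]
    ext ⟨a, b⟩ ⟨a', b'⟩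
    simp [mul_comm]
  rw [h1]
  exact h.id_tensorMap.reindex hε _ _

/-- The stabilized trace norm is submultiplicative under tensor products. -/
theorem DBound.tensorMap {Φ : SuperOp A B} {Ψ : SuperOp C D} {a b : ℝ} (hΦ : DBound Φ a)
    (hΨ : DBound Ψ b) (hh : IsHermitianPreserving Ψ) (ha : 0 ≤ a) :
    DBound (tensorMap Φ Ψ) (a * b) := by
  have h : NLQC.tensorMap Φ Ψ = NLQC.tensorMap Φ (LinearMap.id : SuperOp D D) ∘ₗ
      NLQC.tensorMap (LinearMap.id : SuperOp A A) Ψ := by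
    rw [← tensorMap_comp, LinearMap.id_comp, LinearMap.comp_id]
  rw [h]
  exact (hΦ.tensorMap_id ha).comp hΨ.id_tensorMap (isHermitianPreserving_id.tensorMap hh) ha

end Diamond

/-! ### Continuity of the Stinespring dilation -/

section Stinespring

variable {A B C E F : Type*}
  [Fintype A] [DecidableEq A] [Fintype B] [DecidableEq B]
  [Fintype C] [DecidableEq C] [Fintype E] [DecidableEq E] [Fintype F] [DecidableEq F]

theorem diamondDist_comm (Φ Ψ : SuperOp A B) : diamondDist Φ Ψ = diamondDist Ψ Φ := by
  simp only [diamondDist]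
  refine iSup_congr fun d => iSup_congr fun ρ => iSup_congr fun _ => ?_
  rw [← traceNorm_neg, neg_sub]

/-- The overlap `Re tr(W† (G ⊗ 1) V ρ)` of the Stinespring dilations `V`, `W` with Kraus operators
`k`, `l`, after a linear map with matrix `G` has been applied to the environment of `V`. -/
def overlap (k : E → Matrix B A ℂ) (l : F → Matrix B A ℂ) (G : Matrix E F ℂ)
    (ρ : Matrix A A ℂ) : ℝ :=
  (∑ e, ∑ f, G e f * ((l f).conjTranspose * k e * ρ).trace).re

theorem trace_mul_conjTranspose_self (S : Matrix A B ℂ) :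
    (S * S.conjTranspose).trace = ((∑ i, ∑ j, ‖S i j‖ ^ 2 : ℝ) : ℂ) := by
  simp only [Matrix.trace, Matrix.diag_apply, Matrix.mul_apply, Matrix.conjTranspose_apply]
  push_cast
  refine Finset.sum_congr rfl fun i _ => Finset.sum_congr rfl fun j _ => ?_
  rw [← Complex.mul_conj']
  rfl

/-- The output of a channel on one half of the pure state with coefficient matrix `S`. -/
theorem purified_output (m : E → Matrix B A ℂ) (S : Matrix A A ℂ) :
    (Matrix.of fun (p : A × B) e => (m e * S) p.2 p.1) *
      (Matrix.of fun (p : A × B) e => (m e * S) p.2 p.1).conjTranspose =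
      tensorMap (LinearMap.id : SuperOp A A) (krausMap m)
        (Matrix.vecMulVec (fun p : A × A => S p.2 p.1) (star fun p : A × A => S p.2 p.1)) := by
  set v : A × A → ℂ := fun p => S p.2 p.1 with hv
  rw [tensorMap_id_krausMap]
  ext ⟨a, b⟩ ⟨a', b'⟩
  simp only [krausMap_apply, Matrix.sum_apply]
  rw [Matrix.mul_apply]
  refine Finset.sum_congr rfl fun e _ => ?_
  have h1 : ∀ (a : A) (b : B), (((1 : Matrix A A ℂ) ⊗ₖ m e).mulVec v) (a, b) =
      (m e * S) b a := by
    intro a b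
    simp [Matrix.mulVec, dotProduct, Fintype.sum_prod_type, Matrix.mul_apply, hv,
      Matrix.one_apply]
  have h2 : ((1 : Matrix A A ℂ) ⊗ₖ m e) * Matrix.vecMulVec v (star v) *
      ((1 : Matrix A A ℂ) ⊗ₖ m e).conjTranspose =
      Matrix.vecMulVec (((1 : Matrix A A ℂ) ⊗ₖ m e).mulVec v)
        (star (((1 : Matrix A A ℂ) ⊗ₖ m e).mulVec v)) := by
    rw [Matrix.mul_vecMulVec, Matrix.vecMulVec_mul, Matrix.star_mulVec]
  rw [h2, Matrix.vecMulVec_apply, Pi.star_apply, h1, h1]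
  rfl

/-- Uhlmann's theorem and the Fuchs–van de Graaf inequality for the outputs of two channels: for
every input state the environments can be aligned with an overlap of at least `1 - δ / 2`. -/
theorem exists_overlap_ge {k : E → Matrix B A ℂ} {l : F → Matrix B A ℂ} (hk : IsTP k)
    (hl : IsTP l) {δ : ℝ≥0} (h : diamondDist (krausMap k) (krausMap l) ≤ δ)
    {ρ : Matrix A A ℂ} (hρ : IsDensity ρ) :
    ∃ G : Matrix E F ℂ, IsContraction G ∧ 1 - δ / 2 ≤ overlap k l G ρ := by
  obtain ⟨S, hS⟩ := exists_eq_mul_conjTranspose hρ.1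
  -- `ω` is the purification of `ρ` given by the vector `S`
  set v : A × A → ℂ := fun p => S p.2 p.1 with hv
  set ω : Matrix (A × A) (A × A) ℂ := Matrix.vecMulVec v (star v) with hω
  have hωd : IsDensity ω := by
    refine ⟨Matrix.posSemidef_vecMulVec_self_star v, ?_⟩
    rw [← hρ.2, hS]
    simp only [hω, hv, Matrix.trace, Matrix.diag_apply, Matrix.vecMulVec_apply, Pi.star_apply,
      Fintype.sum_prod_type, Matrix.mul_apply, Matrix.conjTranspose_apply]
    rw [Finset.sum_comm]
  have houtk := purified_output k S
  have houtl := purified_output l S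
  set K : Matrix (A × B) E ℂ := Matrix.of fun (p : A × B) e => (k e * S) p.2 p.1 with hK
  set L : Matrix (A × B) F ℂ := Matrix.of fun (p : A × B) e => (l e * S) p.2 p.1 with hL
  have hPK : IsDensity (K * K.conjTranspose) := by
    rw [houtk]
    exact (isChannel_id.tensorMap hk.isChannel).isDensity hωd
  have hPL : IsDensity (L * L.conjTranspose) := by
    rw [houtl]
    exact (isChannel_id.tensorMap hl.isChannel).isDensity hωd
  obtain ⟨S₁, W₁, hS₁, hSS₁, hA₁, hW₁, hc₁, -⟩ := exists_polar hPK.1 rfl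
  obtain ⟨S₂, W₂, hS₂, hSS₂, hA₂, hW₂, hc₂, -⟩ := exists_polar hPL.1 rfl
  refine ⟨W₁.conjTranspose * W₂, hc₁.conjTranspose.mul hc₂, ?_⟩
  have h1 := powers_stormer hS₁ hS₂
  have h2 : traceNorm (S₁ * S₁ - S₂ * S₂) ≤ δ := by
    have h3 := (diamondDist_le_iff_dBound.mp h).apply hωd.1.1
    rw [tensorMap_sub_right, LinearMap.sub_apply, ← houtk, ← houtl] at h3
    rw [hSS₁, hSS₂]
    exact h3.trans (mul_le_of_le_one_right δ.2 hωd.traceNorm_le)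
  have h4 : ((S₁ - S₂) * (S₁ - S₂)).trace.re = 2 - 2 * (S₂ * S₁).trace.re := by
    have h5 : (S₁ - S₂) * (S₁ - S₂) = S₁ * S₁ + S₂ * S₂ - S₁ * S₂ - S₂ * S₁ := by noncomm_ring
    rw [h5, Matrix.trace_sub, Matrix.trace_sub, Matrix.trace_add, hSS₁, hSS₂, hPK.2, hPL.2,
      Matrix.trace_mul_comm S₁ S₂]
    simp only [Complex.sub_re, Complex.add_re, Complex.one_re]
    ring
  have h6 : overlap k l (W₁.conjTranspose * W₂) ρ = (S₂ * S₁).trace.re := by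
    have h7 : S₁ * (W₁ * W₁.conjTranspose) = S₁ := by
      have := congrArg Matrix.conjTranspose hW₁
      simpa [Matrix.conjTranspose_mul, hS₁.1.eq] using this
    have h8 : (S₂ * S₁).trace = ((W₁.conjTranspose * W₂) * (L.conjTranspose * K)).trace := by
      symm
      calc ((W₁.conjTranspose * W₂) * (L.conjTranspose * K)).trace
          = (W₁.conjTranspose * (W₂ * W₂.conjTranspose * S₂) * (S₁ * W₁)).trace := by
            rw [hA₁, hA₂, Matrix.conjTranspose_mul, hS₂.1.eq]
            simp only [Matrix.mul_assoc]
        _ = (S₂ * (S₁ * (W₁ * W₁.conjTranspose))).trace := by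
            rw [hW₂, Matrix.mul_assoc, Matrix.trace_mul_comm]
            simp only [Matrix.mul_assoc]
        _ = _ := by rw [h7]
    rw [overlap, h8]
    congr 1
    rw [Matrix.trace]
    simp only [Matrix.diag_apply, Matrix.mul_apply (M := W₁.conjTranspose * W₂)]
    refine Finset.sum_congr rfl fun e _ => Finset.sum_congr rfl fun f _ => ?_
    congr 1
    have h9 : (l f).conjTranspose * k e * ρ =
        (l f).conjTranspose * (k e * S) * S.conjTranspose := by
      rw [hS]; simp only [Matrix.mul_assoc]
    rw [h9, Matrix.trace_mul_comm, ← Matrix.mul_assoc, ← Matrix.conjTranspose_mul]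
    rw [Matrix.mul_apply (M := L.conjTranspose), Fintype.sum_prod_type]
    simp only [Matrix.trace, Matrix.diag_apply, Matrix.mul_apply (M := (l f * S).conjTranspose)]
    rfl
  rw [h6]
  linarith

theorem isClosed_posSemidef : IsClosed {M : Matrix A A ℂ | M.PosSemidef} := by
  have h : {M : Matrix A A ℂ | M.PosSemidef} = {M | M.conjTranspose = M} ∩
      ⋂ x : A → ℂ, {M | 0 ≤ star x ⬝ᵥ (M.mulVec x)} := by
    ext M
    simp only [Set.mem_ofPred_eq, Set.mem_inter_iff, Set.mem_iInter,
      Matrix.posSemidef_iff_dotProduct_mulVec]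
    rfl
  rw [h]
  refine IsClosed.inter (isClosed_eq (by fun_prop) (by fun_prop)) (isClosed_iInter fun x => ?_)
  exact isClosed_le continuous_const (by fun_prop)

theorem isCompact_of_isClosed_of_norm_le {s : Set (Matrix A B ℂ)} (hs : IsClosed s)
    (h : ∀ M ∈ s, ∀ i j, ‖M i j‖ ≤ 1) : IsCompact s := by
  have hK : IsCompact (Set.univ.pi fun _ : A => Set.univ.pi fun _ : B =>
      Metric.closedBall (0 : ℂ) 1) :=
    isCompact_univ_pi fun _ => isCompact_univ_pi fun _ => isCompact_closedBall _ _
  refine IsCompact.of_isClosed_subset (s := (Set.univ.pi fun _ : A => Set.univ.pi fun _ : B =>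
      Metric.closedBall (0 : ℂ) 1 : Set (Matrix A B ℂ))) hK hs fun M hM => ?_
  intro i _ j _
  simpa using h M hM i j

theorem isCompact_isDensity : IsCompact {ρ : Matrix A A ℂ | IsDensity ρ} := by
  refine isCompact_of_isClosed_of_norm_le ?_ fun ρ hρ i j => ?_
  · exact isClosed_posSemidef.inter (isClosed_eq (by fun_prop) continuous_const)
  · obtain ⟨S, hS⟩ := exists_eq_mul_conjTranspose hρ.1
    have h1 : ∑ i, ∑ j, ‖S i j‖ ^ 2 = 1 := by
      have := trace_mul_conjTranspose_self S
      rw [← hS, hρ.2] at this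
      exact_mod_cast this.symm
    have h2 : ∀ i, ∑ j, ‖S i j‖ ^ 2 ≤ 1 := fun i => by
      rw [← h1]
      exact Finset.single_le_sum (f := fun i => ∑ j, ‖S i j‖ ^ 2)
        (fun i _ => Finset.sum_nonneg fun j _ => by positivity) (Finset.mem_univ i)
    rw [hS, Matrix.mul_apply]
    refine (norm_sum_mul_le _ _ _).trans ?_
    simp only [Matrix.conjTranspose_apply, norm_star]
    exact mul_le_one₀ (Real.sqrt_le_one.mpr (h2 i)) (Real.sqrt_nonneg _)
      (Real.sqrt_le_one.mpr (h2 j))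

theorem convex_isDensity : Convex ℝ {ρ : Matrix A A ℂ | IsDensity ρ} := by
  intro ρ hρ τ hτ a b ha hb hab
  have hsm : ∀ (c : ℝ) (M : Matrix A A ℂ), c • M = (c : ℂ) • M := fun c M => by
    ext; simp
  refine ⟨?_, ?_⟩
  · rw [hsm, hsm]
    exact (hρ.1.smul (by exact_mod_cast ha)).add (hτ.1.smul (by exact_mod_cast hb))
  · rw [Matrix.trace_add, Matrix.trace_smul, Matrix.trace_smul, hρ.2, hτ.2, ← add_smul, hab,
      one_smul]

theorem isCompact_isContraction : IsCompact {G : Matrix A B ℂ | IsContraction G} := by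
  refine isCompact_of_isClosed_of_norm_le ?_ fun G hG i j => ?_
  · exact isClosed_posSemidef.preimage
      (f := fun G : Matrix A B ℂ => 1 - G.conjTranspose * G) (by fun_prop)
  · have h1 := (show IsContraction G from hG).diag_nonneg (i := j)
    rw [Matrix.sub_apply, Matrix.one_apply_eq, Matrix.mul_apply] at h1
    have h2 : ((∑ i, ‖G i j‖ ^ 2 : ℝ) : ℂ) = ∑ i, G.conjTranspose j i * G i j := by
      push_cast
      refine Finset.sum_congr rfl fun i _ => ?_
      rw [Matrix.conjTranspose_apply, ← Complex.conj_mul']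
      rfl
    rw [← h2] at h1
    have h3 : (0 : ℝ) ≤ 1 - ∑ i, ‖G i j‖ ^ 2 := by exact_mod_cast h1
    have h4 : ‖G i j‖ ^ 2 ≤ ∑ i, ‖G i j‖ ^ 2 :=
      Finset.single_le_sum (f := fun i => ‖G i j‖ ^ 2) (fun i _ => by positivity)
        (Finset.mem_univ i)
    nlinarith [norm_nonneg (G i j)]

theorem convex_isContraction : Convex ℝ {G : Matrix A B ℂ | IsContraction G} := by
  intro G hG H hH a b ha hb hab
  have hsm : ∀ (c : ℝ) (M : Matrix A B ℂ), c • M = (c : ℂ) • M := fun c M => by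
    ext; simp
  obtain rfl : b = 1 - a := by linarith
  have h : 1 - (a • G + (1 - a) • H).conjTranspose * (a • G + (1 - a) • H) =
      (a : ℂ) • (1 - G.conjTranspose * G) + ((1 - a : ℝ) : ℂ) • (1 - H.conjTranspose * H) +
        ((a * (1 - a) : ℝ) : ℂ) • ((G - H).conjTranspose * (G - H)) := by
    rw [hsm, hsm]
    simp only [Matrix.conjTranspose_add, Matrix.conjTranspose_sub, Matrix.conjTranspose_smul,
      Matrix.add_mul, Matrix.mul_add, Matrix.sub_mul, Matrix.mul_sub, Matrix.smul_mul,
      Matrix.mul_smul, RCLike.star_def, Complex.conj_ofReal]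
    push_cast
    module
  change (1 - (a • G + (1 - a) • H).conjTranspose * (a • G + (1 - a) • H)).PosSemidef
  rw [h]
  refine ((Matrix.PosSemidef.smul hG ?_).add (Matrix.PosSemidef.smul hH ?_)).add
    ((Matrix.posSemidef_conjTranspose_mul_self _).smul ?_)
  · exact_mod_cast ha
  · exact_mod_cast hb
  · exact_mod_cast mul_nonneg ha hb

theorem overlap_combo_right (k : E → Matrix B A ℂ) (l : F → Matrix B A ℂ) (G : Matrix E F ℂ)
    (ρ τ : Matrix A A ℂ) (a b : ℝ) :
    overlap k l G (a • ρ + b • τ) = a * overlap k l G ρ + b * overlap k l G τ := by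
  simp only [overlap, Matrix.trace_add, Matrix.trace_smul,
    mul_add, Finset.sum_add_distrib, Complex.add_re, mul_smul_comm, ← Finset.smul_sum,
    Complex.smul_re, smul_eq_mul]

theorem overlap_combo_left (k : E → Matrix B A ℂ) (l : F → Matrix B A ℂ) (G H : Matrix E F ℂ)
    (ρ : Matrix A A ℂ) (a b : ℝ) :
    overlap k l (a • G + b • H) ρ = a * overlap k l G ρ + b * overlap k l H ρ := by
  simp only [overlap, Matrix.add_apply, Matrix.smul_apply,
    add_mul, Finset.sum_add_distrib, Complex.add_re, smul_mul_assoc, ← Finset.smul_sum,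
    Complex.smul_re, smul_eq_mul]

theorem exists_isDensity [Nonempty A] : ∃ ρ : Matrix A A ℂ, IsDensity ρ := by
  obtain ⟨a⟩ := ‹Nonempty A›
  refine ⟨Matrix.vecMulVec (Pi.single a 1) (star (Pi.single a 1)),
    Matrix.posSemidef_vecMulVec_self_star _, ?_⟩
  simp [Matrix.trace, Matrix.vecMulVec_apply, Pi.single_apply]

/-- Continuity of the Stinespring dilation: the minimax theorem turns the alignments of the
environments of `exists_overlap_ge`, which depend on the input state, into a single one. -/
theorem exists_uniform_overlap_ge [Nonempty A] {k : E → Matrix B A ℂ} {l : F → Matrix B A ℂ}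
    (hk : IsTP k) (hl : IsTP l) {δ : ℝ≥0} (h : diamondDist (krausMap k) (krausMap l) ≤ δ) :
    ∃ G : Matrix E F ℂ, IsContraction G ∧ ∀ ρ, IsDensity ρ → 1 - δ / 2 ≤ overlap k l G ρ := by
  have hcont₁ : ∀ G, Continuous fun ρ => overlap k l G ρ := fun G => by
    unfold overlap
    fun_prop
  have hcont₂ : ∀ ρ, Continuous fun G => overlap k l G ρ := fun ρ => by
    unfold overlap
    refine Complex.continuous_re.comp (continuous_finsetSum _ fun e _ =>
      continuous_finsetSum _ fun f _ => ?_)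
    exact (continuous_id.matrix_elem e f).mul continuous_const
  obtain ⟨ρ₀, hρ₀, G₀, hG₀, hsaddle⟩ := Sion.exists_isSaddlePointOn
    (X := {ρ : Matrix A A ℂ | IsDensity ρ}) (Y := {G : Matrix E F ℂ | IsContraction G})
    (f := fun ρ G => overlap k l G ρ) exists_isDensity convex_isDensity isCompact_isDensity
    (fun G _ => (hcont₁ G).lowerSemicontinuous.lowerSemicontinuousOn _)
    (fun G _ => ConvexOn.quasiconvexOn ⟨convex_isDensity, fun ρ _ τ _ a b _ _ _ =>
      (overlap_combo_right k l G ρ τ a b).le⟩)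
    convex_isContraction
    ⟨0, by simp [IsContraction, Matrix.PosSemidef.one]⟩ isCompact_isContraction
    (fun ρ _ => (hcont₂ ρ).upperSemicontinuous.upperSemicontinuousOn _)
    (fun ρ _ => ConcaveOn.quasiconcaveOn ⟨convex_isContraction, fun G _ H _ a b _ _ _ =>
      (overlap_combo_left k l G H ρ a b).ge⟩)
  refine ⟨G₀, hG₀, fun ρ hρ => ?_⟩
  obtain ⟨G, hG, hGρ⟩ := exists_overlap_ge hk hl h hρ₀
  exact hGρ.trans (hsaddle ρ hρ G hG)

theorem re_trace_mul_conjTranspose_le (X Y : Matrix A B ℂ) :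
    (X * Y.conjTranspose).trace.re ≤ Real.sqrt (X * X.conjTranspose).trace.re *
      Real.sqrt (Y * Y.conjTranspose).trace.re := by
  rw [trace_mul_conjTranspose_self, trace_mul_conjTranspose_self, Complex.ofReal_re,
    Complex.ofReal_re]
  refine (Complex.re_le_norm _).trans ?_
  have h : (X * Y.conjTranspose).trace = ∑ p : A × B, X p.1 p.2 * star (Y p.1 p.2) := by
    simp [Matrix.trace, Matrix.mul_apply, Fintype.sum_prod_type]
  rw [h]
  refine (norm_sum_mul_le _ _ _).trans_eq ?_
  simp only [norm_star, Fintype.sum_prod_type]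

theorem IsContraction.re_trace_le {T : Matrix C A ℂ} (hT : IsContraction T) (Z : Matrix A B ℂ) :
    (T * Z * (T * Z).conjTranspose).trace.re ≤ (Z * Z.conjTranspose).trace.re := by
  have h := (Complex.nonneg_iff.mp (hT.conjTranspose_mul_mul_same Z).trace_nonneg).1
  have h1 : (Z.conjTranspose * (1 - T.conjTranspose * T) * Z).trace =
      (Z * Z.conjTranspose).trace - (T * Z * (T * Z).conjTranspose).trace := by
    rw [Matrix.trace_mul_comm Z, Matrix.trace_mul_comm (T * Z), Matrix.conjTranspose_mul,
      ← Matrix.trace_sub]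
    congr 1
    simp only [Matrix.mul_sub, Matrix.sub_mul, Matrix.mul_one, Matrix.mul_assoc]
  rw [h1, Complex.sub_re] at h
  linarith

/-- Channels with close dilations are close, for a fixed input state. -/
theorem traceNorm_krausMap_sub_le {k l : E → Matrix B A ℂ} (hk : IsTP k) (hl : IsTP l) {δ : ℝ}
    {ω : Matrix A A ℂ} (hω : IsDensity ω)
    (h : 1 - δ / 2 ≤ (∑ e, ((l e).conjTranspose * k e * ω).trace).re) :
    traceNorm (krausMap k ω - krausMap l ω) ≤ 2 * Real.sqrt δ := by
  obtain ⟨S, hS⟩ := exists_eq_mul_conjTranspose hω.1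
  rw [traceNorm_le_iff]
  intro T hT
  set K := stack k
  set L := stack l
  set T' : Matrix (E × B) (E × B) ℂ := (1 : Matrix E E ℂ) ⊗ₖ T
  have hT' : IsContraction T' := hT.one_kronecker
  have hK : K.conjTranspose * K = 1 := (stack_mul_stack k k).trans hk
  have hL : L.conjTranspose * L = 1 := (stack_mul_stack l l).trans hl
  have htr : ∀ (M N : Matrix (E × B) A ℂ),
      (M * S * (N * S).conjTranspose).trace = (N.conjTranspose * M * ω).trace := by
    intro M N
    rw [Matrix.conjTranspose_mul, ← Matrix.mul_assoc, Matrix.trace_mul_comm, hS]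
    simp only [Matrix.mul_assoc]
  have h1 : (T * (krausMap k ω - krausMap l ω)).trace =
      (T' * ((K - L) * S) * (K * S).conjTranspose).trace +
        (T' * (L * S) * ((K - L) * S).conjTranspose).trace := by
    have e1 : ∀ m : E → Matrix B A ℂ, (T * krausMap m ω).trace =
        (T' * (stack m * S) * (stack m * S).conjTranspose).trace := by
      intro m
      rw [trace_mul_krausMap, ← stack_mul_mul_stack, ← Matrix.mul_assoc, htr]
      simp only [Matrix.mul_assoc]
      rfl
    rw [Matrix.mul_sub, Matrix.trace_sub, e1 k, e1 l]
    simp only [Matrix.sub_mul, Matrix.mul_sub, Matrix.conjTranspose_sub, Matrix.trace_sub]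
    ring
  have h2 : ((K - L) * S * ((K - L) * S).conjTranspose).trace.re ≤ δ := by
    have e1 : (K - L).conjTranspose * (K - L) * ω =
        ω + ω - L.conjTranspose * K * ω - K.conjTranspose * L * ω := by
      rw [Matrix.conjTranspose_sub, Matrix.sub_mul, Matrix.mul_sub, Matrix.mul_sub, hK, hL]
      noncomm_ring
    have e2 : (K.conjTranspose * L * ω).trace.re = (L.conjTranspose * K * ω).trace.re := by
      have e3 : (K.conjTranspose * L * ω).trace = star (L.conjTranspose * K * ω).trace := by
        rw [← Matrix.trace_conjTranspose, Matrix.conjTranspose_mul, Matrix.conjTranspose_mul,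
          Matrix.conjTranspose_conjTranspose, hω.1.1.eq, Matrix.trace_mul_comm]
      rw [e3]
      simp
    have e4 : (L.conjTranspose * K * ω).trace = ∑ e, ((l e).conjTranspose * k e * ω).trace := by
      rw [stack_mul_stack, Matrix.sum_mul, Matrix.trace_sum]
    rw [htr, e1, Matrix.trace_sub, Matrix.trace_sub, Matrix.trace_add, hω.2, Complex.sub_re,
      Complex.sub_re, e2, e4]
    simp only [Complex.add_re, Complex.one_re]
    linarith
  have h3 : (K * S * (K * S).conjTranspose).trace.re = 1 := by
    rw [htr, hK, Matrix.one_mul, hω.2, Complex.one_re]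
  have h4 : (L * S * (L * S).conjTranspose).trace.re = 1 := by
    rw [htr, hL, Matrix.one_mul, hω.2, Complex.one_re]
  rw [h1, Complex.add_re, two_mul]
  refine add_le_add ?_ ?_
  · refine (re_trace_mul_conjTranspose_le _ _).trans ?_
    rw [h3, Real.sqrt_one, mul_one]
    exact Real.sqrt_le_sqrt ((hT'.re_trace_le _).trans h2)
  · refine (re_trace_mul_conjTranspose_le _ _).trans ?_
    have h5 : Real.sqrt (T' * (L * S) * (T' * (L * S)).conjTranspose).trace.re ≤ 1 :=
      Real.sqrt_le_one.mpr ((hT'.re_trace_le _).trans h4.le)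
    calc _ ≤ 1 * Real.sqrt δ :=
          mul_le_mul h5 (Real.sqrt_le_sqrt h2) (Real.sqrt_nonneg _) zero_le_one
      _ = _ := one_mul _

theorem trace_one_kronecker_mul (M : Matrix A A ℂ) (ω : Matrix (C × A) (C × A) ℂ) :
    (((1 : Matrix C C ℂ) ⊗ₖ M) * ω).trace = (M * traceFst ω).trace := by
  simp only [Matrix.trace, Matrix.diag_apply, Matrix.mul_apply, Fintype.sum_prod_type,
    Matrix.kroneckerMap_apply, Matrix.one_apply, traceFst_apply, Finset.mul_sum, ite_mul, one_mul,
    zero_mul, Finset.sum_ite_irrel, Finset.sum_const_zero, Finset.sum_ite_eq, Finset.mem_univ,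
    if_true]
  rw [Finset.sum_comm]
  refine Finset.sum_congr rfl fun i _ => ?_
  rw [Finset.sum_comm]

theorem diamondDist_le_of_overlap {k l : E → Matrix B A ℂ} (hk : IsTP k) (hl : IsTP l) {δ : ℝ≥0}
    (h : ∀ ρ, IsDensity ρ → 1 - (δ : ℝ) / 2 ≤ (∑ e, ((l e).conjTranspose * k e * ρ).trace).re) :
    diamondDist (krausMap k) (krausMap l) ≤ ((2 * NNReal.sqrt δ : ℝ≥0) : ℝ≥0∞) := by
  rw [diamondDist_le_iff]
  intro d ω hω
  rw [tensorMap_id_krausMap, tensorMap_id_krausMap]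
  have := traceNorm_krausMap_sub_le (hk.one_kronecker (A := Fin d)) (hl.one_kronecker (A := Fin d))
    hω (δ := δ) (by
      refine (h _ (isChannel_traceFst.isDensity hω)).trans_eq ?_
      congr 1
      refine Finset.sum_congr rfl fun e _ => ?_
      rw [← trace_one_kronecker_mul, Matrix.conjTranspose_kronecker, ← Matrix.mul_kronecker_mul,
        Matrix.conjTranspose_one, Matrix.one_mul])
  simpa using this

end Stinespring

/-! ### The tradeoff between information and disturbance -/

section Tradeoff

variable {A B M M' E : Type*}
  [Fintype A] [DecidableEq A] [Fintype B] [DecidableEq B] [Fintype E] [DecidableEq E]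
  [Fintype M] [DecidableEq M] [Fintype M'] [DecidableEq M']

/-- If a channel almost forgets its input, then the input can be recovered from the environment. -/
theorem exists_decoder_of_diamondDist_replaceMap_le [Nonempty A] {k : E → Matrix B A ℂ}
    (hk : IsTP k) {σ : Matrix B B ℂ} (hσ : IsDensity σ) {δ : ℝ≥0}
    (h : diamondDist (replaceMap σ) (krausMap k) ≤ δ) :
    ∃ D : SuperOp E A, IsChannel D ∧
      diamondDist (D ∘ₗ krausMap (krausCompl k)) LinearMap.id ≤
        ((2 * NNReal.sqrt δ : ℝ≥0) : ℝ≥0∞) := by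
  obtain ⟨T, hT⟩ := exists_eq_mul_conjTranspose hσ.1
  set l : A × B → Matrix B A ℂ := fun p => Matrix.of fun b a => if a = p.1 then T b p.2 else 0
    with hl
  have hlmap : replaceMap σ = krausMap l := by rw [hT, replaceMap_mul_conjTranspose]
  have hlTP : IsTP l := isTP_of_trace_preserving fun X => by
    rw [← hlmap, trace_replaceMap hσ.2]
  rw [diamondDist_comm, hlmap] at h
  obtain ⟨G, hG, hGo⟩ := exists_uniform_overlap_ge hk hlTP h
  -- the alignment `G` of the environments followed by discarding the purification of `σ`
  set d : B → Matrix A E ℂ := fun m => Matrix.of fun a e => G e (a, m) with hd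
  have hsub : (1 - ∑ m, (d m).conjTranspose * d m).PosSemidef := by
    have h1 := hG.conjTranspose.transpose
    rw [Matrix.conjTranspose_conjTranspose] at h1
    have h2 : 1 - ∑ m, (d m).conjTranspose * d m = (1 - G * G.conjTranspose).transpose := by
      ext e e'
      simp only [hd, Matrix.sub_apply, Matrix.sum_apply, Matrix.mul_apply, Fintype.sum_prod_type,
        Matrix.transpose_apply, Matrix.conjTranspose_apply, Matrix.of_apply, Matrix.one_apply,
        eq_comm (a := e)]
      rw [Finset.sum_comm]
      simp only [mul_comm]
    rw [h2]
    exact h1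
  obtain ⟨r, hr⟩ := exists_isTP_sumElim hsub
  refine ⟨krausMap (Sum.elim d r), hr.isChannel, ?_⟩
  have hk' : IsTP (krausCompl k) := by
    refine Eq.trans ?_ hk
    ext a a'
    simp only [Matrix.sum_apply, Matrix.mul_apply, krausCompl, Matrix.conjTranspose_apply,
      Matrix.of_apply]
    rw [Finset.sum_comm]
  set t : (B ⊕ E) × B → Matrix A A ℂ :=
    fun p => (Sum.elim (fun m => T p.2 m) (fun _ => 0) p.1 : ℂ) • 1 with ht
  have htid : krausMap t = LinearMap.id := by
    refine LinearMap.ext fun X => ?_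
    have h1 : ∑ m, ∑ b, T b m * star (T b m) = 1 := by
      rw [← hσ.2, hT, Finset.sum_comm]
      simp [Matrix.trace, Matrix.mul_apply]
    simp only [krausMap_apply, ht, Fintype.sum_prod_type, Fintype.sum_sum_type, Sum.elim_inl,
      Sum.elim_inr, Matrix.conjTranspose_smul, Matrix.conjTranspose_one,
      Matrix.smul_mul, Matrix.mul_smul,
      Matrix.one_mul, Matrix.mul_one, smul_smul, ← Finset.sum_smul, LinearMap.id_apply]
    simp only [mul_comm (star _), h1, zero_mul, Finset.sum_const_zero, add_zero, one_smul]
  have htTP : IsTP t := isTP_of_trace_preserving fun X => by rw [htid, LinearMap.id_apply]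
  rw [krausMap_comp, ← htid]
  refine diamondDist_le_of_overlap (hr.comp hk') htTP fun ρ hρ => (hGo ρ hρ).trans_eq ?_
  rw [overlap]
  congr 1
  simp only [ht, Fintype.sum_prod_type, Fintype.sum_sum_type, Sum.elim_inl, Sum.elim_inr,
    Matrix.conjTranspose_smul, Matrix.conjTranspose_one, star_zero,
    Matrix.smul_mul, Matrix.one_mul,
    Matrix.trace_smul, smul_eq_mul]
  simp only [Matrix.trace, Matrix.diag_apply, Matrix.mul_apply, hl, hd, krausCompl,
    Matrix.conjTranspose_apply, Matrix.of_apply, Finset.sum_mul, Finset.mul_sum, apply_ite star,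
    star_zero, ite_mul, zero_mul, Finset.sum_ite_irrel, Finset.sum_const_zero,
    Finset.sum_ite_eq', Finset.mem_univ, if_true]
  rw [add_zero]
  calc _ = ∑ m, ∑ e, ∑ a, ∑ c, ∑ b, G e (a, m) * (star (T b m) * k e b c * ρ c a) := by
        rw [Finset.sum_comm (s := (Finset.univ : Finset B))]
        exact Finset.sum_congr rfl fun e _ => Finset.sum_comm
    _ = _ := by
      refine Finset.sum_congr rfl fun m _ => ?_
      rw [Finset.sum_comm]
      calc _ = ∑ a, ∑ b, ∑ c, ∑ e, G e (a, m) * (star (T b m) * k e b c * ρ c a) := by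
            refine Finset.sum_congr rfl fun a _ => ?_
            rw [Finset.sum_comm, Finset.sum_comm (s := (Finset.univ : Finset B))]
            refine Finset.sum_congr rfl fun c _ => Finset.sum_comm
        _ = _ := by
            rw [Finset.sum_comm]
            refine Finset.sum_congr rfl fun b _ => Finset.sum_congr rfl fun a _ =>
              Finset.sum_congr rfl fun c _ => Finset.sum_congr rfl fun e _ => ?_
            ring

/-- If a channel with Kraus operators `k₁` is close to the identity, then the part `M` of its
environment `Γ M E` almost forgets the input. -/
theorem exists_replaceMap_of_environment [Nonempty A] {Γ : Type*} [Fintype Γ] [DecidableEq Γ]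
    (m₀ : M) {k₁ : Γ × (M × E) → Matrix A A ℂ} (hk₁ : IsTP k₁) {ε : ℝ≥0}
    (h : diamondDist (krausMap k₁) LinearMap.id ≤ ε) :
    ∃ σ : Matrix M M ℂ, IsDensity σ ∧ diamondDist (replaceMap σ)
      (krausMap fun p : A × (Γ × E) => (Matrix.of fun m a => k₁ (p.2.1, m, p.2.2) p.1 a :
        Matrix M A ℂ)) ≤ ((2 * NNReal.sqrt ε : ℝ≥0) : ℝ≥0∞) := by
  rw [← krausMap_id] at h
  obtain ⟨G, hG, hGo⟩ := exists_uniform_overlap_ge hk₁ (by simp [IsTP]) h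
  set g : Γ × (M × E) → ℂ := fun p => G p () with hg
  set r : ℝ := 1 - ∑ p, ‖g p‖ ^ 2 with hr
  have hr0 : 0 ≤ r := by
    have h1 := hG.diag_nonneg (i := ())
    rw [Matrix.sub_apply, Matrix.one_apply_eq, Matrix.mul_apply] at h1
    have h2 : ((∑ p, ‖g p‖ ^ 2 : ℝ) : ℂ) = ∑ p, G.conjTranspose () p * G p () := by
      push_cast
      refine Finset.sum_congr rfl fun i _ => ?_
      rw [Matrix.conjTranspose_apply, ← Complex.conj_mul']
      rfl
    rw [← h2] at h1
    exact_mod_cast h1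
  -- `L` prepares the vector `g` on `Γ M E` while the input moves to the environment; the second
  -- summand compensates for `g` having norm less than one
  set K : (A × (Γ × E)) ⊕ A → Matrix M A ℂ :=
    Sum.elim (fun p => Matrix.of fun m a => k₁ (p.2.1, m, p.2.2) p.1 a) (fun _ => 0) with hK
  set L : (A × (Γ × E)) ⊕ A → Matrix M A ℂ :=
    Sum.elim (fun p => Matrix.of fun m a => if a = p.1 then star (g (p.2.1, m, p.2.2)) else 0)
      (fun a' => Matrix.of fun m a => if a = a' then (if m = m₀ then (Real.sqrt r : ℂ) else 0)
        else 0) with hL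
  have hKmap : krausMap K = krausMap fun p : A × (Γ × E) =>
      (Matrix.of fun m a => k₁ (p.2.1, m, p.2.2) p.1 a : Matrix M A ℂ) := by
    refine LinearMap.ext fun X => ?_
    simp [krausMap_apply, hK, Fintype.sum_sum_type]
  set σ : Matrix M M ℂ := Matrix.of fun m m' =>
    (∑ x : Γ, ∑ e : E, star (g (x, m, e)) * g (x, m', e)) +
      (if m = m₀ then (Real.sqrt r : ℂ) else 0) * (if m' = m₀ then (Real.sqrt r : ℂ) else 0) with hσ
  have hLmap : krausMap L = replaceMap σ := by
    refine LinearMap.ext fun X => ?_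
    ext m m'
    rw [krausMap_apply_apply]
    simp only [hL, Fintype.sum_sum_type, Sum.elim_inl, Sum.elim_inr, Matrix.of_apply,
      apply_ite star, star_star, star_zero, ite_mul, zero_mul, mul_ite, mul_zero,
      Finset.sum_ite_irrel, Finset.sum_const_zero, Finset.sum_ite_eq', Finset.mem_univ, if_true,
      Fintype.sum_prod_type]
    simp only [replaceMap, LinearMap.coe_mk, AddHom.coe_mk, Matrix.smul_apply, smul_eq_mul, hσ,
      Matrix.of_apply, mul_add, Matrix.trace, Matrix.diag_apply, Finset.sum_mul, Finset.mul_sum]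
    congr 1
    · rw [Finset.sum_comm]
      refine Finset.sum_congr rfl fun x _ => ?_
      rw [Finset.sum_comm]
      exact Finset.sum_congr rfl fun e _ => Finset.sum_congr rfl fun a _ => by ring
    · have h3 : star (Real.sqrt r : ℂ) = Real.sqrt r := Complex.conj_ofReal _
      rw [h3]
      by_cases h1 : m = m₀ <;> by_cases h2 : m' = m₀ <;>
        simp only [h1, h2, if_true, if_false, mul_zero, zero_mul, Finset.sum_const_zero]
      exact Finset.sum_congr rfl fun a _ => by ring
  have hσtr : σ.trace = 1 := by
    have h3 : (r : ℂ) = 1 - ∑ x : Γ, ∑ m : M, ∑ e : E, star (g (x, m, e)) * g (x, m, e) := by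
      rw [hr]
      push_cast
      simp only [Fintype.sum_prod_type]
      congr 1
      refine Finset.sum_congr rfl fun x _ => Finset.sum_congr rfl fun m _ =>
        Finset.sum_congr rfl fun e _ => ?_
      rw [← Complex.conj_mul']
      rfl
    have h4 : (Real.sqrt r : ℂ) * Real.sqrt r = r := by
      exact_mod_cast Real.mul_self_sqrt hr0
    simp only [Matrix.trace, Matrix.diag_apply, hσ, Matrix.of_apply, Finset.sum_add_distrib,
      ite_mul, zero_mul, mul_ite, mul_zero, Finset.sum_ite_eq', Finset.mem_univ, if_true]
    rw [h4, h3, Finset.sum_comm]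
    ring
  have hKTP : IsTP K := isTP_of_trace_preserving fun X => by
    rw [trace_krausMap]
    have h5 : ∑ e, (K e).conjTranspose * K e = ∑ p, (k₁ p).conjTranspose * k₁ p := by
      ext i j
      simp only [hK, Fintype.sum_sum_type, Sum.elim_inl, Sum.elim_inr,
        Matrix.sum_apply, Matrix.mul_apply,
        Matrix.conjTranspose_apply, Matrix.of_apply, Fintype.sum_prod_type]
      rw [show ∑ a : A, ∑ m : M, star ((0 : Matrix M A ℂ) m i) * (0 : Matrix M A ℂ) m j = 0 by simp,
        add_zero, Finset.sum_comm]
      refine Finset.sum_congr rfl fun x _ => ?_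
      calc _ = ∑ a : A, ∑ m : M, ∑ e : E, star (k₁ (x, m, e) a i) * k₁ (x, m, e) a j :=
            Finset.sum_congr rfl fun a _ => Finset.sum_comm
        _ = ∑ m : M, ∑ a : A, ∑ e : E, star (k₁ (x, m, e) a i) * k₁ (x, m, e) a j :=
            Finset.sum_comm
        _ = ∑ m : M, ∑ e : E, ∑ a : A, star (k₁ (x, m, e) a i) * k₁ (x, m, e) a j :=
            Finset.sum_congr rfl fun m _ => Finset.sum_comm
    rw [h5, show ∑ p, (k₁ p).conjTranspose * k₁ p = 1 from hk₁, Matrix.one_mul]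
  have hLTP : IsTP L := isTP_of_trace_preserving fun X => by
    rw [hLmap, trace_replaceMap hσtr]
  refine ⟨σ, ?_, ?_⟩
  · obtain ⟨ρ, hρ⟩ := exists_isDensity (A := A)
    have h1 := hLTP.isChannel.isDensity hρ
    rw [hLmap] at h1
    simpa [replaceMap, hρ.2] using h1
  · rw [← hLmap, ← hKmap, diamondDist_comm]
    refine diamondDist_le_of_overlap hKTP hLTP fun ρ hρ => (hGo ρ hρ).trans_eq ?_
    rw [overlap]
    congr 1
    simp only [hK, hL, Fintype.sum_sum_type, Sum.elim_inl, Sum.elim_inr, Fintype.sum_prod_type]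
    simp only [Matrix.mul_zero, Finset.sum_const_zero,
      Finset.univ_unique, Finset.sum_singleton, Matrix.conjTranspose_one,
      Matrix.one_mul, Matrix.trace, Matrix.diag_apply, Matrix.mul_apply,
      Matrix.conjTranspose_apply, Matrix.of_apply, apply_ite star, star_star, star_zero, ite_mul,
      zero_mul, Finset.sum_ite_irrel, Finset.sum_ite_eq', Finset.mem_univ, if_true,
      Finset.mul_sum, Finset.sum_mul]
    rw [show ∑ a : A, ∑ i : A, (0 : Matrix A A ℂ) i i = 0 by simp, add_zero]
    symm
    rw [Finset.sum_comm]
    refine Finset.sum_congr rfl fun x _ => ?_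
    calc _ = ∑ a : A, ∑ m : M, ∑ e : E, ∑ c : A, g (x, m, e) * k₁ (x, m, e) a c * ρ c a := by
          refine Finset.sum_congr rfl fun a _ => ?_
          rw [Finset.sum_comm (s := (Finset.univ : Finset M))]
          exact Finset.sum_congr rfl fun e _ => Finset.sum_comm
      _ = ∑ m : M, ∑ e : E, ∑ a : A, ∑ c : A, g (x, m, e) * k₁ (x, m, e) a c * ρ c a := by
          rw [Finset.sum_comm]
          exact Finset.sum_congr rfl fun m _ => Finset.sum_comm
      _ = _ := by simp only [hg, mul_assoc]

/-- If the input of a channel `Q → M M'` can be almost recovered from `M'`, then the channel to `M`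
almost forgets it. -/
theorem exists_replaceMap_of_decoder [Nonempty A] {N : SuperOp A (M × M')} (hN : IsChannel N)
    {D : SuperOp M' A} (hD : IsChannel D) {ε : ℝ≥0}
    (h : diamondDist (D ∘ₗ traceFst ∘ₗ N) LinearMap.id ≤ ε) :
    ∃ σ : Matrix M M ℂ, IsDensity σ ∧
      diamondDist (replaceMap σ) (traceSnd ∘ₗ N) ≤ ((2 * NNReal.sqrt ε : ℝ≥0) : ℝ≥0∞) := by
  obtain ⟨m₀⟩ : Nonempty M := (isChannel_traceSnd.comp hN).nonempty
  obtain ⟨k, rfl, hk⟩ := hN.exists_kraus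
  obtain ⟨d, rfl, hd⟩ := hD.exists_kraus
  set s : M → Matrix M' (M × M') ℂ :=
    fun a => Matrix.of fun b p => if a = p.1 ∧ b = p.2 then 1 else 0 with hs
  have hsmap : traceFst = krausMap s := traceFst_eq_krausMap
  have hsTP : IsTP s := isTP_of_trace_preserving fun X => by
    rw [← hsmap, isChannel_traceFst.trace_preserving]
  rw [hsmap, krausMap_comp, krausMap_comp] at h
  obtain ⟨σ, hσ, hσd⟩ := exists_replaceMap_of_environment m₀ (hd.comp (hsTP.comp hk)) h
  refine ⟨σ, hσ, ?_⟩
  convert hσd using 2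
  refine LinearMap.ext fun X => ?_
  ext m m'
  have h1 : ∀ Y : Matrix M' M' ℂ, ∑ a, ∑ x, (d x * Y * (d x).conjTranspose) a a = Y.trace := by
    intro Y
    rw [← hd.isChannel.trace_preserving, krausMap_apply, Matrix.trace_sum, Finset.sum_comm]
    rfl
  have h2 : ∀ e, ∑ b, (k e * X * (k e).conjTranspose) (m, b) (m', b) =
      (s m * k e * X * (s m' * k e).conjTranspose).trace := by
    intro e
    have h3 : s m * k e * X * (s m' * k e).conjTranspose =
        s m * (k e * X * (k e).conjTranspose) * (s m').conjTranspose := by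
      rw [Matrix.conjTranspose_mul]; simp only [Matrix.mul_assoc]
    rw [h3]
    generalize k e * X * (k e).conjTranspose = Z
    simp [Matrix.trace, Matrix.mul_apply, hs, Fintype.sum_prod_type, ite_and, apply_ite]
  calc _ = ∑ e, ∑ b, (k e * X * (k e).conjTranspose) (m, b) (m', b) := by
        rw [LinearMap.comp_apply, traceSnd_apply, krausMap_apply, Finset.sum_comm]
        simp only [Matrix.sum_apply]
    _ = ∑ e, ∑ a, ∑ x, (d x * (s m * k e) * X * (d x * (s m' * k e)).conjTranspose) a a := by
        refine Finset.sum_congr rfl fun e _ => ?_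
        rw [h2, ← h1]
        simp only [Matrix.conjTranspose_mul, Matrix.mul_assoc]
    _ = ∑ a, ∑ x, ∑ e, (d x * (s m * k e) * X * (d x * (s m' * k e)).conjTranspose) a a := by
        rw [Finset.sum_comm]
        exact Finset.sum_congr rfl fun a _ => Finset.sum_comm
    _ = _ := by
        rw [krausMap_apply_apply, Fintype.sum_prod_type]
        simp only [Fintype.sum_prod_type (α₁ := M' × A)]
        refine Finset.sum_congr rfl fun a _ => Finset.sum_congr rfl fun x _ =>
          Finset.sum_congr rfl fun e _ => ?_
        rw [Matrix.mul_apply]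
        simp only [Matrix.mul_apply (N := X), Finset.sum_mul]
        rw [Finset.sum_comm]
        rfl

end Tradeoff

/-! ### Protocols with a common first round -/

section Joint

variable {A A' B B' Q L R L' R' M M' N N' E F : Type*}
  [Fintype A] [DecidableEq A] [Fintype B] [DecidableEq B] [Fintype A'] [DecidableEq A']
  [Fintype B'] [DecidableEq B']
  [Fintype Q] [DecidableEq Q] [Fintype L] [DecidableEq L] [Fintype R] [DecidableEq R]
  [Fintype L'] [DecidableEq L'] [Fintype R'] [DecidableEq R']
  [Fintype M] [DecidableEq M] [Fintype M'] [DecidableEq M']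
  [Fintype N] [DecidableEq N] [Fintype N'] [DecidableEq N']
  [Fintype E] [DecidableEq E] [Fintype F] [DecidableEq F]

/-- The channel from `Q` to the two outputs when Alice applies `Φ`, Bob applies `Ψ`, and they share
the resource state `S`. -/
def joint (Φ : SuperOp (Q × L) M) (Ψ : SuperOp R N) (S : Matrix (L × R) (L × R) ℂ) :
    SuperOp Q (M × N) :=
  tensorMap Φ Ψ ∘ₗ withResource S

theorem joint_comp (Φ' : SuperOp M M') (Ψ' : SuperOp N N') (Φ : SuperOp (Q × L) M)
    (Ψ : SuperOp R N) (S : Matrix (L × R) (L × R) ℂ) :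
    joint (Φ' ∘ₗ Φ) (Ψ' ∘ₗ Ψ) S = tensorMap Φ' Ψ' ∘ₗ joint Φ Ψ S := by
  rw [joint, tensorMap_comp, LinearMap.comp_assoc, joint]

theorem withResource_apply (S : Matrix (L × R) (L × R) ℂ) (X : Matrix Q Q ℂ) (q q' : Q) (l l' : L)
    (r r' : R) : withResource S X ((q, l), r) ((q', l'), r') = X q q' * S (l, r) (l', r') := rfl

theorem withResource_mul_conjTranspose (S : Matrix (L × R) E ℂ) :
    (withResource (S * S.conjTranspose) : SuperOp Q ((Q × L) × R)) =
      krausMap fun e => Matrix.of fun p q => if p.1.1 = q then S (p.1.2, p.2) e else 0 := by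
  refine LinearMap.ext fun X => ?_
  ext ⟨⟨q, l⟩, r⟩ ⟨⟨q', l'⟩, r'⟩
  simp [withResource_apply, krausMap_apply_apply, Matrix.mul_apply, apply_ite, Finset.mul_sum]
  refine Finset.sum_congr rfl fun e _ => ?_
  ring

theorem isChannel_withResource {S : Matrix (L × R) (L × R) ℂ} (hS : IsDensity S) :
    IsChannel (withResource S : SuperOp Q ((Q × L) × R)) := by
  obtain ⟨T, rfl⟩ := exists_eq_mul_conjTranspose hS.1
  rw [withResource_mul_conjTranspose]
  refine IsTP.isChannel (isTP_of_trace_preserving fun X => ?_)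
  rw [← withResource_mul_conjTranspose]
  have h := hS.2
  simp only [Matrix.trace, Matrix.diag_apply, Fintype.sum_prod_type, withResource_apply] at h ⊢
  simp only [← Finset.mul_sum, h, mul_one]

theorem isChannel_joint {Φ : SuperOp (Q × L) M} {Ψ : SuperOp R N} {S : Matrix (L × R) (L × R) ℂ}
    (hΦ : IsChannel Φ) (hΨ : IsChannel Ψ) (hS : IsDensity S) : IsChannel (joint Φ Ψ S) :=
  (hΦ.tensorMap hΨ).comp (isChannel_withResource hS)

theorem tensorMap_reindexMap (e : A ≃ A') (f : B ≃ B') :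
    tensorMap (reindexMap e) (reindexMap f) = reindexMap (e.prodCongr f) := by
  refine superOp_prod_ext fun X Y => ?_
  rw [tensorMap_kronecker]
  rfl

theorem joint_reindex (Φ : SuperOp (Q × L) M) (Ψ : SuperOp R N) (S : Matrix (L × R) (L × R) ℂ)
    (eL : L ≃ L') (eR : R ≃ R') :
    joint (Φ ∘ₗ reindexMap ((Equiv.refl Q).prodCongr eL.symm)) (Ψ ∘ₗ reindexMap eR.symm)
      (reindexMap (eL.prodCongr eR) S) = joint Φ Ψ S := by
  rw [joint, tensorMap_comp, tensorMap_reindexMap, LinearMap.comp_assoc, joint]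
  congr 1
  refine LinearMap.ext fun X => ?_
  ext ⟨⟨q, l⟩, r⟩ ⟨⟨q', l'⟩, r'⟩
  simp [withResource_apply]

theorem tensorMap_traceSnd_traceSnd :
    tensorMap (traceSnd : SuperOp (M × M') M) (traceSnd : SuperOp (N × N') N) =
      traceSnd ∘ₗ reindexMap (Equiv.prodProdProdComm M M' N N') := by
  refine superOp_prod_ext fun X Y => ?_
  rw [tensorMap_kronecker]
  ext ⟨m, n⟩ ⟨m', n'⟩
  simp [traceSnd_apply, Fintype.sum_prod_type, Finset.sum_mul_sum]

theorem tensorMap_traceFst_traceFst :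
    tensorMap (traceFst : SuperOp (M × M') M') (traceFst : SuperOp (N × N') N') =
      traceFst ∘ₗ reindexMap (Equiv.prodProdProdComm M M' N N') := by
  refine superOp_prod_ext fun X Y => ?_
  rw [tensorMap_kronecker]
  ext ⟨m, n⟩ ⟨m', n'⟩
  simp [traceFst_apply, Fintype.sum_prod_type, Finset.sum_mul_sum]

theorem traceSnd_comp_reindexMap (e : A ≃ A') (f : B ≃ B') :
    traceSnd ∘ₗ reindexMap (e.prodCongr f) = reindexMap e ∘ₗ traceSnd := by
  rw [← tensorMap_reindexMap]
  refine superOp_prod_ext fun X Y => ?_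
  rw [LinearMap.comp_apply, tensorMap_kronecker]
  ext i j
  simp only [traceSnd_apply, Matrix.kroneckerMap_apply, reindexMap_apply, LinearMap.comp_apply]
  exact f.symm.sum_comp (fun b => X (e.symm i) (e.symm j) * Y b b)

theorem traceFst_comp_reindexMap (e : A ≃ A') (f : B ≃ B') :
    traceFst ∘ₗ reindexMap (e.prodCongr f) = reindexMap f ∘ₗ traceFst := by
  rw [← tensorMap_reindexMap]
  refine superOp_prod_ext fun X Y => ?_
  rw [LinearMap.comp_apply, tensorMap_kronecker]
  ext i j
  simp only [traceFst_apply, Matrix.kroneckerMap_apply, reindexMap_apply, LinearMap.comp_apply]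
  exact e.symm.sum_comp (fun a => X a a * Y (f.symm i) (f.symm j))

theorem tensorMap_id_traceSnd :
    tensorMap (LinearMap.id : SuperOp A A) (traceSnd : SuperOp (B × B') B) =
      traceSnd ∘ₗ reindexMap (Equiv.prodAssoc A B B').symm := by
  refine superOp_prod_ext fun X Y => ?_
  rw [tensorMap_kronecker]
  ext ⟨a, b⟩ ⟨a', b'⟩
  simp [traceSnd_apply, Finset.mul_sum]

theorem tensorMap_krausMap_comp_withResource (k : E → Matrix M (Q × L) ℂ) (l : F → Matrix N R ℂ)
    (ψ : L × R → ℂ) : joint (krausMap k) (krausMap l) (Matrix.vecMulVec ψ (star ψ)) =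
      krausMap fun p : E × F => (Matrix.of fun b q => ∑ a, ∑ r, k p.1 b.1 (q, a) * l p.2 b.2 r *
        ψ (a, r) : Matrix (M × N) Q ℂ) := by
  have h : Matrix.vecMulVec ψ (star ψ) = (Matrix.of fun a (_ : Unit) => ψ a) *
      (Matrix.of fun a (_ : Unit) => ψ a).conjTranspose := by
    ext a b
    simp [Matrix.vecMulVec_apply, Matrix.mul_apply]
  rw [joint, tensorMap_krausMap, h, withResource_mul_conjTranspose, krausMap_comp,
    ← krausMap_equiv (Equiv.prodPUnit (E × F)).symm]
  congr 1
  ext p b q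
  simp [Matrix.mul_apply, Fintype.sum_prod_type, mul_assoc, Finset.sum_ite_irrel]

/-- The isometric channel `A → B E` with Kraus operators `k` for the environment `E`. -/
def isoMap (k : E → Matrix B A ℂ) : SuperOp A (B × E) :=
  krausMap fun _ : Unit => Matrix.of fun p a => k p.2 p.1 a

theorem isChannel_isoMap {k : E → Matrix B A ℂ} (hk : IsTP k) : IsChannel (isoMap k) := by
  refine IsTP.isChannel (Eq.trans ?_ hk)
  ext a a'
  simp [Matrix.sum_apply, Matrix.mul_apply, Fintype.sum_prod_type]
  rw [Finset.sum_comm]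

theorem traceSnd_comp_isoMap (k : E → Matrix B A ℂ) : traceSnd ∘ₗ isoMap k = krausMap k := by
  refine LinearMap.ext fun X => ?_
  ext b b'
  simp [isoMap, traceSnd_apply, krausMap_apply_apply]

theorem traceFst_comp_isoMap (k : E → Matrix B A ℂ) :
    traceFst ∘ₗ isoMap k = krausMap (krausCompl k) := by
  refine LinearMap.ext fun X => ?_
  ext b b'
  simp [isoMap, traceFst_apply, krausMap_apply_apply, krausCompl]

end Joint

/-! ### From `f`-routing to conditional disclosure of secrets -/

namespace FRProtocol

variable {n : ℕ} {Q L R M₀ M₀' M₁ M₁' : Type*}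
  [Fintype Q] [DecidableEq Q] [Fintype L] [DecidableEq L] [Fintype R] [DecidableEq R]
  [Fintype M₀] [DecidableEq M₀] [Fintype M₀'] [DecidableEq M₀']
  [Fintype M₁] [DecidableEq M₁] [Fintype M₁'] [DecidableEq M₁']

theorem toBob_eq_joint (P : FRProtocol n Q L R M₀ M₀' M₁ M₁') (x y : Fin n → Bool) :
    P.toBob x y = joint (traceSnd ∘ₗ P.alice x) (traceSnd ∘ₗ P.bob y) P.state := by
  rw [joint_comp]
  rfl

theorem toAlice_eq_joint (P : FRProtocol n Q L R M₀ M₀' M₁ M₁') (x y : Fin n → Bool) :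
    P.toAlice x y = joint (traceFst ∘ₗ P.alice x) (traceFst ∘ₗ P.bob y) P.state := by
  rw [joint_comp]
  rfl

/-- The conditional disclosure protocol in which the systems that Bob holds at the end of an
`f`-routing protocol are sent to the referee, and all others are discarded. -/
def toCDQS (P : FRProtocol n Q L R M₀ M₀' M₁ M₁') : CDQSProtocol n Q L R M₀ M₁ where
  state := P.state
  state_isDensity := P.state_isDensity
  alice x := traceSnd ∘ₗ P.alice x
  alice_isChannel x := isChannel_traceSnd.comp (P.alice_isChannel x)
  bob y := traceSnd ∘ₗ P.bob y
  bob_isChannel y := isChannel_traceSnd.comp (P.bob_isChannel y)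

theorem toCDQS_channel (P : FRProtocol n Q L R M₀ M₀' M₁ M₁') (x y : Fin n → Bool) :
    P.toCDQS.channel x y = P.toBob x y :=
  (P.toBob_eq_joint x y).symm

theorem IsCorrect.toCDQS_isCorrect {P : FRProtocol n Q L R M₀ M₀' M₁ M₁'}
    {f : (Fin n → Bool) → (Fin n → Bool) → Bool} {ε₀ ε₁ : ℝ≥0} (h : P.IsCorrect f ε₀ ε₁) :
    P.toCDQS.IsCorrect f ε₁ := fun x y hxy => by
  rw [toCDQS_channel]
  exact h.1 x y hxy

theorem IsCorrect.toCDQS_isSecure [Nonempty Q] {P : FRProtocol n Q L R M₀ M₀' M₁ M₁'}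
    {f : (Fin n → Bool) → (Fin n → Bool) → Bool} {ε₀ ε₁ : ℝ≥0} (h : P.IsCorrect f ε₀ ε₁) :
    P.toCDQS.IsSecure f (2 * NNReal.sqrt ε₀) := fun x y hxy => by
  obtain ⟨D, hD, hDd⟩ := h.2 x y hxy
  have hN : IsChannel (reindexMap (Equiv.prodProdProdComm M₀ M₀' M₁ M₁') ∘ₗ P.channel x y) :=
    (isChannel_reindexMap _).comp
      (isChannel_joint (P.alice_isChannel x) (P.bob_isChannel y) P.state_isDensity)
  have h1 : P.toAlice x y = traceFst ∘ₗ
      (reindexMap (Equiv.prodProdProdComm M₀ M₀' M₁ M₁') ∘ₗ P.channel x y) := by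
    rw [toAlice, tensorMap_traceFst_traceFst, LinearMap.comp_assoc]
  have h2 : P.toBob x y = traceSnd ∘ₗ
      (reindexMap (Equiv.prodProdProdComm M₀ M₀' M₁ M₁') ∘ₗ P.channel x y) := by
    rw [toBob, tensorMap_traceSnd_traceSnd, LinearMap.comp_assoc]
  rw [h1] at hDd
  rw [toCDQS_channel, h2]
  exact exists_replaceMap_of_decoder hN hD hDd

variable {K T N₀ N₀' N₁ N₁' : Type*} [Fintype K] [DecidableEq K] [Fintype T] [DecidableEq T]
  [Fintype N₀] [DecidableEq N₀] [Fintype N₀'] [DecidableEq N₀']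
  [Fintype N₁] [DecidableEq N₁] [Fintype N₁'] [DecidableEq N₁']

/-- Relabelling the bases of all systems but `Q`. -/
def reindex (P : FRProtocol n Q L R M₀ M₀' M₁ M₁') (eL : L ≃ K) (eR : R ≃ T) (e₀ : M₀ ≃ N₀)
    (e₀' : M₀' ≃ N₀') (e₁ : M₁ ≃ N₁) (e₁' : M₁' ≃ N₁') : FRProtocol n Q K T N₀ N₀' N₁ N₁' where
  state := reindexMap (eL.prodCongr eR) P.state
  state_isDensity := (isChannel_reindexMap _).isDensity P.state_isDensity
  alice x := (reindexMap (e₀.prodCongr e₀') ∘ₗ P.alice x) ∘ₗ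
    reindexMap ((Equiv.refl Q).prodCongr eL.symm)
  alice_isChannel x := ((isChannel_reindexMap _).comp (P.alice_isChannel x)).comp
    (isChannel_reindexMap _)
  bob y := (reindexMap (e₁.prodCongr e₁') ∘ₗ P.bob y) ∘ₗ reindexMap eR.symm
  bob_isChannel y := ((isChannel_reindexMap _).comp (P.bob_isChannel y)).comp
    (isChannel_reindexMap _)

theorem IsCorrect.reindex {P : FRProtocol n Q L R M₀ M₀' M₁ M₁'}
    {f : (Fin n → Bool) → (Fin n → Bool) → Bool} {ε₀ ε₁ : ℝ≥0} (h : P.IsCorrect f ε₀ ε₁)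
    (eL : L ≃ K) (eR : R ≃ T) (e₀ : M₀ ≃ N₀) (e₀' : M₀' ≃ N₀') (e₁ : M₁ ≃ N₁)
    (e₁' : M₁' ≃ N₁') : (P.reindex eL eR e₀ e₀' e₁ e₁').IsCorrect f ε₀ ε₁ := by
  refine ⟨fun x y hxy => ?_, fun x y hxy => ?_⟩
  · obtain ⟨D, hD, hDd⟩ := h.1 x y hxy
    refine ⟨D ∘ₗ reindexMap (e₀.prodCongr e₁).symm, hD.comp (isChannel_reindexMap _), ?_⟩
    have h1 : (P.reindex eL eR e₀ e₀' e₁ e₁').toBob x y =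
        reindexMap (e₀.prodCongr e₁) ∘ₗ P.toBob x y := by
      rw [toBob_eq_joint, toBob_eq_joint]
      simp only [FRProtocol.reindex, ← LinearMap.comp_assoc, traceSnd_comp_reindexMap]
      rw [joint_reindex, LinearMap.comp_assoc, LinearMap.comp_assoc, joint_comp,
        tensorMap_reindexMap]
    rw [h1, LinearMap.comp_assoc, ← LinearMap.comp_assoc _ _ (reindexMap (e₀.prodCongr e₁).symm),
      reindexMap_symm_comp, LinearMap.id_comp]
    exact hDd
  · obtain ⟨D, hD, hDd⟩ := h.2 x y hxy
    refine ⟨D ∘ₗ reindexMap (e₀'.prodCongr e₁').symm, hD.comp (isChannel_reindexMap _), ?_⟩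
    have h1 : (P.reindex eL eR e₀ e₀' e₁ e₁').toAlice x y =
        reindexMap (e₀'.prodCongr e₁') ∘ₗ P.toAlice x y := by
      rw [toAlice_eq_joint, toAlice_eq_joint]
      simp only [FRProtocol.reindex, ← LinearMap.comp_assoc, traceFst_comp_reindexMap]
      rw [joint_reindex, LinearMap.comp_assoc, LinearMap.comp_assoc, joint_comp,
        tensorMap_reindexMap]
    rw [h1, LinearMap.comp_assoc, ← LinearMap.comp_assoc _ _ (reindexMap (e₀'.prodCongr e₁').symm),
      reindexMap_symm_comp, LinearMap.id_comp]
    exact hDd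

end FRProtocol

/-! ### From conditional disclosure of secrets to `f`-routing -/

section Qubits

variable {A B : Type*} [Fintype A] [Fintype B]

theorem qubits_nonneg : 0 ≤ qubits A := by
  rw [qubits]
  rcases Nat.eq_zero_or_pos (Fintype.card A) with h | h
  · simp [h]
  · exact Real.logb_nonneg one_lt_two (by exact_mod_cast h)

theorem qubits_prod [Nonempty A] [Nonempty B] : qubits (A × B) = qubits A + qubits B := by
  rw [qubits, Fintype.card_prod, Nat.cast_mul, Real.logb_mul] <;> simp [qubits]

theorem qubits_prod_le : qubits (A × B) ≤ qubits A + qubits B := by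
  rcases isEmpty_or_nonempty A with h | h
  · have : qubits (A × B) = 0 := by simp [qubits]
    rw [this]
    exact add_nonneg qubits_nonneg qubits_nonneg
  rcases isEmpty_or_nonempty B with h' | h'
  · have : qubits (A × B) = 0 := by simp [qubits]
    rw [this]
    exact add_nonneg qubits_nonneg qubits_nonneg
  exact qubits_prod.le

theorem qubits_fin_card : qubits (Fin (Fintype.card A)) = qubits A := by simp [qubits]

end Qubits

namespace CDQSProtocol

variable {n : ℕ} {Q L R MA MB : Type*}
  [Fintype Q] [DecidableEq Q] [Fintype L] [DecidableEq L] [Fintype R] [DecidableEq R]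
  [Fintype MA] [DecidableEq MA] [Fintype MB] [DecidableEq MB]

theorem channel_eq_joint (P : CDQSProtocol n Q L R MA MB) (x y : Fin n → Bool) :
    P.channel x y = joint (P.alice x) (P.bob y) P.state := rfl

section Routing

variable {EA EB : Type*} [Fintype EA] [DecidableEq EA] [Fintype EB] [DecidableEq EB]

/-- The `f`-routing protocol in which Alice and Bob apply isometric dilations of their channels;
the messages of the conditional disclosure protocol end up with Bob and the environments of the
dilations with Alice. -/
def toFR (P : CDQSProtocol n Q L R MA MB) (kA : (Fin n → Bool) → EA → Matrix MA (Q × L) ℂ)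
    (kB : (Fin n → Bool) → EB → Matrix MB R ℂ) (hA : ∀ x, P.alice x = krausMap (kA x))
    (hB : ∀ y, P.bob y = krausMap (kB y)) : FRProtocol n Q L R MA EA MB EB where
  state := P.state
  state_isDensity := P.state_isDensity
  alice x := isoMap (kA x)
  alice_isChannel x := isChannel_isoMap (isTP_of_trace_preserving fun X => by
    rw [← hA, (P.alice_isChannel x).trace_preserving])
  bob y := isoMap (kB y)
  bob_isChannel y := isChannel_isoMap (isTP_of_trace_preserving fun X => by
    rw [← hB, (P.bob_isChannel y).trace_preserving])

theorem toFR_isCorrect [Nonempty Q] (P : CDQSProtocol n Q L R MA MB)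
    (kA : (Fin n → Bool) → EA → Matrix MA (Q × L) ℂ)
    (kB : (Fin n → Bool) → EB → Matrix MB R ℂ) (hA : ∀ x, P.alice x = krausMap (kA x))
    (hB : ∀ y, P.bob y = krausMap (kB y)) (hψ : IsPure P.state)
    {f : (Fin n → Bool) → (Fin n → Bool) → Bool} {ε δ : ℝ≥0} (hε : P.IsCorrect f ε)
    (hδ : P.IsSecure f δ) : (P.toFR kA kB hA hB).IsCorrect f (2 * NNReal.sqrt δ) ε := by
  have h1 : ∀ x y, (P.toFR kA kB hA hB).toBob x y = P.channel x y := by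
    intro x y
    rw [FRProtocol.toBob_eq_joint, channel_eq_joint, hA, hB]
    simp only [toFR, traceSnd_comp_isoMap]
  refine ⟨fun x y hxy => ?_, fun x y hxy => ?_⟩
  · rw [h1]
    exact hε x y hxy
  · obtain ⟨-, ψ, hψ⟩ := hψ
    obtain ⟨σ, hσ, hσd⟩ := hδ x y hxy
    have hch := isChannel_joint (P.alice_isChannel x) (P.bob_isChannel y) P.state_isDensity
    rw [channel_eq_joint, hA, hB, hψ, tensorMap_krausMap_comp_withResource] at hσd
    rw [hA, hB, hψ, tensorMap_krausMap_comp_withResource] at hch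
    obtain ⟨D, hD, hDd⟩ := exists_decoder_of_diamondDist_replaceMap_le
      (isTP_of_trace_preserving hch.trace_preserving) hσ hσd
    refine ⟨D, hD, ?_⟩
    rw [FRProtocol.toAlice_eq_joint]
    simp only [toFR, traceFst_comp_isoMap]
    rw [hψ, tensorMap_krausMap_comp_withResource]
    exact hDd

/-- `toFR` with the bases of the messages labelled by numbers. -/
theorem exists_frProtocol [Nonempty Q] (P : CDQSProtocol n Q L R MA MB)
    (kA : (Fin n → Bool) → EA → Matrix MA (Q × L) ℂ)
    (kB : (Fin n → Bool) → EB → Matrix MB R ℂ) (hA : ∀ x, P.alice x = krausMap (kA x))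
    (hB : ∀ y, P.bob y = krausMap (kB y)) (hψ : IsPure P.state)
    {f : (Fin n → Bool) → (Fin n → Bool) → Bool} {ε δ : ℝ≥0} (hε : P.IsCorrect f ε)
    (hδ : P.IsSecure f δ) :
    ∃ P' : FRProtocol n Q L R (Fin (Fintype.card MA)) (Fin (Fintype.card EA))
      (Fin (Fintype.card MB)) (Fin (Fintype.card EB)),
      P'.state = P.state ∧ P'.IsCorrect f (2 * NNReal.sqrt δ) ε :=
  ⟨(P.toFR kA kB hA hB).reindex (Equiv.refl L) (Equiv.refl R) (Fintype.equivFin MA)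
    (Fintype.equivFin EA) (Fintype.equivFin MB) (Fintype.equivFin EB), rfl,
    (P.toFR_isCorrect kA kB hA hB hψ hε hδ).reindex _ _ _ _ _ _⟩

end Routing

theorem exists_kraus (P : CDQSProtocol n Q L R MA MB) :
    ∃ (kA : (Fin n → Bool) → (Q × L) × MA → Matrix MA (Q × L) ℂ)
      (kB : (Fin n → Bool) → R × MB → Matrix MB R ℂ), (∀ x, P.alice x = krausMap (kA x)) ∧
      ∀ y, P.bob y = krausMap (kB y) := by
  choose kA hA using fun x => (P.alice_isChannel x).exists_kraus
  choose kB hB using fun y => (P.bob_isChannel y).exists_kraus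
  exact ⟨kA, kB, fun x => (hA x).1, fun y => (hB y).1⟩

/-- The vector `∑ᵢ √S |i⟩ |i⟩` is a purification of `S`. -/
theorem exists_purification (S : Matrix (L × R) (L × R) ℂ) (hS : IsDensity S) :
    ∃ S' : Matrix (L × (R × Fin (Fintype.card (L × R)))) (L × (R × Fin (Fintype.card (L × R)))) ℂ,
      IsPure S' ∧ ∀ i j : L × R, S i j = ∑ k, S' (i.1, (i.2, k)) (j.1, (j.2, k)) := by
  obtain ⟨T, hT⟩ := exists_eq_mul_conjTranspose hS.1
  set e := Fintype.equivFin (L × R)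
  set ψ : L × (R × Fin (Fintype.card (L × R))) → ℂ := fun p => T (p.1, p.2.1) (e.symm p.2.2) with hψ
  have h1 : ∀ i j : L × R, S i j = ∑ k, Matrix.vecMulVec ψ (star ψ) (i.1, (i.2, k))
      (j.1, (j.2, k)) := by
    intro i j
    rw [hT, Matrix.mul_apply, ← e.symm.sum_comp]
    rfl
  refine ⟨Matrix.vecMulVec ψ (star ψ),
    ⟨⟨Matrix.posSemidef_vecMulVec_self_star ψ, ?_⟩, ψ, rfl⟩, h1⟩
  rw [← hS.2]
  simp only [Matrix.trace, Matrix.diag_apply, h1, Fintype.sum_prod_type]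

/-- Replacing the resource state by an extension of which Bob ignores the additional part. -/
def extendState {K : Type*} [Fintype K] [DecidableEq K] (P : CDQSProtocol n Q L R MA MB)
    (S' : Matrix (L × (R × K)) (L × (R × K)) ℂ) (hS' : IsDensity S') :
    CDQSProtocol n Q L (R × K) MA MB where
  state := S'
  state_isDensity := hS'
  alice := P.alice
  alice_isChannel := P.alice_isChannel
  bob y := P.bob y ∘ₗ traceSnd
  bob_isChannel y := (P.bob_isChannel y).comp isChannel_traceSnd

theorem extendState_channel {K : Type*} [Fintype K] [DecidableEq K]
    (P : CDQSProtocol n Q L R MA MB)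
    (S' : Matrix (L × (R × K)) (L × (R × K)) ℂ) (hS' : IsDensity S')
    (h : ∀ i j : L × R, P.state i j = ∑ k, S' (i.1, (i.2, k)) (j.1, (j.2, k)))
    (x y : Fin n → Bool) : (P.extendState S' hS').channel x y = P.channel x y := by
  have h1 := joint_comp (P.alice x) (P.bob y) (LinearMap.id : SuperOp (Q × L) (Q × L))
    (traceSnd : SuperOp (R × K) R) S'
  rw [LinearMap.comp_id] at h1
  rw [channel_eq_joint]
  refine h1.trans ?_
  rw [channel]
  congr 1
  rw [joint, tensorMap_id_traceSnd]
  refine LinearMap.ext fun X => ?_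
  ext ⟨⟨q, l⟩, r⟩ ⟨⟨q', l'⟩, r'⟩
  rw [withResource_apply, h, Finset.mul_sum]
  rfl

variable {K T NA NB : Type*} [Fintype K] [DecidableEq K] [Fintype T] [DecidableEq T]
  [Fintype NA] [DecidableEq NA] [Fintype NB] [DecidableEq NB]

/-- Relabelling the bases of all systems but `Q`. -/
def reindex (P : CDQSProtocol n Q L R MA MB) (eL : L ≃ K) (eR : R ≃ T) (eA : MA ≃ NA)
    (eB : MB ≃ NB) : CDQSProtocol n Q K T NA NB where
  state := reindexMap (eL.prodCongr eR) P.state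
  state_isDensity := (isChannel_reindexMap _).isDensity P.state_isDensity
  alice x := (reindexMap eA ∘ₗ P.alice x) ∘ₗ reindexMap ((Equiv.refl Q).prodCongr eL.symm)
  alice_isChannel x := ((isChannel_reindexMap _).comp (P.alice_isChannel x)).comp
    (isChannel_reindexMap _)
  bob y := (reindexMap eB ∘ₗ P.bob y) ∘ₗ reindexMap eR.symm
  bob_isChannel y := ((isChannel_reindexMap _).comp (P.bob_isChannel y)).comp
    (isChannel_reindexMap _)

theorem reindex_channel (P : CDQSProtocol n Q L R MA MB) (eL : L ≃ K) (eR : R ≃ T) (eA : MA ≃ NA)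
    (eB : MB ≃ NB) (x y : Fin n → Bool) :
    (P.reindex eL eR eA eB).channel x y = reindexMap (eA.prodCongr eB) ∘ₗ P.channel x y := by
  rw [channel_eq_joint, channel_eq_joint]
  simp only [reindex]
  rw [joint_reindex, joint_comp, tensorMap_reindexMap]

theorem IsCorrect.reindex {P : CDQSProtocol n Q L R MA MB}
    {f : (Fin n → Bool) → (Fin n → Bool) → Bool} {ε : ℝ≥0} (h : P.IsCorrect f ε) (eL : L ≃ K)
    (eR : R ≃ T) (eA : MA ≃ NA) (eB : MB ≃ NB) : (P.reindex eL eR eA eB).IsCorrect f ε := by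
  intro x y hxy
  obtain ⟨D, hD, hDd⟩ := h x y hxy
  refine ⟨D ∘ₗ reindexMap (eA.prodCongr eB).symm, hD.comp (isChannel_reindexMap _), ?_⟩
  rw [reindex_channel, LinearMap.comp_assoc,
    ← LinearMap.comp_assoc _ _ (reindexMap (eA.prodCongr eB).symm), reindexMap_symm_comp,
    LinearMap.id_comp]
  exact hDd

theorem IsSecure.reindex {P : CDQSProtocol n Q L R MA MB}
    {f : (Fin n → Bool) → (Fin n → Bool) → Bool} {δ : ℝ≥0} (h : P.IsSecure f δ) (eL : L ≃ K)
    (eR : R ≃ T) (eA : MA ≃ NA) (eB : MB ≃ NB) : (P.reindex eL eR eA eB).IsSecure f δ := by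
  intro x y hxy
  obtain ⟨σ, hσ, hσd⟩ := h x y hxy
  refine ⟨reindexMap (eA.prodCongr eB) σ, (isChannel_reindexMap _).isDensity hσ, ?_⟩
  rw [diamondDist_le_iff_dBound] at hσd ⊢
  have h1 : replaceMap (reindexMap (eA.prodCongr eB) σ) - (P.reindex eL eR eA eB).channel x y =
      reindexMap (eA.prodCongr eB) ∘ₗ (replaceMap σ - P.channel x y) ∘ₗ
        reindexMap (Equiv.refl Q) := by
    rw [reindex_channel]
    rfl
  rw [h1]
  exact hσd.reindex δ.2 _ _

end CDQSProtocol

/-! ### Routing with a pure or purified resource: size of the systems -/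

section Routing

variable {n : ℕ} {Q L R MA MB : Type*}
  [Fintype Q] [DecidableEq Q] [Fintype L] [DecidableEq L] [Fintype R] [DecidableEq R]
  [Fintype MA] [DecidableEq MA] [Fintype MB] [DecidableEq MB]

theorem CDQSProtocol.exists_frProtocol_of_isPure [Nonempty Q]
    {f : (Fin n → Bool) → (Fin n → Bool) → Bool} {ε δ : ℝ≥0} {nM nE : ℝ}
    (P : CDQSProtocol n Q L R MA MB) (hε : P.IsCorrect f ε) (hδ : P.IsSecure f δ)
    (hMA : qubits MA ≤ nM) (hMB : qubits MB ≤ nM) (hE : qubits (L × R) ≤ nE)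
    (hψ : IsPure P.state) :
    ∃ (m₀ m₀' m₁ m₁' : ℕ)
      (P' : FRProtocol n Q L R (Fin m₀) (Fin m₀') (Fin m₁) (Fin m₁')),
      P'.state = P.state ∧ P'.IsCorrect f (2 * NNReal.sqrt δ) ε ∧
      qubits (Fin m₀) + qubits (Fin m₁') ≤ 4 * (nM + nE) ∧
      (qubits Q ≤ 3 * nE → qubits (Fin m₀) + qubits (Fin m₀') + qubits (Fin m₁) +
        qubits (Fin m₁') ≤ 4 * (nM + nE)) := by
  obtain ⟨kA, kB, hA, hB⟩ := P.exists_kraus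
  obtain ⟨P', hs, hc⟩ := P.exists_frProtocol kA kB hA hB hψ hε hδ
  obtain ⟨⟨hL⟩, ⟨hR⟩⟩ := nonempty_prod.mp P.state_isDensity.nonempty
  have : Nonempty L := ⟨hL⟩
  have : Nonempty R := ⟨hR⟩
  rw [qubits_prod] at hE
  have h1 : qubits ((Q × L) × MA) ≤ qubits Q + qubits L + qubits MA :=
    qubits_prod_le.trans (by gcongr; exact qubits_prod_le)
  have h2 : qubits (R × MB) ≤ qubits R + qubits MB := qubits_prod_le
  have h3 := qubits_nonneg (A := L)
  have h4 := qubits_nonneg (A := R)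
  have h5 := qubits_nonneg (A := MA)
  refine ⟨_, _, _, _, P', hs, hc, ?_, fun hQ => ?_⟩ <;> simp only [qubits_fin_card] <;> linarith

theorem CDQSProtocol.exists_frProtocol_purification [Nonempty Q]
    {f : (Fin n → Bool) → (Fin n → Bool) → Bool} {ε δ : ℝ≥0} {nM nE : ℝ}
    (P : CDQSProtocol n Q L R MA MB) (hε : P.IsCorrect f ε) (hδ : P.IsSecure f δ)
    (hMA : qubits MA ≤ nM) (hMB : qubits MB ≤ nM) (hE : qubits (L × R) ≤ nE) :
    ∃ (r m₀ m₀' m₁ m₁' : ℕ)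
      (P' : FRProtocol n Q L (R × Fin r) (Fin m₀) (Fin m₀') (Fin m₁) (Fin m₁')),
      qubits (Fin r) ≤ nE ∧ IsPure P'.state ∧
      (∀ i j : L × R, P.state i j = ∑ k, P'.state (i.1, (i.2, k)) (j.1, (j.2, k))) ∧
      P'.IsCorrect f (2 * NNReal.sqrt δ) ε ∧
      qubits (Fin m₀) + qubits (Fin m₁') ≤ 4 * (nM + nE) ∧
      (qubits Q ≤ 2 * nE → qubits (Fin m₀) + qubits (Fin m₀') + qubits (Fin m₁) +
        qubits (Fin m₁') ≤ 4 * (nM + nE)) := by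
  obtain ⟨S', hS', hSS'⟩ := CDQSProtocol.exists_purification P.state P.state_isDensity
  set P₁ := P.extendState S' hS'.1
  have hch : ∀ x y, P₁.channel x y = P.channel x y := P.extendState_channel S' hS'.1 hSS'
  have hε' : P₁.IsCorrect f ε := fun x y hxy => by
    rw [hch]
    exact hε x y hxy
  have hδ' : P₁.IsSecure f δ := fun x y hxy => by
    rw [hch]
    exact hδ x y hxy
  obtain ⟨kA, kB, hA, hB⟩ := P.exists_kraus
  -- the environment of Bob's dilation consists of that for `R` and of the purifying system
  obtain ⟨P', hs, hc⟩ := P₁.exists_frProtocol kA _ hA (fun y => by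
    change P.bob y ∘ₗ traceSnd = _
    rw [hB, traceSnd_eq_krausMap, krausMap_comp]) hS' hε' hδ'
  obtain ⟨⟨hL⟩, ⟨hR⟩⟩ := nonempty_prod.mp P.state_isDensity.nonempty
  have : Nonempty L := ⟨hL⟩
  have : Nonempty R := ⟨hR⟩
  have hr : qubits (Fin (Fintype.card (L × R))) ≤ nE := by rwa [qubits_fin_card]
  rw [qubits_prod] at hE
  have h1 : qubits ((Q × L) × MA) ≤ qubits Q + qubits L + qubits MA :=
    qubits_prod_le.trans (by gcongr; exact qubits_prod_le)
  have h2 : qubits ((R × MB) × Fin (Fintype.card (L × R))) ≤ qubits R + qubits MB + nE :=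
    qubits_prod_le.trans (add_le_add qubits_prod_le hr)
  have h3 := qubits_nonneg (A := L)
  have h4 := qubits_nonneg (A := R)
  have h5 := qubits_nonneg (A := MA)
  refine ⟨_, _, _, _, _, P', hr, by rw [hs]; exact hS', by rw [hs]; exact hSS', hc, ?_,
    fun hQ => ?_⟩ <;> rw [qubits_fin_card, qubits_fin_card] <;>
    try rw [qubits_fin_card, qubits_fin_card]
  · linarith
  · linarith

end Routing

/-! ### Tensor products of finite families -/

section PiMap

variable {ι A B C D E : Type*} [Fintype ι] [DecidableEq ι] [Fintype A] [DecidableEq A]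
  [Fintype B] [DecidableEq B] [Fintype C] [DecidableEq C] [Fintype D] [DecidableEq D]
  [Fintype E] [DecidableEq E]

/-- The tensor product `⨂ᵢ mᵢ` of a family of matrices. -/
def piKron (m : ι → Matrix A B ℂ) : Matrix (ι → A) (ι → B) ℂ :=
  Matrix.of fun a b => ∏ i, m i (a i) (b i)

theorem piKron_apply (m : ι → Matrix A B ℂ) (a : ι → A) (b : ι → B) :
    piKron m a b = ∏ i, m i (a i) (b i) := rfl

theorem sum_prod_apply (f : ι → A → ℂ) : ∑ a : ι → A, ∏ i, f i (a i) = ∏ i, ∑ j, f i j := by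
  rw [Finset.prod_univ_sum, Fintype.piFinset_univ]

theorem piKron_mul (m : ι → Matrix A B ℂ) (m' : ι → Matrix B C ℂ) :
    piKron m * piKron m' = piKron fun i => m i * m' i := by
  ext a c
  simp only [Matrix.mul_apply, piKron_apply, ← Finset.prod_mul_distrib]
  exact sum_prod_apply fun i b => m i (a i) b * m' i b (c i)

theorem conjTranspose_piKron (m : ι → Matrix A B ℂ) :
    (piKron m).conjTranspose = piKron fun i => (m i).conjTranspose := by
  ext a b
  simp [piKron_apply, Matrix.conjTranspose_apply]

theorem piKron_one : piKron (fun _ : ι => (1 : Matrix A A ℂ)) = 1 := by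
  ext a b
  rw [piKron_apply, Matrix.one_apply]
  split_ifs with h
  · subst h
    exact Finset.prod_eq_one fun i _ => Matrix.one_apply_eq _
  · obtain ⟨i, hi⟩ := Function.ne_iff.mp h
    exact Finset.prod_eq_zero (Finset.mem_univ i) (Matrix.one_apply_ne hi)

theorem trace_piKron (m : ι → Matrix A A ℂ) : (piKron m).trace = ∏ i, (m i).trace :=
  sum_prod_apply fun i a => m i a a

theorem single_pi (a a' : ι → A) :
    (Matrix.single a a' 1 : Matrix (ι → A) (ι → A) ℂ) =
      piKron fun i => Matrix.single (a i) (a' i) 1 := by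
  ext b b'
  rw [piKron_apply, Matrix.single_apply]
  split_ifs with h
  · simp [← h.1, ← h.2]
  · have h' : ∃ i, ¬(a i = b i ∧ a' i = b' i) := by
      by_contra! h'
      exact h ⟨funext fun i => (h' i).1, funext fun i => (h' i).2⟩
    obtain ⟨i, hi⟩ := h'
    refine (Finset.prod_eq_zero (Finset.mem_univ i) ?_).symm
    rw [Matrix.single_apply, if_neg hi]

theorem superOp_pi_ext {Φ Ψ : SuperOp (ι → A) B}
    (h : ∀ m : ι → Matrix A A ℂ, Φ (piKron m) = Ψ (piKron m)) : Φ = Ψ :=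
  superOp_ext fun a a' => by rw [single_pi, h]

/-- The functional `Φ ↦ ∏ᵢ Φᵢ(|aᵢ⟩⟨a'ᵢ|)_{bᵢ b'ᵢ}`. -/
def piMapKernel (a a' : ι → A) (b b' : ι → B) :
    MultilinearMap ℂ (fun _ : ι => SuperOp A B) ℂ :=
  (MultilinearMap.mkPiAlgebra ℂ ι ℂ).compLinearMap fun i =>
    { toFun := fun Φ => Φ (Matrix.single (a i) (a' i) 1) (b i) (b' i)
      map_add' := fun _ _ => rfl
      map_smul' := fun _ _ => rfl }

theorem piMapKernel_apply (a a' : ι → A) (b b' : ι → B) (Φ : ι → SuperOp A B) :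
    piMapKernel a a' b b' Φ = ∏ i, Φ i (Matrix.single (a i) (a' i) 1) (b i) (b' i) := by
  simp only [piMapKernel, MultilinearMap.compLinearMap_apply, MultilinearMap.mkPiAlgebra_apply]
  rfl

/-- The tensor product `⨂ᵢ Φᵢ` of a family of super-operators, as a multilinear function of the
family; see `piMap_piKron`. -/
def piMap : MultilinearMap ℂ (fun _ : ι => SuperOp A B) (SuperOp (ι → A) (ι → B)) where
  toFun Φ :=
    { toFun := fun X => Matrix.of fun b b' => ∑ a, ∑ a', X a a' * piMapKernel a a' b b' Φ
      map_add' := fun X Y => by ext; simp [add_mul, Finset.sum_add_distrib]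
      map_smul' := fun c X => by ext; simp [mul_assoc, Finset.mul_sum] }
  map_update_add' Φ i Ψ Ψ' := by
    refine LinearMap.ext fun X => ?_
    ext
    simp only [MultilinearMap.map_update_add, mul_add, Finset.sum_add_distrib, LinearMap.coe_mk,
      AddHom.coe_mk, LinearMap.add_apply, Matrix.add_apply, Matrix.of_apply]
  map_update_smul' Φ i c Ψ := by
    refine LinearMap.ext fun X => ?_
    ext
    simp only [MultilinearMap.map_update_smul, LinearMap.coe_mk, smul_eq_mul, Finset.mul_sum,
      AddHom.coe_mk, LinearMap.smul_apply, Matrix.smul_apply, Matrix.of_apply, mul_left_comm]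

theorem piMap_apply (Φ : ι → SuperOp A B) (X : Matrix (ι → A) (ι → A) ℂ) (b b' : ι → B) :
    piMap Φ X b b' =
      ∑ a, ∑ a', X a a' * ∏ i, Φ i (Matrix.single (a i) (a' i) 1) (b i) (b' i) := by
  simp only [← piMapKernel_apply]
  rfl

theorem piMap_piKron (Φ : ι → SuperOp A B) (m : ι → Matrix A A ℂ) :
    piMap Φ (piKron m) = piKron fun i => Φ i (m i) := by
  ext b b'
  rw [piMap_apply, piKron_apply]
  have h : ∀ a : ι → A, (∑ a' : ι → A, piKron m a a' *
      ∏ i, Φ i (Matrix.single (a i) (a' i) 1) (b i) (b' i)) =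
      ∏ i, ∑ j', m i (a i) j' * Φ i (Matrix.single (a i) j' 1) (b i) (b' i) := by
    intro a
    simp only [piKron_apply, ← Finset.prod_mul_distrib]
    exact sum_prod_apply fun i j' => m i (a i) j' * Φ i (Matrix.single (a i) j' 1) (b i) (b' i)
  simp only [h]
  rw [sum_prod_apply fun i j => ∑ j', m i j j' * Φ i (Matrix.single j j' 1) (b i) (b' i)]
  exact Finset.prod_congr rfl fun i _ => (superOp_apply (Φ i) (m i) (b i) (b' i)).symm

theorem piMap_comp (Φ : ι → SuperOp B C) (Ψ : ι → SuperOp A B) :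
    piMap (fun i => Φ i ∘ₗ Ψ i) = piMap Φ ∘ₗ piMap Ψ :=
  superOp_pi_ext fun m => by simp only [LinearMap.comp_apply, piMap_piKron]

theorem piMap_id : piMap (fun _ : ι => (LinearMap.id : SuperOp A A)) = LinearMap.id :=
  superOp_pi_ext fun m => by simp only [LinearMap.id_apply, piMap_piKron]

theorem piMap_krausMap (k : ι → E → Matrix B A ℂ) :
    piMap (fun i => krausMap (k i)) = krausMap fun e : ι → E => piKron fun i => k i (e i) := by
  refine superOp_pi_ext fun m => ?_
  rw [piMap_piKron]
  simp only [krausMap_apply, conjTranspose_piKron, piKron_mul]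
  ext b b'
  simp only [Matrix.sum_apply, piKron_apply]
  exact (sum_prod_apply fun i e => (k i e * m i * (k i e).conjTranspose) (b i) (b' i)).symm

theorem isChannel_piMap {Φ : ι → SuperOp A B} (h : ∀ i, IsChannel (Φ i)) :
    IsChannel (piMap Φ) := by
  choose k hk hk' using fun i => (h i).exists_kraus
  obtain rfl : Φ = fun i => krausMap (k i) := funext hk
  have hl : (Matrix.traceLinearMap (ι → B) ℂ ℂ) ∘ₗ piMap (fun i => krausMap (k i)) =
      Matrix.traceLinearMap (ι → A) ℂ ℂ := by
    refine LinearMap.ext fun X => ?_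
    rw [Matrix.matrix_eq_sum_single X]
    simp only [map_sum]
    refine Finset.sum_congr rfl fun a _ => Finset.sum_congr rfl fun a' _ => ?_
    have h1 : Matrix.single a a' (X a a') = X a a' • Matrix.single a a' (1 : ℂ) := by
      rw [Matrix.smul_single, smul_eq_mul, mul_one]
    rw [h1, map_smul, map_smul, single_pi, LinearMap.comp_apply, piMap_piKron,
      Matrix.traceLinearMap_apply, Matrix.traceLinearMap_apply, trace_piKron, trace_piKron]
    simp only [(h _).trace_preserving]
  have ht : ∀ X, (piMap (fun i => krausMap (k i)) X).trace = X.trace := fun X =>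
    LinearMap.congr_fun hl X
  rw [piMap_krausMap] at ht ⊢
  exact (isTP_of_trace_preserving ht).isChannel

theorem IsHermitianPreserving.piMap {Φ : ι → SuperOp A B}
    (h : ∀ i, IsHermitianPreserving (Φ i)) : IsHermitianPreserving (piMap Φ) := by
  intro X
  ext b b'
  rw [Matrix.conjTranspose_apply, piMap_apply, piMap_apply]
  simp only [star_sum, star_mul', Matrix.conjTranspose_apply, star_prod, (h _).apply_single]
  rw [Finset.sum_comm]

theorem trace_piMap_update {Δ : SuperOp A B} (h : ∀ X, (Δ X).trace = 0) (Φ : ι → SuperOp A B)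
    (i : ι) (X : Matrix (ι → A) (ι → A) ℂ) :
    (piMap (Function.update Φ i Δ) X).trace = 0 := by
  have h0 : (Matrix.traceLinearMap (ι → B) ℂ ℂ) ∘ₗ piMap (Function.update Φ i Δ) = 0 := by
    refine LinearMap.ext fun X => ?_
    rw [Matrix.matrix_eq_sum_single X]
    simp only [map_sum]
    refine Finset.sum_congr rfl fun a _ => Finset.sum_congr rfl fun a' _ => ?_
    have h1 : Matrix.single a a' (X a a') = X a a' • Matrix.single a a' (1 : ℂ) := by
      rw [Matrix.smul_single, smul_eq_mul, mul_one]
    rw [h1, map_smul, map_smul, single_pi, LinearMap.comp_apply, piMap_piKron,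
      Matrix.traceLinearMap_apply, trace_piKron, LinearMap.zero_apply,
      Finset.prod_eq_zero (Finset.mem_univ i)]
    simp [h]
  exact LinearMap.congr_fun h0 X

/-- Splitting off the first factor. -/
theorem piMap_succ {n : ℕ} (Φ : Fin (n + 1) → SuperOp A B) :
    piMap Φ = reindexMap (Fin.consEquiv fun _ => B) ∘ₗ
      tensorMap (Φ 0) (piMap fun i : Fin n => Φ i.succ) ∘ₗ
        reindexMap (Fin.consEquiv fun _ => A).symm := by
  refine superOp_pi_ext fun m => ?_
  have h : reindexMap (Fin.consEquiv fun _ => A).symm (piKron m) =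
      m 0 ⊗ₖ piKron fun i : Fin n => m i.succ := by
    ext ⟨a, c⟩ ⟨a', c'⟩
    simp [piKron_apply, Fin.prod_univ_succ, Fin.consEquiv]
  rw [LinearMap.comp_apply, LinearMap.comp_apply, h, tensorMap_kronecker, piMap_piKron,
    piMap_piKron]
  ext b b'
  simp [piKron_apply, Fin.prod_univ_succ, Fin.consEquiv, Fin.tail]

theorem DBound.piMap {n : ℕ} {Δ : Fin n → SuperOp A B} {ε : Fin n → ℝ}
    (h : ∀ i, DBound (Δ i) (ε i)) (hh : ∀ i, IsHermitianPreserving (Δ i)) (hε : ∀ i, 0 ≤ ε i) :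
    DBound (piMap Δ) (∏ i, ε i) := by
  induction n with
  | zero =>
    have : IsChannel (NLQC.piMap Δ) := isChannel_piMap fun i => i.elim0
    simpa using this.dBound
  | succ n ih =>
    rw [piMap_succ, Fin.prod_univ_succ]
    refine DBound.reindex ?_ (mul_nonneg (hε 0) (Finset.prod_nonneg fun i _ => hε i.succ)) _ _
    exact (h 0).tensorMap (ih (fun i => h i.succ) (fun i => hh i.succ) fun i => hε i.succ)
      (IsHermitianPreserving.piMap fun i => hh i.succ) (hε 0)

theorem reindexMap_arrowProd_piKron (X : ι → Matrix A A ℂ) (Y : ι → Matrix C C ℂ) :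
    reindexMap (Equiv.arrowProdEquivProdArrow ι (fun _ => A) fun _ => C)
      (piKron fun i => X i ⊗ₖ Y i) = piKron X ⊗ₖ piKron Y := by
  ext ⟨a, c⟩ ⟨a', c'⟩
  simp [piKron_apply, Finset.prod_mul_distrib, Equiv.arrowProdEquivProdArrow]

theorem superOp_pi_prod_ext {Φ Ψ : SuperOp (ι → A × C) B}
    (h : ∀ (X : ι → Matrix A A ℂ) (Y : ι → Matrix C C ℂ),
      Φ (piKron fun i => X i ⊗ₖ Y i) = Ψ (piKron fun i => X i ⊗ₖ Y i)) : Φ = Ψ :=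
  superOp_ext fun p p' => by
    rw [single_pi, show (fun i => (Matrix.single (p i) (p' i) 1 : Matrix (A × C) (A × C) ℂ)) =
      fun i => Matrix.single (p i).1 (p' i).1 1 ⊗ₖ Matrix.single (p i).2 (p' i).2 1 from
        funext fun i => single_prod _ _ _ _, h]

theorem tensorMap_piMap_piMap (Φ : ι → SuperOp A B) (Ψ : ι → SuperOp C D) :
    tensorMap (piMap Φ) (piMap Ψ) ∘ₗ
        reindexMap (Equiv.arrowProdEquivProdArrow ι (fun _ => A) fun _ => C) =
      reindexMap (Equiv.arrowProdEquivProdArrow ι (fun _ => B) fun _ => D) ∘ₗ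
        piMap fun i => tensorMap (Φ i) (Ψ i) := by
  refine superOp_pi_prod_ext fun X Y => ?_
  rw [LinearMap.comp_apply, LinearMap.comp_apply, reindexMap_arrowProd_piKron,
    tensorMap_kronecker, piMap_piKron, piMap_piKron, piMap_piKron]
  simp only [tensorMap_kronecker]
  rw [reindexMap_arrowProd_piKron]

theorem traceSnd_comp_arrowProd :
    traceSnd ∘ₗ reindexMap (Equiv.arrowProdEquivProdArrow ι (fun _ => A) fun _ => C) =
      piMap fun _ : ι => (traceSnd : SuperOp (A × C) A) := by
  refine superOp_pi_prod_ext fun X Y => ?_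
  rw [LinearMap.comp_apply, reindexMap_arrowProd_piKron, piMap_piKron]
  ext a a'
  simp only [traceSnd_apply, Matrix.kroneckerMap_apply, piKron_apply, ← Finset.mul_sum,
    Finset.prod_mul_distrib]
  rw [sum_prod_apply fun i c => Y i c c]

theorem traceFst_comp_arrowProd :
    traceFst ∘ₗ reindexMap (Equiv.arrowProdEquivProdArrow ι (fun _ => A) fun _ => C) =
      piMap fun _ : ι => (traceFst : SuperOp (A × C) C) := by
  refine superOp_pi_prod_ext fun X Y => ?_
  rw [LinearMap.comp_apply, reindexMap_arrowProd_piKron, piMap_piKron]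
  ext a a'
  simp only [traceFst_apply, Matrix.kroneckerMap_apply, piKron_apply, ← Finset.sum_mul,
    Finset.prod_mul_distrib]
  rw [sum_prod_apply fun i c => X i c c]

end PiMap

/-! ### The five-qubit code -/

section Code

/-- The signs of the amplitudes of the codeword `b` of the five-qubit code, in the form of a graph
state: the graph is the pentagon, and `b` is the exponent of a global phase flip. -/
def codeSign (b : Fin 2) (x : Fin 5 → Fin 2) : ℤ :=
  (-1) ^ ((x 0 * x 1 + x 1 * x 2 + x 2 * x 3 + x 3 * x 4 + x 4 * x 0 +
    b * (x 0 + x 1 + x 2 + x 3 + x 4) : Fin 2) : ℕ)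

/-- The marginals on the qubits `i` and `j` of `|b⟩⟨b'|` are maximally mixed for `b = b'` and vanish
for `b ≠ b'`. -/
def HasTrivialMarginal (i j : Fin 5) : Prop := ∀ a a' c c' b b' : Fin 2,
  ∑ x : Fin 5 → Fin 2, (if x i = a ∧ x j = c then codeSign b x *
    codeSign b' (Function.update (Function.update x i a') j c') else 0) =
  if a = a' ∧ c = c' ∧ b = b' then 8 else 0

theorem HasTrivialMarginal.symm {i j : Fin 5} (hij : i ≠ j) (h : HasTrivialMarginal i j) :
    HasTrivialMarginal j i := by
  intro a a' c c' b b'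
  have := h c c' a a' b b'
  simp only [Function.update_comm (β := fun _ => Fin 2) hij c' a', and_comm (b := _ = a)] at this
  rw [this]
  exact if_congr and_left_comm rfl rfl

theorem codeSign_rotate (b : Fin 2) (x : Fin 5 → Fin 2) :
    codeSign b (fun k => x (k + 1)) = codeSign b x := by
  have h : ∀ b p q r s t : Fin 2,
      q * r + r * s + s * t + t * p + p * q + b * (q + r + s + t + p) =
        p * q + q * r + r * s + s * t + t * p + b * (p + q + r + s + t) := by decide
  exact congrArg (fun m : Fin 2 => (-1 : ℤ) ^ (m : ℕ)) (h b (x 0) (x 1) (x 2) (x 3) (x 4))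

theorem HasTrivialMarginal.rotate {i j : Fin 5} (h : HasTrivialMarginal i j) :
    HasTrivialMarginal (i + 1) (j + 1) := by
  intro a a' c c' b b'
  rw [← h a a' c c' b b']
  refine Eq.trans (Finset.sum_congr rfl fun x _ => ?_)
    (((Equiv.addRight (1 : Fin 5)).symm.arrowCongr (Equiv.refl (Fin 2))).sum_comp fun x =>
      if x i = a ∧ x j = c then codeSign b x *
        codeSign b' (Function.update (Function.update x i a') j c') else 0)
  set y : Fin 5 → Fin 2 := fun k => x (k + 1) with hy
  have h1 : Function.update (Function.update y i a') j c' =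
      fun k => Function.update (Function.update x (i + 1) a') (j + 1) c' (k + 1) := by
    funext k
    simp [Function.update_apply, hy]
  have h2 : ((Equiv.addRight (1 : Fin 5)).symm.arrowCongr (Equiv.refl (Fin 2))) x = y := rfl
  rw [h2, h1, codeSign_rotate, hy, codeSign_rotate]

set_option maxRecDepth 100000 in
theorem hasTrivialMarginal_zero_one : HasTrivialMarginal 0 1 := by
  unfold HasTrivialMarginal
  decide +kernel

set_option maxRecDepth 100000 in
theorem hasTrivialMarginal_zero_two : HasTrivialMarginal 0 2 := by
  unfold HasTrivialMarginal
  decide +kernel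

theorem HasTrivialMarginal.iterate {i j : Fin 5} (h : HasTrivialMarginal i j) (k : ℕ) :
    HasTrivialMarginal ((· + 1)^[k] i) ((· + 1)^[k] j) := by
  induction k with
  | zero => exact h
  | succ k ih =>
    rw [Function.iterate_succ_apply', Function.iterate_succ_apply']
    exact ih.rotate

/-- By the rotation symmetry of the pentagon it suffices to check two pairs of qubits. -/
theorem hasTrivialMarginal {i j : Fin 5} (hij : i ≠ j) : HasTrivialMarginal i j := by
  have key : ∀ i j : Fin 5, i ≠ j → ∃ k : Fin 5,
      ((· + 1)^[k] 0 = i ∧ (· + 1)^[k] 1 = j) ∨ ((· + 1)^[k] 0 = j ∧ (· + 1)^[k] 1 = i) ∨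
      ((· + 1)^[k] 0 = i ∧ (· + 1)^[k] 2 = j) ∨ ((· + 1)^[k] 0 = j ∧ (· + 1)^[k] 2 = i) := by
    decide
  obtain ⟨k, ⟨rfl, rfl⟩ | ⟨rfl, rfl⟩ | ⟨rfl, rfl⟩ | ⟨rfl, rfl⟩⟩ := key i j hij
  · exact hasTrivialMarginal_zero_one.iterate k
  · exact (hasTrivialMarginal_zero_one.iterate k).symm hij.symm
  · exact hasTrivialMarginal_zero_two.iterate k
  · exact (hasTrivialMarginal_zero_two.iterate k).symm hij.symm

/-- The encoding isometry. -/
def codeMatrix : Matrix (Fin 5 → Fin 2) (Fin 2) ℂ :=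
  Matrix.of fun x b => (codeSign b x : ℂ) / (Real.sqrt 32 : ℂ)

/-- A product operator that is a scalar off the sites `i` and `j` connects a basis vector only to
those that agree with it off `i` and `j`. -/
theorem sum_piKron_mul {A : Type*} [Fintype A] [DecidableEq A] {i j : Fin 5} (hij : i ≠ j)
    {m : Fin 5 → Matrix A A ℂ} {c : Fin 5 → ℂ} (hm : ∀ k, k ≠ i → k ≠ j → m k = c k • 1)
    (x : Fin 5 → A) (g : (Fin 5 → A) → ℂ) :
    ∑ x', piKron m x x' * g x' = ∑ p : A × A, (∏ k ∈ (Finset.univ.erase i).erase j, c k) *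
      (m i (x i) p.1 * m j (x j) p.2) *
      g (Function.update (Function.update x i p.1) j p.2) := by
  symm
  refine Fintype.sum_of_injective
    (fun p : A × A => Function.update (Function.update x i p.1) j p.2) ?_ _ _ ?_ ?_
  · rintro ⟨p, q⟩ ⟨p', q'⟩ h
    have h1 := congrFun h i
    have h2 := congrFun h j
    simp only [Function.update_self, Function.update_of_ne hij] at h1 h2
    rw [h1, h2]
  · intro x' hx'
    have h' : ∃ k, k ≠ i ∧ k ≠ j ∧ x k ≠ x' k := by
      by_contra! h'
      refine hx' ⟨(x' i, x' j), funext fun k => ?_⟩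
      by_cases hj : k = j
      · subst hj
        simp
      by_cases hi : k = i
      · subst hi
        simp [hj]
      · simp [hj, hi, h' k hi hj]
    obtain ⟨k, hi, hj, hk⟩ := h'
    rw [piKron_apply, Finset.prod_eq_zero (Finset.mem_univ k), zero_mul]
    rw [hm k hi hj]
    simp [Matrix.one_apply_ne hk]
  · rintro ⟨p, q⟩
    rw [piKron_apply, ← Finset.mul_prod_erase _ _ (Finset.mem_univ i),
      ← Finset.mul_prod_erase _ _ (Finset.mem_erase.mpr ⟨hij.symm, Finset.mem_univ j⟩)]
    have : ∏ k ∈ (Finset.univ.erase i).erase j, m k (x k)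
        (Function.update (Function.update x i p) j q k) =
        ∏ k ∈ (Finset.univ.erase i).erase j, c k := by
      refine Finset.prod_congr rfl fun k hk => ?_
      rw [Finset.mem_erase, Finset.mem_erase] at hk
      rw [hm k hk.2.1 hk.1, Function.update_of_ne hk.1, Function.update_of_ne hk.2.1]
      simp
    rw [this, Function.update_of_ne hij]
    simp only [Function.update_self]
    ring

/-- The Knill–Laflamme condition for operators that act on at most two qubits. The code is pure:
the scalar depends only on the traces of the factors. -/
theorem codeMatrix_mul_piKron_mul {i j : Fin 5} (hij : i ≠ j) {m : Fin 5 → Matrix (Fin 2) (Fin 2) ℂ}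
    {c : Fin 5 → ℂ} (hm : ∀ k, k ≠ i → k ≠ j → m k = c k • 1) :
    codeMatrix.conjTranspose * piKron m * codeMatrix = (∏ k, (m k).trace / 2) • 1 := by
  have hs : ((Real.sqrt 32 : ℝ) : ℂ) * ((Real.sqrt 32 : ℝ) : ℂ) = 32 := by
    rw [← Complex.ofReal_mul, Real.mul_self_sqrt (by norm_num)]
    norm_num
  have htr : ∏ k, (m k).trace / 2 = (∏ k ∈ (Finset.univ.erase i).erase j, c k) *
      ((m i).trace / 2 * ((m j).trace / 2)) := by
    rw [← Finset.mul_prod_erase _ _ (Finset.mem_univ i),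
      ← Finset.mul_prod_erase _ _ (Finset.mem_erase.mpr ⟨hij.symm, Finset.mem_univ j⟩)]
    rw [Finset.prod_congr rfl (g := c) fun k hk => ?_]
    · ring
    · rw [Finset.mem_erase, Finset.mem_erase] at hk
      rw [hm k hk.2.1 hk.1]
      simp
  rw [htr]
  -- expand along the values at the sites `i`, `j`, before and after the operator is applied
  set K : ℂ := ∏ k ∈ (Finset.univ.erase i).erase j, c k
  ext b b'
  rw [Matrix.mul_assoc, Matrix.mul_apply]
  simp only [Matrix.mul_apply (M := piKron m),
    sum_piKron_mul hij hm _ fun x' => codeMatrix x' b']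
  have h1 : ∀ (x : Fin 5 → Fin 2) (p : Fin 2 × Fin 2), codeMatrix.conjTranspose b x *
      (K * (m i (x i) p.1 * m j (x j) p.2) *
      codeMatrix (Function.update (Function.update x i p.1) j p.2) b') =
      ∑ q : Fin 2 × Fin 2, K / 32 * (m i q.1 p.1 * m j q.2 p.2) *
        ((if x i = q.1 ∧ x j = q.2 then codeSign b x *
          codeSign b' (Function.update (Function.update x i p.1) j p.2) else 0 : ℤ) : ℂ) := by
    intro x p
    rw [Finset.sum_eq_single (x i, x j)]
    · simp only [codeMatrix, Matrix.conjTranspose_apply, Matrix.of_apply, and_self, if_true, ← hs]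
      simp
      field_simp
    · rintro ⟨q, q'⟩ - hq
      rw [if_neg, Int.cast_zero, mul_zero]
      rintro ⟨rfl, rfl⟩
      exact hq rfl
    · simp
  have h2 : ∀ p q : Fin 2 × Fin 2, ∑ x : Fin 5 → Fin 2, K / 32 * (m i q.1 p.1 * m j q.2 p.2) *
        ((if x i = q.1 ∧ x j = q.2 then codeSign b x *
          codeSign b' (Function.update (Function.update x i p.1) j p.2) else 0 : ℤ) : ℂ) =
      K / 32 * (m i q.1 p.1 * m j q.2 p.2) *
        ((if q.1 = p.1 ∧ q.2 = p.2 ∧ b = b' then 8 else 0 : ℤ) : ℂ) := by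
    intro p q
    rw [← Finset.mul_sum, ← Int.cast_sum, hasTrivialMarginal hij]
  refine (Finset.sum_congr rfl fun x _ => (Finset.mul_sum _ _ _).trans
    (Finset.sum_congr rfl fun p _ => h1 x p)).trans (Finset.sum_comm.trans
      ((Finset.sum_congr rfl fun p _ => Finset.sum_comm.trans
        (Finset.sum_congr rfl fun q _ => h2 p q)).trans ?_))
  by_cases hb : b = b'
  · subst hb
    simp [Fintype.sum_prod_type, Matrix.trace, Fin.sum_univ_two]
    ring
  · simp [hb]

theorem codeMatrix_isometry : codeMatrix.conjTranspose * codeMatrix = 1 := by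
  have h := codeMatrix_mul_piKron_mul (i := 0) (j := 1) (by decide)
    (m := fun _ => (1 : Matrix (Fin 2) (Fin 2) ℂ)) (c := fun _ => 1)
    (fun _ _ _ => (one_smul _ _).symm)
  simpa [piKron_one] using h

/-- Encoding into the five-qubit code. -/
def encode : SuperOp (Fin 2) (Fin 5 → Fin 2) := krausMap fun _ : Unit => codeMatrix

theorem encode_apply (X : Matrix (Fin 2) (Fin 2) ℂ) :
    encode X = codeMatrix * X * codeMatrix.conjTranspose := by
  simp [encode, krausMap_apply]

theorem isChannel_encode : IsChannel encode :=
  IsTP.isChannel (by simp [IsTP, codeMatrix_isometry])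

/-- The Pauli matrices `1, X, Z, XZ`. -/
def pauli : Fin 4 → Matrix (Fin 2) (Fin 2) ℂ :=
  ![1, !![0, 1; 1, 0], !![1, 0; 0, -1], !![0, -1; 1, 0]]

/-- The Pauli matrices are orthonormal for the normalized Hilbert–Schmidt inner product. -/
theorem trace_pauli (p q : Fin 4) :
    ((pauli p).conjTranspose * pauli q).trace / 2 = if p = q then 1 else 0 := by
  fin_cases p <;> fin_cases q <;>
    simp [pauli, Matrix.trace, Fin.sum_univ_two, Matrix.mul_apply]

/-- The Pauli label of each qubit for an error on at most one qubit: `some (i, p)` is the nontrivial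
Pauli matrix `p + 1` on the qubit `i`, and `none` stands for no error. -/
def errorIndex (e : Option (Fin 5 × Fin 3)) : Fin 5 → Fin 4 :=
  e.elim 0 fun p => Pi.single p.1 p.2.succ

theorem errorIndex_injective : Function.Injective errorIndex := by
  rintro (_ | ⟨i, p⟩) (_ | ⟨j, q⟩) h
  · rfl
  · exact absurd (congrFun h j) (by simp [errorIndex, (Fin.succ_ne_zero q).symm])
  · exact absurd (congrFun h i) (by simp [errorIndex, Fin.succ_ne_zero p])
  · have h1 := congrFun h i
    by_cases hij : i = j
    · subst hij
      simpa [errorIndex] using h1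
    · simp [errorIndex, hij, Fin.succ_ne_zero p] at h1

/-- The site of an error; for no error, an arbitrary site. -/
def errorSite (e : Option (Fin 5 × Fin 3)) : Fin 5 := e.elim 0 Prod.fst

theorem errorIndex_of_ne {e : Option (Fin 5 × Fin 3)} {k : Fin 5} (h : k ≠ errorSite e) :
    errorIndex e k = 0 := by
  rcases e with _ | ⟨i, p⟩
  · rfl
  · simpa [errorIndex, errorSite] using Pi.single_eq_of_ne h _

/-- The Pauli error with index `e`, on five qubits. -/
def errorMatrix (e : Option (Fin 5 × Fin 3)) : Matrix (Fin 5 → Fin 2) (Fin 5 → Fin 2) ℂ :=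
  piKron fun k => pauli (errorIndex e k)

theorem exists_ne_forall (i j : Fin 5) : ∃ i' j' : Fin 5, i' ≠ j' ∧ ∀ k, k ≠ i' → k ≠ j' →
    k ≠ i ∧ k ≠ j := by
  by_cases h : i = j
  · obtain ⟨j', hj'⟩ := exists_ne i
    exact ⟨i, j', hj'.symm, fun k hk _ => ⟨hk, h ▸ hk⟩⟩
  · exact ⟨i, j, h, fun k hk hk' => ⟨hk, hk'⟩⟩

/-- The images of the code space under different errors are orthogonal: the code is
nondegenerate. -/
theorem codeMatrix_errorMatrix (e e' : Option (Fin 5 × Fin 3)) :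
    (errorMatrix e * codeMatrix).conjTranspose * (errorMatrix e' * codeMatrix) =
      if e = e' then 1 else 0 := by
  obtain ⟨i, j, hij, h⟩ := exists_ne_forall (errorSite e) (errorSite e')
  have h1 := codeMatrix_mul_piKron_mul hij (c := fun _ => 1)
    (m := fun k => (pauli (errorIndex e k)).conjTranspose * pauli (errorIndex e' k))
    fun k hi hj => by
      rw [errorIndex_of_ne (h k hi hj).1, errorIndex_of_ne (h k hi hj).2]
      simp [pauli]
  rw [← piKron_mul, ← conjTranspose_piKron] at h1
  rw [Matrix.conjTranspose_mul, Matrix.mul_assoc, ← Matrix.mul_assoc _ _ codeMatrix,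
    ← Matrix.mul_assoc codeMatrix.conjTranspose]
  refine h1.trans ?_
  simp only [trace_pauli]
  split_ifs with hee
  · subst hee
    simp
  · obtain ⟨k, hk⟩ := Function.ne_iff.mp (errorIndex_injective.ne hee)
    rw [Finset.prod_eq_zero (Finset.mem_univ k) (if_neg hk), zero_smul]

/-- The Kraus operators of the decoder: undo the error `e`, then invert the encoding. -/
def decodeKraus (e : Option (Fin 5 × Fin 3)) : Matrix (Fin 2) (Fin 5 → Fin 2) ℂ :=
  (errorMatrix e * codeMatrix).conjTranspose

/-- The code is perfect: the sixteen images of the code space under at most one Pauli error are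
orthogonal and exhaust the space, so that the decoder is trace preserving. -/
theorem isTP_decodeKraus : IsTP decodeKraus := by
  set M : Matrix (Fin 5 → Fin 2) (Option (Fin 5 × Fin 3) × Fin 2) ℂ :=
    Matrix.of fun x p => (errorMatrix p.1 * codeMatrix) x p.2 with hM
  have h1 : M.conjTranspose * M = 1 := by
    ext ⟨e, b⟩ ⟨e', b'⟩
    have := congrFun (congrFun (codeMatrix_errorMatrix e e') b) b'
    rw [Matrix.mul_apply] at this
    rw [Matrix.mul_apply]
    refine this.trans ?_
    by_cases he : e = e' <;> simp [he, Matrix.one_apply]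
  have h2 : M * M.conjTranspose = 1 := by
    rwa [Matrix.mul_eq_one_comm_of_card_eq]
    simp
  refine Eq.trans ?_ h2
  ext x x'
  simp only [decodeKraus, Matrix.conjTranspose_conjTranspose, Matrix.sum_apply,
    Matrix.mul_apply (N := Matrix.conjTranspose _),
    Fintype.sum_prod_type]
  rfl

/-- Decoding of the five-qubit code. -/
def decode : SuperOp (Fin 5 → Fin 2) (Fin 2) := krausMap decodeKraus

theorem isChannel_decode : IsChannel decode := isTP_decodeKraus.isChannel

end Code

/-! ### Noise and leakage through the five-qubit code -/

section CodeNoise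

variable {A B : Type*} [Fintype A] [DecidableEq A] [Fintype B] [DecidableEq B]

/-- The map `X ↦ S X T†`. -/
def sandwich (S T : Matrix B A ℂ) : SuperOp A B where
  toFun X := S * X * T.conjTranspose
  map_add' X Y := by rw [Matrix.mul_add, Matrix.add_mul]
  map_smul' c X := by rw [Matrix.mul_smul, Matrix.smul_mul, RingHom.id_apply]

theorem sandwich_apply (S T : Matrix B A ℂ) (X : Matrix A A ℂ) :
    sandwich S T X = S * X * T.conjTranspose := rfl

/-- The maps `X ↦ S X T†` with matrix units `S`, `T` span all super-operators. -/
theorem superOp_eq_sum_sandwich (Δ : SuperOp A B) :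
    Δ = ∑ p : (A × A) × B × B, Δ (Matrix.single p.1.1 p.1.2 1) p.2.1 p.2.2 •
      sandwich (Matrix.single p.2.1 p.1.1 1) (Matrix.single p.2.2 p.1.2 1) := by
  refine LinearMap.ext fun X => ?_
  ext b b'
  rw [superOp_apply]
  simp only [LinearMap.sum_apply, LinearMap.smul_apply, Matrix.sum_apply, Matrix.smul_apply,
    sandwich_apply, Fintype.sum_prod_type, smul_eq_mul, Matrix.conjTranspose_single, star_one]
  refine Finset.sum_congr rfl fun a _ => Finset.sum_congr rfl fun a' _ => ?_
  rw [Finset.sum_eq_single b, Finset.sum_eq_single b']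
  · simp [mul_comm]
  · intro c' _ hc'
    simp [Matrix.single_mul_mul_single, hc']
  · simp
  · intro c _ hc
    refine Finset.sum_eq_zero fun c' _ => ?_
    simp [Matrix.single_mul_mul_single, hc]
  · simp

theorem piMap_sandwich {ι : Type*} [Fintype ι] [DecidableEq ι] (S T : ι → Matrix B A ℂ) :
    piMap (fun i => sandwich (S i) (T i)) = sandwich (piKron S) (piKron T) :=
  superOp_pi_ext fun m => by
    rw [piMap_piKron, sandwich_apply, conjTranspose_piKron, piKron_mul, piKron_mul]
    rfl

/-- The decoder sees noise on one qubit only through a scalar. -/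
theorem exists_decode_update (i : Fin 5) (Δ : SuperOp (Fin 2) (Fin 2)) :
    ∃ c : ℂ, decode ∘ₗ piMap (Function.update (fun _ => LinearMap.id) i Δ) ∘ₗ encode =
      c • LinearMap.id := by
  have key : ∀ S T : Matrix (Fin 2) (Fin 2) ℂ, ∃ c : ℂ,
      decode ∘ₗ piMap (Function.update (fun _ => LinearMap.id) i (sandwich S T)) ∘ₗ encode =
        c • LinearMap.id := by
    intro S T
    have hid : (LinearMap.id : SuperOp (Fin 2) (Fin 2)) = sandwich 1 1 :=
      LinearMap.ext fun X => by simp [sandwich_apply]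
    have h1 : Function.update (fun _ => LinearMap.id) i (sandwich S T) =
        fun k : Fin 5 => sandwich
          (Function.update (fun _ => (1 : Matrix (Fin 2) (Fin 2) ℂ)) i S k)
          (Function.update (fun _ => (1 : Matrix (Fin 2) (Fin 2) ℂ)) i T k) := by
      funext k
      by_cases hk : k = i
      · subst hk
        simp
      · simp [hk, hid]
    have h2 : ∀ (U : Matrix (Fin 2) (Fin 2) ℂ) (e : Option (Fin 5 × Fin 3)), ∃ c : ℂ,
        decodeKraus e * piKron (Function.update (fun _ : Fin 5 => (1 : Matrix (Fin 2) (Fin 2) ℂ)) i U) * codeMatrix = c • 1 := by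
      intro U e
      obtain ⟨i', j', hij, h⟩ := exists_ne_forall i (errorSite e)
      have h3 := codeMatrix_mul_piKron_mul hij (c := fun _ => 1)
        (m := fun k => (pauli (errorIndex e k)).conjTranspose *
          Function.update (fun _ : Fin 5 => (1 : Matrix (Fin 2) (Fin 2) ℂ)) i U k) fun k hi hj => by
        rw [errorIndex_of_ne (h k hi hj).2, Function.update_of_ne (h k hi hj).1]
        simp [pauli]
      rw [← piKron_mul, ← conjTranspose_piKron] at h3
      refine ⟨_, Eq.trans ?_ h3⟩
      rw [decodeKraus, Matrix.conjTranspose_mul, Matrix.mul_assoc, Matrix.mul_assoc,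
        Matrix.mul_assoc, Matrix.mul_assoc]
      rfl
    choose s hs using h2 S
    choose t ht using h2 T
    refine ⟨∑ e, s e * star (t e), LinearMap.ext fun X => ?_⟩
    rw [h1, piMap_sandwich]
    simp only [LinearMap.comp_apply, encode_apply, sandwich_apply, decode, krausMap_apply,
      Finset.sum_smul, LinearMap.sum_apply, LinearMap.smul_apply, LinearMap.id_apply]
    refine Finset.sum_congr rfl fun e _ => ?_
    calc _ = (decodeKraus e * piKron (Function.update (fun _ : Fin 5 => (1 : Matrix (Fin 2) (Fin 2) ℂ)) i S) * codeMatrix) * X *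
        (decodeKraus e * piKron (Function.update (fun _ : Fin 5 => (1 : Matrix (Fin 2) (Fin 2) ℂ)) i T) *
          codeMatrix).conjTranspose := by
          simp only [Matrix.conjTranspose_mul, Matrix.mul_assoc]
      _ = _ := by
          rw [hs, ht, Matrix.conjTranspose_smul, Matrix.conjTranspose_one, Matrix.smul_mul,
            Matrix.one_mul, Matrix.mul_smul, Matrix.mul_one, smul_smul, mul_comm]
  choose c hc using key
  refine ⟨∑ p : (Fin 2 × Fin 2) × Fin 2 × Fin 2, Δ (Matrix.single p.1.1 p.1.2 1) p.2.1 p.2.2 *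
    c (Matrix.single p.2.1 p.1.1 1) (Matrix.single p.2.2 p.1.2 1), ?_⟩
  conv_lhs => rw [superOp_eq_sum_sandwich Δ]
  rw [MultilinearMap.map_update_sum]
  simp only [MultilinearMap.map_update_smul, Finset.sum_smul]
  refine LinearMap.ext fun X => ?_
  simp only [LinearMap.comp_apply, LinearMap.sum_apply, map_sum, LinearMap.smul_apply, map_smul]
  refine Finset.sum_congr rfl fun p _ => ?_
  rw [mul_smul]
  congr 1
  exact LinearMap.congr_fun (hc _ _) X

theorem decode_comp_encode : decode ∘ₗ encode = LinearMap.id := by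
  obtain ⟨c, hc⟩ := exists_decode_update 0 LinearMap.id
  rw [Function.update_eq_self_iff.mpr rfl, piMap_id, LinearMap.id_comp] at hc
  have h := congrArg Matrix.trace (LinearMap.congr_fun hc (Matrix.single 0 0 1))
  rw [(isChannel_decode.comp isChannel_encode).trace_preserving] at h
  have h1 : c = 1 := by simpa using h.symm
  rw [hc, h1, one_smul]

/-- The code corrects an arbitrary error on one qubit. -/
theorem decode_update_encode (i : Fin 5) {Δ : SuperOp (Fin 2) (Fin 2)}
    (hΔ : ∀ X, (Δ X).trace = 0) :
    decode ∘ₗ piMap (Function.update (fun _ => LinearMap.id) i Δ) ∘ₗ encode = 0 := by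
  obtain ⟨c, hc⟩ := exists_decode_update i Δ
  have h := congrArg Matrix.trace (LinearMap.congr_fun hc (Matrix.single 0 0 1))
  rw [LinearMap.comp_apply, isChannel_decode.trace_preserving, LinearMap.comp_apply,
    trace_piMap_update hΔ] at h
  have h1 : c = 0 := by simpa using h.symm
  rw [hc, h1, zero_smul]

theorem sum_finset_five (f : ℕ → ℝ) : ∑ s : Finset (Fin 5), f s.card =
    f 0 + 5 * f 1 + 10 * f 2 + 10 * f 3 + 5 * f 4 + f 5 := by
  rw [← Finset.powerset_univ, Finset.sum_powerset_apply_card]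
  simp [Finset.sum_range_succ, Nat.choose]

/-- The bound `(1 + ε) ^ 5 - 1 - 5 ε` on the error of the five-qubit code, as a function of the error
on each qubit. -/
def codeError (ε : ℝ≥0) : ℝ≥0 := 10 * ε ^ 2 + 10 * ε ^ 3 + 5 * ε ^ 4 + ε ^ 5

theorem prod_piecewise_const (s : Finset (Fin 5)) (ε : ℝ) :
    ∏ i, s.piecewise (fun _ => ε) (fun _ => 1) i = ε ^ s.card := by
  rw [Finset.prod_piecewise]
  simp

theorem dBound_piMap_piecewise (s : Finset (Fin 5)) {Δ Φ : Fin 5 → SuperOp A B} {ε : ℝ}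
    (hε : 0 ≤ ε) (hΔ : ∀ i, DBound (Δ i) ε) (hΔh : ∀ i, IsHermitianPreserving (Δ i))
    (hΦ : ∀ i, IsChannel (Φ i)) : DBound (piMap (s.piecewise Δ Φ)) (ε ^ s.card) := by
  rw [← prod_piecewise_const]
  refine DBound.piMap (fun i => ?_) (fun i => ?_) fun i => ?_
  · by_cases hi : i ∈ s
    · simpa [hi] using hΔ i
    · simpa [hi] using (hΦ i).dBound
  · by_cases hi : i ∈ s
    · simpa [hi] using hΔh i
    · simpa [hi] using (hΦ i).isHermitianPreserving
  · by_cases hi : i ∈ s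
    · simpa [hi] using hε
    · simp [hi]

/-- Coding improves noisy channels: with `Φᵢ = id + Δᵢ`, the terms of `⨂ᵢ Φᵢ` with exactly one
factor `Δᵢ` vanish after decoding, and those with `k ≥ 2` factors have size at most `ε ^ k`. -/
theorem diamondDist_decode_piMap_encode_le {Φ : Fin 5 → SuperOp (Fin 2) (Fin 2)} {ε : ℝ≥0}
    (hΦ : ∀ i, IsChannel (Φ i)) (h : ∀ i, diamondDist (Φ i) LinearMap.id ≤ ε) :
    diamondDist (decode ∘ₗ piMap Φ ∘ₗ encode) LinearMap.id ≤ codeError ε := by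
  simp only [diamondDist_le_iff_dBound] at h ⊢
  set Δ : Fin 5 → SuperOp (Fin 2) (Fin 2) := fun i => Φ i - LinearMap.id with hΔ
  have hΔh : ∀ i, IsHermitianPreserving (Δ i) := fun i =>
    (hΦ i).isHermitianPreserving.sub isHermitianPreserving_id
  have hΦΔ : Φ = Δ + fun _ => LinearMap.id := by
    funext i
    simp [hΔ]
  -- the terms in which no qubit or only one qubit is disturbed add up to the identity
  have h0 : ∀ s : Finset (Fin 5), s.card < 2 →
      decode ∘ₗ piMap (s.piecewise Δ fun _ => LinearMap.id) ∘ₗ encode =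
        if s = ∅ then LinearMap.id else 0 := by
    intro s hs
    split_ifs with he
    · subst he
      rw [Finset.piecewise_empty, piMap_id, LinearMap.id_comp, decode_comp_encode]
    · obtain ⟨i, rfl⟩ : ∃ i, s = {i} := by
        rw [← Finset.card_eq_one]
        have := Finset.card_pos.mpr (Finset.nonempty_iff_ne_empty.mpr he)
        omega
      rw [Finset.piecewise_singleton]
      refine decode_update_encode i fun X => ?_
      simp [hΔ, (hΦ i).trace_preserving]
  have h1 : decode ∘ₗ piMap Φ ∘ₗ encode - LinearMap.id = ∑ s : Finset (Fin 5),
      if s.card < 2 then 0 else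
        decode ∘ₗ piMap (s.piecewise Δ fun _ => LinearMap.id) ∘ₗ encode := by
    have h2 : decode ∘ₗ piMap Φ ∘ₗ encode = ∑ s : Finset (Fin 5),
        decode ∘ₗ piMap (s.piecewise Δ fun _ => LinearMap.id) ∘ₗ encode := by
      rw [hΦΔ, MultilinearMap.map_add_univ]
      refine LinearMap.ext fun X => ?_
      simp only [LinearMap.comp_apply, LinearMap.sum_apply, map_sum]
    have h3 : (LinearMap.id : SuperOp (Fin 2) (Fin 2)) =
        ∑ s : Finset (Fin 5), if s = ∅ then LinearMap.id else 0 := by simp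
    refine (congrArg₂ (· - ·) h2 h3).trans ?_
    rw [← Finset.sum_sub_distrib]
    refine Finset.sum_congr rfl fun s _ => ?_
    by_cases hs : s.card < 2
    · rw [h0 s hs, sub_self, if_pos hs]
    · have he : s ≠ ∅ := by
        rintro rfl
        simp at hs
      rw [if_neg he, if_neg hs, sub_zero]
  rw [h1]
  have h4 := sum_finset_five fun k => if k < 2 then 0 else (ε : ℝ) ^ k
  have h5 : (codeError ε : ℝ) = ∑ s : Finset (Fin 5), if s.card < 2 then 0 else (ε : ℝ) ^ s.card := by
    rw [h4]
    simp [codeError]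
  rw [h5]
  refine DBound.sum fun s _ => ?_
  split_ifs with hs
  · exact dBound_zero
  · have h6 := (isChannel_decode.dBound).comp ((dBound_piMap_piecewise s ε.2 h hΔh
      fun _ => isChannel_id).comp isChannel_encode.dBound isChannel_encode.isHermitianPreserving
        (pow_nonneg ε.2 _)) ?_ zero_le_one
    · simpa using h6
    · intro X
      rw [LinearMap.comp_apply, isChannel_encode.isHermitianPreserving, LinearMap.comp_apply]
      refine IsHermitianPreserving.piMap (fun i => ?_) _
      by_cases hi : i ∈ s
      · simpa [hi] using hΔh i
      · simpa [hi] using isHermitianPreserving_id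

/-- If all but two of the maps are constant, then the two-qubit marginals of the code, hence the
output, do not depend on the encoded state. -/
theorem exists_piMap_encode {i j : Fin 5} (hij : i ≠ j) {Φ : Fin 5 → SuperOp (Fin 2) B}
    {σ : Fin 5 → Matrix B B ℂ} (hΦ : ∀ k, k ≠ i → k ≠ j → Φ k = replaceMap (σ k)) :
    ∃ W : Matrix (Fin 5 → B) (Fin 5 → B) ℂ, piMap Φ ∘ₗ encode = replaceMap W := by
  refine ⟨Matrix.of fun b b' => ∏ k, (Matrix.of fun a' a : Fin 2 =>
    Φ k (Matrix.single a a' 1) (b k) (b' k)).trace / 2, LinearMap.ext fun X => ?_⟩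
  ext b b'
  set m : Fin 5 → Matrix (Fin 2) (Fin 2) ℂ := fun k => Matrix.of fun a' a : Fin 2 =>
    Φ k (Matrix.single a a' 1) (b k) (b' k) with hm
  have h1 := codeMatrix_mul_piKron_mul hij (m := m) (c := fun k => σ k (b k) (b' k)) fun k hi hj => by
    ext a' a
    simp only [hm, hΦ k hi hj, replaceMap, Matrix.of_apply, LinearMap.coe_mk, AddHom.coe_mk,
      Matrix.smul_apply, smul_eq_mul]
    by_cases haa : a = a'
    · subst haa
      simp
    · rw [Matrix.trace_single_eq_of_ne _ _ _ haa, Matrix.one_apply_ne (Ne.symm haa)]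
      simp
  have h2 : (piMap Φ ∘ₗ encode) X b b' = (encode X * piKron m).trace := by
    rw [LinearMap.comp_apply, piMap_apply]
    rfl
  rw [h2, encode_apply, Matrix.mul_assoc, Matrix.mul_assoc, Matrix.trace_mul_comm,
    Matrix.mul_assoc, h1]
  simp [replaceMap, mul_comm, hm]

/-- Coding improves secrecy: if each `Ψᵢ` is a constant channel up to `Δᵢ`, then the terms of
`⨂ᵢ Ψᵢ` with at most two factors `Δᵢ` do not depend on the encoded state, and the others have size
at most `δ ^ 3`. -/
theorem exists_diamondDist_replaceMap_piMap_encode_le {Ψ : Fin 5 → SuperOp (Fin 2) B} {δ : ℝ≥0}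
    (hδ : δ ≤ 1 / 2) (hΨ : ∀ i, IsChannel (Ψ i)) {σ : Fin 5 → Matrix B B ℂ}
    (hσ : ∀ i, IsDensity (σ i)) (h : ∀ i, diamondDist (replaceMap (σ i)) (Ψ i) ≤ δ) :
    ∃ τ : Matrix (Fin 5 → B) (Fin 5 → B) ℂ, IsDensity τ ∧
      diamondDist (replaceMap τ) (piMap Ψ ∘ₗ encode) ≤ codeError δ := by
  simp only [diamondDist_le_iff_dBound] at h
  set Φ : Fin 5 → SuperOp (Fin 2) B := fun i => replaceMap (σ i) with hΦ
  set Δ : Fin 5 → SuperOp (Fin 2) B := fun i => Ψ i - Φ i with hΔ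
  have hΦc : ∀ i, IsChannel (Φ i) := fun i => isChannel_replaceMap (hσ i)
  have hΔh : ∀ i, IsHermitianPreserving (Δ i) := fun i =>
    (hΨ i).isHermitianPreserving.sub (hΦc i).isHermitianPreserving
  have hΔd : ∀ i, DBound (Δ i) δ := fun i => by
    have := (h i).neg
    rwa [neg_sub] at this
  have hΨΔ : Ψ = Δ + Φ := by
    funext i
    simp [hΔ]
  obtain ⟨ω, hω⟩ := exists_isDensity (A := Fin 2)
  set T : Finset (Fin 5) → SuperOp (Fin 2) (Fin 5 → B) :=
    fun s => piMap (s.piecewise Δ Φ) ∘ₗ encode with hT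
  have hsum : piMap Ψ ∘ₗ encode = ∑ s, T s := by
    rw [hΨΔ, MultilinearMap.map_add_univ]
    refine LinearMap.ext fun X => ?_
    simp only [hT, LinearMap.comp_apply, LinearMap.sum_apply]
  have hconst : ∀ s : Finset (Fin 5), s.card < 3 → T s ∘ₗ replaceMap ω = T s := by
    intro s hs
    obtain ⟨i, j, hij, hs'⟩ : ∃ i j : Fin 5, i ≠ j ∧ ∀ k, k ≠ i → k ≠ j → k ∉ s := by
      obtain ⟨t, hst, ht⟩ := Finset.exists_superset_card_eq (s := s) (n := 2) (by omega) (by simp)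
      obtain ⟨i, j, hij, rfl⟩ := Finset.card_eq_two.mp ht
      refine ⟨i, j, hij, fun k hi hj hk => ?_⟩
      have := hst hk
      simp [hi, hj] at this
    obtain ⟨W, hW⟩ := exists_piMap_encode hij (Φ := s.piecewise Δ Φ) (σ := σ) fun k hi hj => by
      simp [hs' k hi hj, hΦ]
    simp only [hT, hW]
    refine LinearMap.ext fun X => ?_
    simp [replaceMap, hω.2]
  have hTd : ∀ s, DBound (T s) ((δ : ℝ) ^ s.card) := fun s => by
    have := (dBound_piMap_piecewise s δ.2 hΔd hΔh hΦc).comp isChannel_encode.dBound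
      isChannel_encode.isHermitianPreserving (pow_nonneg δ.2 _)
    rwa [mul_one] at this
  refine ⟨(piMap Ψ ∘ₗ encode) ω,
    ((isChannel_piMap hΨ).comp isChannel_encode).isDensity hω, ?_⟩
  rw [diamondDist_le_iff_dBound]
  have h1 : replaceMap ((piMap Ψ ∘ₗ encode) ω) - piMap Ψ ∘ₗ encode =
      ∑ s : Finset (Fin 5), if s.card < 3 then 0 else T s ∘ₗ replaceMap ω + -T s := by
    have h2 : (replaceMap ((piMap Ψ ∘ₗ encode) ω) : SuperOp (Fin 2) (Fin 5 → B)) = ∑ s, T s ∘ₗ replaceMap ω := by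
      rw [hsum]
      refine LinearMap.ext fun X => ?_
      simp only [replaceMap, LinearMap.coe_mk, AddHom.coe_mk, LinearMap.sum_apply,
        LinearMap.comp_apply, map_smul, Finset.smul_sum]
    rw [h2, hsum, ← Finset.sum_sub_distrib]
    refine Finset.sum_congr rfl fun s _ => ?_
    split_ifs with hs
    · rw [hconst s hs, sub_self]
    · rw [sub_eq_add_neg]
  rw [h1]
  have hle : (∑ s : Finset (Fin 5), if s.card < 3 then 0 else (δ : ℝ) ^ s.card + (δ : ℝ) ^ s.card) ≤
      (codeError δ : ℝ) := by
    rw [sum_finset_five fun k => if k < 3 then 0 else (δ : ℝ) ^ k + (δ : ℝ) ^ k]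
    have h0 : (0 : ℝ) ≤ δ := δ.2
    have h1 : (δ : ℝ) ≤ 1 / 2 := by exact_mod_cast hδ
    simp only [codeError, NNReal.coe_add, NNReal.coe_mul, NNReal.coe_pow, NNReal.coe_ofNat]
    norm_num
    have h2 : (δ : ℝ) ^ 2 * (10 * δ + 5 * δ ^ 2 + δ ^ 3) ≤ (δ : ℝ) ^ 2 * 10 := by
      refine mul_le_mul_of_nonneg_left ?_ (sq_nonneg _)
      have h3 : (δ : ℝ) ^ 2 ≤ (1 / 2) ^ 2 := pow_le_pow_left₀ h0 h1 2
      have h4 : (δ : ℝ) ^ 3 ≤ (1 / 2) ^ 3 := pow_le_pow_left₀ h0 h1 3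
      linarith
    linarith
  refine DBound.mono (DBound.sum fun s _ => ?_) hle
  split_ifs with hs
  · exact dBound_zero
  · have hr := isChannel_replaceMap (A := Fin 2) hω
    have := (hTd s).comp hr.dBound hr.isHermitianPreserving (pow_nonneg δ.2 _)
    rw [mul_one] at this
    exact this.add (hTd s).neg

end CodeNoise

/-! ### Amplification of protocols by coding -/

section Amplify

variable {Q Q' L L' R R' M M' N N' A B C D E F : Type*}
  [Fintype Q] [DecidableEq Q] [Fintype Q'] [DecidableEq Q'] [Fintype L] [DecidableEq L]
  [Fintype L'] [DecidableEq L'] [Fintype R] [DecidableEq R] [Fintype R'] [DecidableEq R']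
  [Fintype M] [DecidableEq M] [Fintype M'] [DecidableEq M'] [Fintype N] [DecidableEq N]
  [Fintype N'] [DecidableEq N'] [Fintype A] [DecidableEq A] [Fintype B] [DecidableEq B]
  [Fintype C] [DecidableEq C] [Fintype D] [DecidableEq D] [Fintype E] [DecidableEq E]
  [Fintype F] [DecidableEq F]

theorem reindexMap_prodAssoc_symm_kronecker (X : Matrix A A ℂ) (Y : Matrix C C ℂ)
    (Z : Matrix E E ℂ) :
    reindexMap (Equiv.prodAssoc A C E).symm (X ⊗ₖ (Y ⊗ₖ Z)) = (X ⊗ₖ Y) ⊗ₖ Z := by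
  ext
  simp [mul_assoc]

theorem reindexMap_prodComm_kronecker (X : Matrix A A ℂ) (Y : Matrix C C ℂ) :
    reindexMap (Equiv.prodComm A C) (X ⊗ₖ Y) = Y ⊗ₖ X := by
  ext
  simp [mul_comm]

theorem tensorMap_assoc (Φ : SuperOp A B) (Φ' : SuperOp C D) (Φ'' : SuperOp E F) :
    tensorMap (tensorMap Φ Φ') Φ'' ∘ₗ reindexMap (Equiv.prodAssoc A C E).symm =
      reindexMap (Equiv.prodAssoc B D F).symm ∘ₗ tensorMap Φ (tensorMap Φ' Φ'') := by
  refine superOp_ext fun ⟨a, c, e⟩ ⟨a', c', e'⟩ => ?_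
  rw [single_prod, single_prod, LinearMap.comp_apply, LinearMap.comp_apply, tensorMap_kronecker,
    tensorMap_kronecker, reindexMap_prodAssoc_symm_kronecker, reindexMap_prodAssoc_symm_kronecker,
    tensorMap_kronecker, tensorMap_kronecker]

theorem tensorMap_comp_withResource (Φ : SuperOp Q Q') (Φ' : SuperOp L L') (Φ'' : SuperOp R R')
    (S : Matrix (L × R) (L × R) ℂ) :
    tensorMap (tensorMap Φ Φ') Φ'' ∘ₗ withResource S =
      withResource (tensorMap Φ' Φ'' S) ∘ₗ Φ := by
  refine LinearMap.ext fun X => ?_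
  have h := LinearMap.congr_fun (tensorMap_assoc Φ Φ' Φ'') (X ⊗ₖ S)
  rw [LinearMap.comp_apply, LinearMap.comp_apply, tensorMap_kronecker] at h
  exact h

/-- Local channels that act on the resource can be absorbed into the channels of the players. -/
theorem joint_tensorMap (Φ : SuperOp (Q × L') M) (Ψ : SuperOp R' N) (C : SuperOp L L')
    (D : SuperOp R R') (S : Matrix (L × R) (L × R) ℂ) :
    joint Φ Ψ (tensorMap C D S) = joint (Φ ∘ₗ tensorMap LinearMap.id C) (Ψ ∘ₗ D) S := by
  rw [joint_comp, joint, joint, tensorMap_comp_withResource, LinearMap.comp_id]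

/-- Five copies of a bipartite state, grouped by the players. -/
def powState (S : Matrix (L × R) (L × R) ℂ) :
    Matrix ((Fin 5 → L) × (Fin 5 → R)) ((Fin 5 → L) × (Fin 5 → R)) ℂ :=
  reindexMap (Equiv.arrowProdEquivProdArrow (Fin 5) (fun _ => L) fun _ => R)
    (piKron fun _ : Fin 5 => S)

theorem IsDensity.powState {S : Matrix (L × R) (L × R) ℂ} (hS : IsDensity S) :
    IsDensity (powState S) := by
  refine (isChannel_reindexMap _).isDensity ⟨?_, ?_⟩
  · obtain ⟨T, hT⟩ := exists_eq_mul_conjTranspose hS.1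
    have h : piKron (fun _ : Fin 5 => S) =
        piKron (fun _ : Fin 5 => T) * (piKron fun _ : Fin 5 => T).conjTranspose := by
      rw [conjTranspose_piKron, piKron_mul, hT]
    rw [h]
    exact Matrix.posSemidef_self_mul_conjTranspose _
  · rw [trace_piKron, hS.2]
    simp

/-- Encode a qubit into five, then apply a channel to each of them and one copy of `L`. -/
def powAlice (Φ : SuperOp (Fin 2 × L) M) : SuperOp (Fin 2 × (Fin 5 → L)) (Fin 5 → M) :=
  piMap (fun _ => Φ) ∘ₗ
    reindexMap (Equiv.arrowProdEquivProdArrow (Fin 5) (fun _ => Fin 2) fun _ => L).symm ∘ₗ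
      tensorMap encode LinearMap.id

theorem IsChannel.powAlice {Φ : SuperOp (Fin 2 × L) M} (h : IsChannel Φ) :
    IsChannel (powAlice Φ) :=
  (isChannel_piMap fun _ => h).comp
    ((isChannel_reindexMap _).comp (isChannel_encode.tensorMap isChannel_id))

theorem piMap_comp_powAlice (Φ : SuperOp (Fin 2 × L) M) (Θ : SuperOp M N) :
    piMap (fun _ => Θ) ∘ₗ powAlice Φ = powAlice (Θ ∘ₗ Φ) := by
  rw [powAlice, powAlice, piMap_comp, LinearMap.comp_assoc]

/-- Adjoining `powState S` amounts to adjoining `S` five times. -/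
theorem reindexMap_comp_withResource_powState (S : Matrix (L × R) (L × R) ℂ) :
    tensorMap (reindexMap (Equiv.arrowProdEquivProdArrow (Fin 5) (fun _ => Q) fun _ => L).symm)
        LinearMap.id ∘ₗ withResource (powState S) =
      reindexMap (Equiv.arrowProdEquivProdArrow (Fin 5) (fun _ => Q × L) fun _ => R) ∘ₗ
        piMap fun _ : Fin 5 => (withResource S : SuperOp Q ((Q × L) × R)) := by
  have hid : (LinearMap.id : SuperOp (Fin 5 → R) (Fin 5 → R)) = reindexMap (Equiv.refl _) := rfl
  refine superOp_pi_ext fun m => ?_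
  rw [hid, tensorMap_reindexMap, LinearMap.comp_apply, LinearMap.comp_apply, piMap_piKron]
  ext ⟨p, r⟩ ⟨p', r'⟩
  simp [withResource_apply, powState, piKron_apply, Equiv.arrowProdEquivProdArrow]
  exact Finset.prod_mul_distrib.symm

/-- The channel of the amplified protocol is a tensor power of the original one, applied to the
encoded secret. -/
theorem joint_powAlice (Φ : SuperOp (Fin 2 × L) M) (Ψ : SuperOp R N)
    (S : Matrix (L × R) (L × R) ℂ) :
    joint (powAlice Φ) (piMap fun _ => Ψ) (powState S) =
      reindexMap (Equiv.arrowProdEquivProdArrow (Fin 5) (fun _ => M) fun _ => N) ∘ₗ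
        piMap (fun _ => joint Φ Ψ S) ∘ₗ encode := by
  have h1 : joint (powAlice Φ) (piMap fun _ => Ψ) (powState S) =
      tensorMap (piMap fun _ => Φ) (piMap fun _ => Ψ) ∘ₗ
        (tensorMap (reindexMap (Equiv.arrowProdEquivProdArrow (Fin 5) (fun _ => Fin 2)
          fun _ => L).symm) LinearMap.id ∘ₗ withResource (powState S)) ∘ₗ encode := by
    have h2 := tensorMap_comp_withResource encode (LinearMap.id : SuperOp (Fin 5 → L) (Fin 5 → L))
      (LinearMap.id : SuperOp (Fin 5 → R) (Fin 5 → R)) (powState S)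
    rw [tensorMap_id_id, LinearMap.id_apply] at h2
    have h3 : tensorMap (piMap fun _ => Φ) (piMap fun _ => Ψ) ∘ₗ
        tensorMap (reindexMap (Equiv.arrowProdEquivProdArrow (Fin 5) (fun _ => Fin 2)
          fun _ => L).symm) LinearMap.id ∘ₗ tensorMap (tensorMap encode LinearMap.id)
            (LinearMap.id : SuperOp (Fin 5 → R) (Fin 5 → R)) = tensorMap (powAlice Φ) (piMap fun _ => Ψ) := by
      rw [← tensorMap_comp, ← tensorMap_comp, powAlice]
      simp only [LinearMap.comp_id]
    rw [LinearMap.comp_assoc, ← h2, joint, ← h3]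
    simp only [LinearMap.comp_assoc]
  rw [h1, reindexMap_comp_withResource_powState, LinearMap.comp_assoc, ← LinearMap.comp_assoc,
    tensorMap_piMap_piMap, LinearMap.comp_assoc, ← LinearMap.comp_assoc encode, ← piMap_comp]
  rfl

/-- Decoding after amplification: apply `D` to each of the five outputs, then decode. -/
theorem diamondDist_powDecode_le {Φ : SuperOp (Fin 2) (M × N)} (hΦ : IsChannel Φ)
    {D : SuperOp (M × N) (Fin 2)} (hD : IsChannel D) {ε : ℝ≥0}
    (h : diamondDist (D ∘ₗ Φ) LinearMap.id ≤ ε) :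
    ∃ D' : SuperOp ((Fin 5 → M) × (Fin 5 → N)) (Fin 2), IsChannel D' ∧
      diamondDist (D' ∘ₗ
        reindexMap (Equiv.arrowProdEquivProdArrow (Fin 5) (fun _ => M) fun _ => N) ∘ₗ
          piMap (fun _ => Φ) ∘ₗ encode) LinearMap.id ≤ codeError ε := by
  refine ⟨decode ∘ₗ piMap (fun _ => D) ∘ₗ
    reindexMap (Equiv.arrowProdEquivProdArrow (Fin 5) (fun _ => M) fun _ => N).symm,
    isChannel_decode.comp ((isChannel_piMap fun _ => hD).comp (isChannel_reindexMap _)), ?_⟩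
  simp only [LinearMap.comp_assoc]
  rw [← LinearMap.comp_assoc _ (reindexMap _) (reindexMap _), reindexMap_symm_comp,
    LinearMap.id_comp, ← LinearMap.comp_assoc encode, ← piMap_comp]
  exact diamondDist_decode_piMap_encode_le (fun _ => hD.comp hΦ) fun _ => h

end Amplify

namespace FRProtocol

variable {n : ℕ} {L R M₀ M₀' M₁ M₁' : Type*}
  [Fintype L] [DecidableEq L] [Fintype R] [DecidableEq R]
  [Fintype M₀] [DecidableEq M₀] [Fintype M₀'] [DecidableEq M₀']
  [Fintype M₁] [DecidableEq M₁] [Fintype M₁'] [DecidableEq M₁']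
  {f : (Fin n → Bool) → (Fin n → Bool) → Bool} {ε₀ ε₁ : ℝ≥0}

/-- Five parallel runs of a protocol, one for each qubit of the encoded `Q`. -/
def amplify (P : FRProtocol n (Fin 2) L R M₀ M₀' M₁ M₁') :
    FRProtocol n (Fin 2) (Fin 5 → L) (Fin 5 → R) (Fin 5 → M₀) (Fin 5 → M₀') (Fin 5 → M₁)
      (Fin 5 → M₁') where
  state := powState P.state
  state_isDensity := P.state_isDensity.powState
  alice x := reindexMap (Equiv.arrowProdEquivProdArrow (Fin 5) (fun _ => M₀) fun _ => M₀') ∘ₗ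
    powAlice (P.alice x)
  alice_isChannel x := (isChannel_reindexMap _).comp (P.alice_isChannel x).powAlice
  bob y := reindexMap (Equiv.arrowProdEquivProdArrow (Fin 5) (fun _ => M₁) fun _ => M₁') ∘ₗ
    piMap fun _ => P.bob y
  bob_isChannel y := (isChannel_reindexMap _).comp (isChannel_piMap fun _ => P.bob_isChannel y)

theorem amplify_toBob (P : FRProtocol n (Fin 2) L R M₀ M₀' M₁ M₁') (x y : Fin n → Bool) :
    P.amplify.toBob x y =
      reindexMap (Equiv.arrowProdEquivProdArrow (Fin 5) (fun _ => M₀) fun _ => M₁) ∘ₗ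
        piMap (fun _ => P.toBob x y) ∘ₗ encode := by
  rw [toBob_eq_joint, toBob_eq_joint, ← joint_powAlice]
  simp only [amplify]
  rw [← LinearMap.comp_assoc, ← LinearMap.comp_assoc, traceSnd_comp_arrowProd,
    traceSnd_comp_arrowProd, piMap_comp_powAlice, ← piMap_comp]

theorem amplify_toAlice (P : FRProtocol n (Fin 2) L R M₀ M₀' M₁ M₁') (x y : Fin n → Bool) :
    P.amplify.toAlice x y =
      reindexMap (Equiv.arrowProdEquivProdArrow (Fin 5) (fun _ => M₀') fun _ => M₁') ∘ₗ
        piMap (fun _ => P.toAlice x y) ∘ₗ encode := by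
  rw [toAlice_eq_joint, toAlice_eq_joint, ← joint_powAlice]
  simp only [amplify]
  rw [← LinearMap.comp_assoc, ← LinearMap.comp_assoc, traceFst_comp_arrowProd,
    traceFst_comp_arrowProd, piMap_comp_powAlice, ← piMap_comp]

theorem IsCorrect.amplify {P : FRProtocol n (Fin 2) L R M₀ M₀' M₁ M₁'}
    (h : P.IsCorrect f ε₀ ε₁) : P.amplify.IsCorrect f (codeError ε₀) (codeError ε₁) := by
  refine ⟨fun x y hxy => ?_, fun x y hxy => ?_⟩
  · obtain ⟨D, hD, hDd⟩ := h.1 x y hxy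
    rw [amplify_toBob]
    refine diamondDist_powDecode_le ?_ hD hDd
    rw [toBob_eq_joint]
    exact isChannel_joint (isChannel_traceSnd.comp (P.alice_isChannel x))
      (isChannel_traceSnd.comp (P.bob_isChannel y)) P.state_isDensity
  · obtain ⟨D, hD, hDd⟩ := h.2 x y hxy
    rw [amplify_toAlice]
    refine diamondDist_powDecode_le ?_ hD hDd
    rw [toAlice_eq_joint]
    exact isChannel_joint (isChannel_traceFst.comp (P.alice_isChannel x))
      (isChannel_traceFst.comp (P.bob_isChannel y)) P.state_isDensity

end FRProtocol

namespace CDQSProtocol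

variable {n : ℕ} {L R MA MB : Type*} [Fintype L] [DecidableEq L] [Fintype R] [DecidableEq R]
  [Fintype MA] [DecidableEq MA] [Fintype MB] [DecidableEq MB]
  {f : (Fin n → Bool) → (Fin n → Bool) → Bool} {ε δ : ℝ≥0}

/-- Five parallel runs of a protocol, one for each qubit of the encoded secret. -/
def amplify (P : CDQSProtocol n (Fin 2) L R MA MB) :
    CDQSProtocol n (Fin 2) (Fin 5 → L) (Fin 5 → R) (Fin 5 → MA) (Fin 5 → MB) where
  state := powState P.state
  state_isDensity := P.state_isDensity.powState
  alice x := powAlice (P.alice x)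
  alice_isChannel x := (P.alice_isChannel x).powAlice
  bob y := piMap fun _ => P.bob y
  bob_isChannel y := isChannel_piMap fun _ => P.bob_isChannel y

theorem amplify_channel (P : CDQSProtocol n (Fin 2) L R MA MB) (x y : Fin n → Bool) :
    P.amplify.channel x y =
      reindexMap (Equiv.arrowProdEquivProdArrow (Fin 5) (fun _ => MA) fun _ => MB) ∘ₗ
        piMap (fun _ => P.channel x y) ∘ₗ encode :=
  joint_powAlice (P.alice x) (P.bob y) P.state

theorem isChannel_channel (P : CDQSProtocol n (Fin 2) L R MA MB) (x y : Fin n → Bool) :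
    IsChannel (P.channel x y) :=
  isChannel_joint (P.alice_isChannel x) (P.bob_isChannel y) P.state_isDensity

theorem IsCorrect.amplify {P : CDQSProtocol n (Fin 2) L R MA MB} (h : P.IsCorrect f ε) :
    P.amplify.IsCorrect f (codeError ε) := by
  intro x y hxy
  obtain ⟨D, hD, hDd⟩ := h x y hxy
  rw [amplify_channel]
  exact diamondDist_powDecode_le (P.isChannel_channel x y) hD hDd

theorem IsSecure.amplify {P : CDQSProtocol n (Fin 2) L R MA MB} (h : P.IsSecure f δ)
    (hδ : δ ≤ 1 / 2) : P.amplify.IsSecure f (codeError δ) := by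
  intro x y hxy
  obtain ⟨σ, hσ, hσd⟩ := h x y hxy
  obtain ⟨τ, hτ, hτd⟩ := exists_diamondDist_replaceMap_piMap_encode_le hδ
    (fun _ => P.isChannel_channel x y) (fun _ => hσ) fun _ => hσd
  set e := Equiv.arrowProdEquivProdArrow (Fin 5) (fun _ => MA) fun _ => MB
  refine ⟨reindexMap e τ, (isChannel_reindexMap e).isDensity hτ, ?_⟩
  rw [diamondDist_le_iff_dBound] at hτd ⊢
  have h1 : replaceMap (reindexMap e τ) - P.amplify.channel x y =
      reindexMap e ∘ₗ (replaceMap τ - piMap (fun _ => P.channel x y) ∘ₗ encode) ∘ₗ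
        reindexMap (Equiv.refl (Fin 2)) := by
    rw [amplify_channel]
    rfl
  rw [h1]
  exact hτd.reindex (codeError δ).2 _ _

end CDQSProtocol

/-! ### Compressing the resource -/

section Compress

variable {Q L R M N MA MB : Type*} [Fintype Q] [DecidableEq Q] [Fintype L] [DecidableEq L]
  [Fintype R] [DecidableEq R] [Fintype M] [DecidableEq M] [Fintype N] [DecidableEq N]
  [Fintype MA] [DecidableEq MA] [Fintype MB] [DecidableEq MB]

/-- Every state of `L R` arises from a pure state of `L L`, namely the canonical purification of its
marginal on `L`, by a channel on the second factor. -/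
theorem exists_isPure_tensorMap {S : Matrix (L × R) (L × R) ℂ} (hS : IsDensity S) :
    ∃ (T : Matrix (L × L) (L × L) ℂ) (C : SuperOp L R), IsPure T ∧ IsChannel C ∧
      tensorMap LinearMap.id C T = S := by
  obtain ⟨⟨l₀, r₀⟩⟩ := hS.nonempty
  have : Nonempty R := ⟨r₀⟩
  obtain ⟨T, hT⟩ := exists_eq_mul_conjTranspose hS.1
  set A : Matrix L (R × (L × R)) ℂ := Matrix.of fun l p => T (l, p.1) p.2 with hA
  obtain ⟨P, W, hP, hPP, hAW, hWP, hW, -⟩ :=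
    exists_polar (Matrix.posSemidef_self_mul_conjTranspose A) rfl
  set k : L × R → Matrix R L ℂ := fun e => Matrix.of fun r l => W l (r, e) with hk
  have hkW : ∑ e, (k e).conjTranspose * k e = (W * W.conjTranspose).transpose := by
    ext l l'
    simp only [hk, Matrix.sum_apply, Matrix.mul_apply, Matrix.conjTranspose_apply, Matrix.of_apply,
      Matrix.transpose_apply]
    rw [Fintype.sum_prod_type (f := fun j : R × (L × R) => W l' j * star (W l j)),
      Finset.sum_comm]
    exact Finset.sum_congr rfl fun r _ => Finset.sum_congr rfl fun e _ =>
      mul_comm (star (W l (r, e))) (W l' (r, e))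
  obtain ⟨k', hk'⟩ := exists_isTP_sumElim (k := k) (by
    have h := hW.conjTranspose
    rw [IsContraction, Matrix.conjTranspose_conjTranspose] at h
    have h1 := h.transpose
    rwa [Matrix.transpose_sub, Matrix.transpose_one, ← hkW] at h1)
  set ψ : L × L → ℂ := fun p => P p.1 p.2 with hψ
  -- the additional Kraus operators vanish on the support of the marginal
  have hzero : ∀ e, k' e * P.transpose = 0 := by
    have h1 : ∑ e, (k' e * P.transpose).conjTranspose * (k' e * P.transpose) = 0 := by
      have h2 : ∑ e, (k' e).conjTranspose * k' e = 1 - (W * W.conjTranspose).transpose := by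
        rw [← hkW]
        have h3 : ∑ e, (Sum.elim k k' e).conjTranspose * Sum.elim k k' e = 1 := hk'
        rw [Fintype.sum_sum_type] at h3
        simp only [Sum.elim_inl, Sum.elim_inr] at h3
        rw [← h3, add_sub_cancel_left]
      have h4 : (1 - W * W.conjTranspose).transpose * P.transpose =
          (P * (1 - W * W.conjTranspose)).transpose := (Matrix.transpose_mul _ _).symm
      have h5 : P * (1 - W * W.conjTranspose) = 0 := by
        have := congrArg Matrix.conjTranspose hWP
        rw [Matrix.conjTranspose_mul, Matrix.conjTranspose_mul, Matrix.conjTranspose_conjTranspose,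
          hP.1.eq] at this
        rw [Matrix.mul_sub, this, Matrix.mul_one, sub_self]
      calc _ = P.transpose.conjTranspose * ((∑ e, (k' e).conjTranspose * k' e) * P.transpose) := by
            simp only [Matrix.conjTranspose_mul, Matrix.mul_sum, Matrix.sum_mul, Matrix.mul_assoc]
        _ = 0 := by
            rw [h2, ← Matrix.transpose_one, ← Matrix.transpose_sub, h4, h5,
              Matrix.transpose_zero, Matrix.mul_zero]
    have h6 := congrArg Matrix.trace h1
    rw [Matrix.trace_sum, Matrix.trace_zero, Finset.sum_eq_zero_iff_of_nonneg fun e _ =>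
      (Matrix.posSemidef_conjTranspose_mul_self _).trace_nonneg] at h6
    exact fun e => Matrix.trace_conjTranspose_mul_self_eq_zero_iff.mp (h6 e (Finset.mem_univ e))
  refine ⟨Matrix.vecMulVec ψ (star ψ), krausMap (Sum.elim k k'),
    ⟨⟨Matrix.posSemidef_vecMulVec_self_star ψ, ?_⟩, ψ, rfl⟩, hk'.isChannel, ?_⟩
  · have h1 : (Matrix.vecMulVec ψ (star ψ)).trace = (P * P.conjTranspose).trace := by
      simp [Matrix.trace, Matrix.vecMulVec_apply, hψ, Fintype.sum_prod_type, Matrix.mul_apply]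
    rw [h1, hP.1.eq, hPP, ← hS.2, hT]
    simp [Matrix.trace, Matrix.mul_apply, Fintype.sum_prod_type, hA]
  · ext ⟨l, r⟩ ⟨l', r'⟩
    have hv : ∀ (e : (L × R) ⊕ L) (l : L) (r : R), ∑ a, Sum.elim k k' e r a * P l a =
        Sum.elim (fun e => T (l, r) e) (fun _ => 0) e := by
      rintro (e | e) l r
      · have := congrFun (congrFun hAW l) (r, e)
        rw [Matrix.mul_apply] at this
        refine Eq.trans ?_ this.symm
        exact Finset.sum_congr rfl fun a _ => mul_comm _ _
      · have := congrFun (congrFun (hzero e) r) l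
        rw [Matrix.mul_apply] at this
        exact this
    rw [tensorMap_id_krausMap, krausMap_apply_apply, hT, Matrix.mul_apply]
    have h2 : ∀ e, (∑ p : L × L, ∑ p' : L × L, ((1 : Matrix L L ℂ) ⊗ₖ Sum.elim k k' e) (l, r) p *
        Matrix.vecMulVec ψ (star ψ) p p' *
          star (((1 : Matrix L L ℂ) ⊗ₖ Sum.elim k k' e) (l', r') p')) =
        (∑ a, Sum.elim k k' e r a * P l a) * star (∑ a, Sum.elim k k' e r' a * P l' a) := by
      intro e
      simp only [Fintype.sum_prod_type, Matrix.kroneckerMap_apply, Matrix.vecMulVec_apply,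
        Matrix.one_apply, ite_mul, one_mul, zero_mul, apply_ite star, star_zero, mul_ite, mul_zero,
        Finset.sum_ite_irrel, Finset.sum_const_zero, Finset.sum_ite_eq, Finset.mem_univ, if_true,
        hψ, Pi.star_apply, star_sum, star_mul', Finset.sum_mul_sum]
      refine Finset.sum_congr rfl fun a _ => Finset.sum_congr rfl fun a' _ => ?_
      ring
    simp only [h2, hv, Fintype.sum_sum_type, Sum.elim_inl, Sum.elim_inr, zero_mul,
      Finset.sum_const_zero, add_zero, Matrix.conjTranspose_apply]

theorem IsPure.reindexMap {T : Matrix M M ℂ} (h : IsPure T) (e : M ≃ N) :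
    IsPure (reindexMap e T) := by
  obtain ⟨hT, ψ, rfl⟩ := h
  exact ⟨(isChannel_reindexMap e).isDensity hT, ψ ∘ e.symm, rfl⟩

namespace CDQSProtocol

variable {n : ℕ}

/-- Any resource may be replaced by a pure state of two copies of `L`. -/
theorem exists_isPure_left (P : CDQSProtocol n Q L R MA MB) :
    ∃ P' : CDQSProtocol n Q L L MA MB, IsPure P'.state ∧
      ∀ x y, P'.channel x y = P.channel x y := by
  obtain ⟨T, C, hT, hC, hTS⟩ := exists_isPure_tensorMap P.state_isDensity
  refine ⟨⟨T, hT.1, P.alice, P.alice_isChannel, fun y => P.bob y ∘ₗ C,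
    fun y => (P.bob_isChannel y).comp hC⟩, hT, fun x y => ?_⟩
  have h := joint_tensorMap (P.alice x) (P.bob y) LinearMap.id C T
  rw [hTS, tensorMap_id_id, LinearMap.comp_id] at h
  exact h.symm

/-- Any resource may be replaced by a pure state of two copies of `R`. -/
theorem exists_isPure_right (P : CDQSProtocol n Q L R MA MB) :
    ∃ P' : CDQSProtocol n Q R R MA MB, IsPure P'.state ∧
      ∀ x y, P'.channel x y = P.channel x y := by
  obtain ⟨T, C, hT, hC, hTS⟩ := exists_isPure_tensorMap
    ((isChannel_reindexMap (Equiv.prodComm L R)).isDensity P.state_isDensity)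
  set T' := reindexMap (Equiv.prodComm R R) T with hT'
  have hTS' : tensorMap C LinearMap.id T' = P.state := by
    have h1 : tensorMap C (LinearMap.id : SuperOp R R) ∘ₗ reindexMap (Equiv.prodComm R R) =
        reindexMap (Equiv.prodComm R L) ∘ₗ tensorMap LinearMap.id C := by
      refine superOp_prod_ext fun X Y => ?_
      rw [LinearMap.comp_apply, LinearMap.comp_apply, tensorMap_kronecker,
        reindexMap_prodComm_kronecker, reindexMap_prodComm_kronecker, tensorMap_kronecker]
    have h2 := LinearMap.congr_fun h1 T
    rw [LinearMap.comp_apply, LinearMap.comp_apply, hTS] at h2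
    rw [h2]
    rfl
  have hP : IsPure T' := hT.reindexMap _
  refine ⟨⟨T', hP.1, fun x => P.alice x ∘ₗ tensorMap LinearMap.id C, fun x =>
    (P.alice_isChannel x).comp (isChannel_id.tensorMap hC), P.bob, P.bob_isChannel⟩, hP,
    fun x y => ?_⟩
  have h := joint_tensorMap (P.alice x) (P.bob y) C LinearMap.id T'
  rw [hTS', LinearMap.comp_id] at h
  exact h.symm

end CDQSProtocol

end Compress

/-! ### Comparison of the costs -/

section Costs

theorem codeError_mono : Monotone codeError := fun a b h => by
  unfold codeError
  gcongr

theorem exists_iterate_codeError_le : ∃ k : ℕ, codeError^[k] 0.09 ≤ 0.002 := by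
  have step : ∀ a b : ℝ≥0, codeError a ≤ b → (∃ k : ℕ, codeError^[k] b ≤ 0.002) →
      ∃ k : ℕ, codeError^[k] a ≤ 0.002 := by
    rintro a b hab ⟨k, hk⟩
    refine ⟨k + 1, ?_⟩
    rw [Function.iterate_succ_apply]
    exact (codeError_mono.iterate k hab).trans hk
  -- `codeError` has a fixed point near `0.0913`, just above the starting point, so that the first
  -- iterations decrease slowly
  refine step _ 0.0887 ?_ <| step _ 0.086 ?_ <| step _ 0.081 ?_ <| step _ 0.0712 ?_ <|
    step _ 0.0545 ?_ <| step _ 0.0314 ?_ <| step _ 0.0102 ?_ <| step _ 0.0011 ?_ ⟨0, ?_⟩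
  all_goals
    rw [← NNReal.coe_le_coe]
    norm_num [codeError]

theorem two_mul_sqrt_le : 2 * NNReal.sqrt 0.002 ≤ 0.09 := by
  have h : NNReal.sqrt 0.002 ≤ 0.045 := by
    rw [NNReal.sqrt_le_iff_le_sq, ← NNReal.coe_le_coe]
    norm_num
  calc 2 * NNReal.sqrt 0.002 ≤ 2 * 0.045 := by gcongr
    _ ≤ 0.09 := by
      rw [← NNReal.coe_le_coe]
      norm_num

theorem qubits_fin_pow (d k : ℕ) : qubits (Fin (d ^ k)) = k * qubits (Fin d) := by
  simp [qubits, Real.logb_pow]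

variable {n : ℕ} {f : (Fin n → Bool) → (Fin n → Bool) → Bool}

theorem FRProtocol.exists_amplify_iterate (k : ℕ) {l r m₀ m₀' m₁ m₁' : ℕ} {ε₀ ε₁ : ℝ≥0}
    (P : FRProtocol n (Fin 2) (Fin l) (Fin r) (Fin m₀) (Fin m₀') (Fin m₁) (Fin m₁'))
    (h : P.IsCorrect f ε₀ ε₁) :
    ∃ (p p' q q' : ℕ) (P' : FRProtocol n (Fin 2) (Fin (l ^ 5 ^ k)) (Fin (r ^ 5 ^ k)) (Fin p)
      (Fin p') (Fin q) (Fin q')), P'.IsCorrect f (codeError^[k] ε₀) (codeError^[k] ε₁) := by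
  induction k with
  | zero =>
    rw [pow_zero, pow_one, pow_one]
    exact ⟨_, _, _, _, P, h⟩
  | succ k ih =>
    obtain ⟨p, p', q, q', P', hP'⟩ := ih
    have e : ∀ l : ℕ, (Fin 5 → Fin (l ^ 5 ^ k)) ≃ Fin (l ^ 5 ^ (k + 1)) := fun l =>
      Fintype.equivFinOfCardEq (by
        rw [Fintype.card_fun, Fintype.card_fin, Fintype.card_fin, ← pow_mul, pow_succ])
    have h1 := hP'.amplify.reindex (e l) (e r) (Fintype.equivFin _) (Fintype.equivFin _)
      (Fintype.equivFin _) (Fintype.equivFin _)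
    simp only [Function.iterate_succ_apply']
    exact ⟨_, _, _, _, _, h1⟩

/-- The bound on `ε` ensures that the error stays small enough for coding to improve secrecy. -/
theorem CDQSProtocol.exists_amplify_iterate (k : ℕ) {l r mA mB : ℕ} {ε : ℝ≥0} (hε : ε ≤ 0.09)
    (P : CDQSProtocol n (Fin 2) (Fin l) (Fin r) (Fin mA) (Fin mB)) (h : P.IsCorrect f ε)
    (h' : P.IsSecure f ε) :
    ∃ (p q : ℕ) (P' : CDQSProtocol n (Fin 2) (Fin (l ^ 5 ^ k)) (Fin (r ^ 5 ^ k)) (Fin p) (Fin q)),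
      P'.IsCorrect f (codeError^[k] ε) ∧ P'.IsSecure f (codeError^[k] ε) := by
  have h09 : codeError 0.09 ≤ 0.09 := by
    rw [← NNReal.coe_le_coe]
    norm_num [codeError]
  have hhalf : (0.09 : ℝ≥0) ≤ 1 / 2 := by
    rw [← NNReal.coe_le_coe]
    norm_num
  have hle : ∀ k, codeError^[k] ε ≤ 0.09 := by
    intro k
    induction k with
    | zero => exact hε
    | succ k ih =>
      rw [Function.iterate_succ_apply']
      exact (codeError_mono ih).trans h09
  induction k with
  | zero =>
    rw [pow_zero, pow_one, pow_one]
    exact ⟨_, _, P, h, h'⟩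
  | succ k ih =>
    obtain ⟨p, q, P', hP', hP''⟩ := ih
    have e : ∀ l : ℕ, (Fin 5 → Fin (l ^ 5 ^ k)) ≃ Fin (l ^ 5 ^ (k + 1)) := fun l =>
      Fintype.equivFinOfCardEq (by
        rw [Fintype.card_fun, Fintype.card_fin, Fintype.card_fin, ← pow_mul, pow_succ])
    have h1 := hP'.amplify.reindex (e l) (e r) (Fintype.equivFin _) (Fintype.equivFin _)
    have h2 := (hP''.amplify ((hle k).trans hhalf)).reindex (e l) (e r) (Fintype.equivFin _)
      (Fintype.equivFin _)
    simp only [Function.iterate_succ_apply']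
    exact ⟨_, _, _, h1, h2⟩

theorem CDQSProtocol.IsCorrect.mono {Q L R MA MB : Type*}
    [Fintype Q] [DecidableEq Q] [Fintype L] [DecidableEq L] [Fintype R] [DecidableEq R]
    [Fintype MA] [DecidableEq MA] [Fintype MB] [DecidableEq MB] {P : CDQSProtocol n Q L R MA MB}
    {ε ε' : ℝ≥0} (h : P.IsCorrect f ε) (hε : ε ≤ ε') : P.IsCorrect f ε' := fun x y hxy =>
  let ⟨D, hD, hDd⟩ := h x y hxy
  ⟨D, hD, hDd.trans (ENNReal.coe_le_coe.mpr hε)⟩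

theorem CDQSProtocol.IsSecure.mono {Q L R MA MB : Type*}
    [Fintype Q] [DecidableEq Q] [Fintype L] [DecidableEq L] [Fintype R] [DecidableEq R]
    [Fintype MA] [DecidableEq MA] [Fintype MB] [DecidableEq MB] {P : CDQSProtocol n Q L R MA MB}
    {ε ε' : ℝ≥0} (h : P.IsSecure f ε) (hε : ε ≤ ε') : P.IsSecure f ε' := fun x y hxy =>
  let ⟨σ, hσ, hσd⟩ := h x y hxy
  ⟨σ, hσ, hσd.trans (ENNReal.coe_le_coe.mpr hε)⟩

theorem FRProtocol.IsCorrect.mono {Q L R M₀ M₀' M₁ M₁' : Type*}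
    [Fintype Q] [DecidableEq Q] [Fintype L] [DecidableEq L] [Fintype R] [DecidableEq R]
    [Fintype M₀] [DecidableEq M₀] [Fintype M₀'] [DecidableEq M₀']
    [Fintype M₁] [DecidableEq M₁] [Fintype M₁'] [DecidableEq M₁']
    {P : FRProtocol n Q L R M₀ M₀' M₁ M₁'} {ε₀ ε₀' ε₁ ε₁' : ℝ≥0} (h : P.IsCorrect f ε₀ ε₁)
    (h₀ : ε₀ ≤ ε₀') (h₁ : ε₁ ≤ ε₁') : P.IsCorrect f ε₀' ε₁' :=
  ⟨fun x y hxy =>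
    let ⟨D, hD, hDd⟩ := h.1 x y hxy
    ⟨D, hD, hDd.trans (ENNReal.coe_le_coe.mpr h₁)⟩,
   fun x y hxy =>
    let ⟨D, hD, hDd⟩ := h.2 x y hxy
    ⟨D, hD, hDd.trans (ENNReal.coe_le_coe.mpr h₀)⟩⟩

theorem cdqsCost_le {ε δ : ℝ≥0} {l r mA mB : ℕ}
    (P : CDQSProtocol n (Fin 2) (Fin l) (Fin r) (Fin mA) (Fin mB)) (h : P.IsCorrect f ε)
    (h' : P.IsSecure f δ) :
    cdqsCost ε δ f ≤ ENNReal.ofReal (min (qubits (Fin l)) (qubits (Fin r))) :=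
  iInf_le_of_le l <| iInf_le_of_le r <| iInf_le_of_le mA <| iInf_le_of_le mB <|
    iInf_le_of_le P <| iInf_le_of_le h <| iInf_le_of_le h' le_rfl

theorem frCost_le {ε₀ ε₁ : ℝ≥0} {l r m₀ m₀' m₁ m₁' : ℕ}
    (P : FRProtocol n (Fin 2) (Fin l) (Fin r) (Fin m₀) (Fin m₀') (Fin m₁) (Fin m₁'))
    (h : P.IsCorrect f ε₀ ε₁) : frCost ε₀ ε₁ f ≤ ENNReal.ofReal (qubits (Fin l × Fin r)) :=
  iInf_le_of_le l <| iInf_le_of_le r <| iInf_le_of_le m₀ <| iInf_le_of_le m₀' <|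
    iInf_le_of_le m₁ <| iInf_le_of_le m₁' <| iInf_le_of_le P <| iInf_le_of_le h le_rfl

theorem frMinCost_le_frCost (ε₀ ε₁ : ℝ≥0) : frMinCost ε₀ ε₁ f ≤ frCost ε₀ ε₁ f := by
  refine iInf_mono fun l => iInf_mono fun r => iInf_mono fun m₀ => iInf_mono fun m₀' =>
    iInf_mono fun m₁ => iInf_mono fun m₁' => iInf_mono fun P => iInf_mono fun _ =>
      ENNReal.ofReal_le_ofReal ?_
  obtain ⟨⟨a, b⟩⟩ := P.state_isDensity.nonempty
  have : Nonempty (Fin l) := ⟨a⟩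
  have : Nonempty (Fin r) := ⟨b⟩
  rw [qubits_prod]
  exact (min_le_left _ _).trans (le_add_of_nonneg_right qubits_nonneg)

/-- An `f`-routing protocol is amplified before it is turned into a conditional disclosure protocol,
to make up for the square root in the security parameter. -/
theorem cdqsCost_le_mul_frMinCost {k : ℕ} (hk : codeError^[k] 0.09 ≤ 0.002) :
    ((5 ^ k : ℝ≥0)⁻¹ : ℝ≥0) * cdqsCost 0.09 0.09 f ≤ frMinCost 0.09 0.09 f := by
  refine le_iInf fun l => le_iInf fun r => le_iInf fun m₀ => le_iInf fun m₀' =>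
    le_iInf fun m₁ => le_iInf fun m₁' => le_iInf fun P => le_iInf fun hP => ?_
  obtain ⟨p, p', q, q', P', hP'⟩ := P.exists_amplify_iterate k hP
  have h09 : (0.002 : ℝ≥0) ≤ 0.09 := by
    rw [← NNReal.coe_le_coe]
    norm_num
  have hP'' := hP'.mono hk hk
  have h1 := cdqsCost_le P'.toCDQS (hP''.toCDQS_isCorrect.mono h09)
    (hP''.toCDQS_isSecure.mono two_mul_sqrt_le)
  rw [qubits_fin_pow, qubits_fin_pow, ← mul_min_of_nonneg _ _ (Nat.cast_nonneg _),
    ENNReal.ofReal_mul (Nat.cast_nonneg _), ENNReal.ofReal_natCast] at h1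
  calc ((5 ^ k : ℝ≥0)⁻¹ : ℝ≥0) * cdqsCost 0.09 0.09 f
      ≤ ((5 ^ k : ℝ≥0)⁻¹ : ℝ≥0) * (((5 ^ k : ℕ) : ℝ≥0∞) *
        ENNReal.ofReal (min (qubits (Fin l)) (qubits (Fin r)))) := by gcongr
    _ = ENNReal.ofReal (min (qubits (Fin l)) (qubits (Fin r))) := by
        rw [← mul_assoc, ← ENNReal.coe_natCast, ← ENNReal.coe_mul]
        simp

theorem frCost_le_of_isPure {d mA mB : ℕ}
    (P : CDQSProtocol n (Fin 2) (Fin d) (Fin d) (Fin mA) (Fin mB)) (hP : IsPure P.state)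
    (h : P.IsCorrect f 0.002) (h' : P.IsSecure f 0.002) :
    frCost 0.09 0.09 f ≤ ENNReal.ofReal (2 * qubits (Fin d)) := by
  have h09 : (0.002 : ℝ≥0) ≤ 0.09 := by
    rw [← NNReal.coe_le_coe]
    norm_num
  obtain ⟨kA, kB, hA, hB⟩ := P.exists_kraus
  obtain ⟨P', -, hP'⟩ := P.exists_frProtocol kA kB hA hB hP h h'
  refine (frCost_le P' (hP'.mono two_mul_sqrt_le h09)).trans (ENNReal.ofReal_le_ofReal ?_)
  rw [two_mul]
  exact qubits_prod_le

/-- A conditional disclosure protocol is amplified, and its resource is compressed to a pure state of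
two copies of the smaller one of `L` and `R`, before it is turned into an `f`-routing protocol. -/
theorem frCost_le_mul_cdqsCost {k : ℕ} (hk : codeError^[k] 0.09 ≤ 0.002) :
    frCost 0.09 0.09 f ≤ ((2 * 5 ^ k : ℝ≥0) : ℝ≥0∞) * cdqsCost 0.09 0.09 f := by
  have hC0 : ((2 * 5 ^ k : ℝ≥0) : ℝ≥0∞) ≠ 0 := by simp
  have h : ((2 * 5 ^ k : ℝ≥0) : ℝ≥0∞)⁻¹ * frCost 0.09 0.09 f ≤ cdqsCost 0.09 0.09 f := by
    refine le_iInf fun l => le_iInf fun r => le_iInf fun mA => le_iInf fun mB =>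
      le_iInf fun P => le_iInf fun hP => le_iInf fun hP' => ?_
    obtain ⟨p, q, P₁, hP₁, hP₁'⟩ := P.exists_amplify_iterate k le_rfl hP hP'
    have h1 := hP₁.mono hk
    have h2 := hP₁'.mono hk
    have h3 : frCost 0.09 0.09 f ≤ ENNReal.ofReal (2 * min (qubits (Fin (l ^ 5 ^ k)))
        (qubits (Fin (r ^ 5 ^ k)))) := by
      rcases min_choice (qubits (Fin (l ^ 5 ^ k))) (qubits (Fin (r ^ 5 ^ k))) with h | h <;> rw [h]
      · obtain ⟨P₂, hP₂, hc⟩ := P₁.exists_isPure_left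
        exact frCost_le_of_isPure P₂ hP₂ (fun x y hxy => by rw [hc]; exact h1 x y hxy)
          fun x y hxy => by rw [hc]; exact h2 x y hxy
      · obtain ⟨P₂, hP₂, hc⟩ := P₁.exists_isPure_right
        exact frCost_le_of_isPure P₂ hP₂ (fun x y hxy => by rw [hc]; exact h1 x y hxy)
          fun x y hxy => by rw [hc]; exact h2 x y hxy
    rw [ENNReal.inv_mul_le_iff hC0 ENNReal.coe_ne_top]
    refine h3.trans (le_of_eq ?_)
    rw [qubits_fin_pow, qubits_fin_pow, ← mul_min_of_nonneg _ _ (Nat.cast_nonneg _), ← mul_assoc,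
      ENNReal.ofReal_mul (by positivity)]
    congr 1
    rw [ENNReal.ofReal, Real.toNNReal_of_nonneg (by positivity)]
    congr 1
    ext
    simp
  rwa [ENNReal.inv_mul_le_iff hC0 ENNReal.coe_ne_top] at h

/-- The costs of `f`-routing and of conditional disclosure of secrets agree up to constants. -/
theorem exists_cost_bounds : ∃ c C : ℝ≥0, 0 < c ∧ 0 < C ∧
    ∀ (n : ℕ) (f : (Fin n → Bool) → (Fin n → Bool) → Bool),
      (c * cdqsCost 0.09 0.09 f ≤ frCost 0.09 0.09 f ∧
        frCost 0.09 0.09 f ≤ C * cdqsCost 0.09 0.09 f) ∧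
      (c * cdqsCost 0.09 0.09 f ≤ frMinCost 0.09 0.09 f ∧
        frMinCost 0.09 0.09 f ≤ C * cdqsCost 0.09 0.09 f) := by
  obtain ⟨k, hk⟩ := exists_iterate_codeError_le
  refine ⟨(5 ^ k)⁻¹, 2 * 5 ^ k, by positivity, by positivity, fun n f => ?_⟩
  have h1 := cdqsCost_le_mul_frMinCost (f := f) hk
  have h2 := frCost_le_mul_cdqsCost (f := f) hk
  have h3 := frMinCost_le_frCost (f := f) 0.09 0.09
  exact ⟨⟨h1.trans h3, h2⟩, h1, h3.trans h2⟩

end Costs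

end NLQC

end

theorem mainTheorem1 :
    -- `f`-routing to CDQS: same resource state, the messages are the systems `M₀` and `M₁`
    (∀ (n : ℕ) (f : (Fin n → Bool) → (Fin n → Bool) → Bool) (ε₀ ε₁ : ℝ≥0)
      (Q L R M₀ M₀' M₁ M₁' : Type)
      [Fintype Q] [DecidableEq Q] [Nonempty Q] [Fintype L] [DecidableEq L]
      [Fintype R] [DecidableEq R] [Fintype M₀] [DecidableEq M₀] [Fintype M₀'] [DecidableEq M₀']
      [Fintype M₁] [DecidableEq M₁] [Fintype M₁'] [DecidableEq M₁']
      (P : NLQC.FRProtocol n Q L R M₀ M₀' M₁ M₁'), P.IsCorrect f ε₀ ε₁ →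
      ∃ P' : NLQC.CDQSProtocol n Q L R M₀ M₁,
        P'.state = P.state ∧ P'.IsCorrect f ε₁ ∧ P'.IsSecure f (2 * NNReal.sqrt ε₀)) ∧
    -- CDQS to `f`-routing
    (∀ (n : ℕ) (f : (Fin n → Bool) → (Fin n → Bool) → Bool) (ε δ : ℝ≥0)
      (Q L R MA MB : Type)
      [Fintype Q] [DecidableEq Q] [Nonempty Q] [Fintype L] [DecidableEq L]
      [Fintype R] [DecidableEq R] [Fintype MA] [DecidableEq MA] [Fintype MB] [DecidableEq MB]
      (nM nE : ℝ) (P : NLQC.CDQSProtocol n Q L R MA MB),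
      P.IsCorrect f ε → P.IsSecure f δ →
      NLQC.qubits MA ≤ nM → NLQC.qubits MB ≤ nM → NLQC.qubits (L × R) ≤ nE →
      -- a pure resource state is used unchanged
      (NLQC.IsPure P.state →
        ∃ (m₀ m₀' m₁ m₁' : ℕ)
          (P' : NLQC.FRProtocol n Q L R (Fin m₀) (Fin m₀') (Fin m₁) (Fin m₁')),
          P'.state = P.state ∧ P'.IsCorrect f (2 * NNReal.sqrt δ) ε ∧
          -- the systems that are exchanged
          NLQC.qubits (Fin m₀) + NLQC.qubits (Fin m₁') ≤ 4 * (nM + nE) ∧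
          -- all systems, sent or kept
          (NLQC.qubits Q ≤ 3 * nE →
            NLQC.qubits (Fin m₀) + NLQC.qubits (Fin m₀') + NLQC.qubits (Fin m₁) +
              NLQC.qubits (Fin m₁') ≤ 4 * (nM + nE))) ∧
      -- a mixed resource state is replaced by a purification, with Bob holding the purifying system
      (∃ (r m₀ m₀' m₁ m₁' : ℕ)
          (P' : NLQC.FRProtocol n Q L (R × Fin r) (Fin m₀) (Fin m₀') (Fin m₁) (Fin m₁')),
          NLQC.qubits (Fin r) ≤ nE ∧ NLQC.IsPure P'.state ∧
          (∀ i j : L × R, P.state i j = ∑ k, P'.state (i.1, (i.2, k)) (j.1, (j.2, k))) ∧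
          P'.IsCorrect f (2 * NNReal.sqrt δ) ε ∧
          NLQC.qubits (Fin m₀) + NLQC.qubits (Fin m₁') ≤ 4 * (nM + nE) ∧
          (NLQC.qubits Q ≤ 2 * nE →
            NLQC.qubits (Fin m₀) + NLQC.qubits (Fin m₀') + NLQC.qubits (Fin m₁) +
              NLQC.qubits (Fin m₁') ≤ 4 * (nM + nE)))) ∧
    -- `FR(f) = Θ(CDQS(f))`, with universal constants, for both measures of the resource of `FR`
    (∃ c C : ℝ≥0, 0 < c ∧ 0 < C ∧
      ∀ (n : ℕ) (f : (Fin n → Bool) → (Fin n → Bool) → Bool),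
        (c * NLQC.cdqsCost 0.09 0.09 f ≤ NLQC.frCost 0.09 0.09 f ∧
          NLQC.frCost 0.09 0.09 f ≤ C * NLQC.cdqsCost 0.09 0.09 f) ∧
        (c * NLQC.cdqsCost 0.09 0.09 f ≤ NLQC.frMinCost 0.09 0.09 f ∧
          NLQC.frMinCost 0.09 0.09 f ≤ C * NLQC.cdqsCost 0.09 0.09 f)) := by
  refine ⟨?_, ?_, ?_⟩
  · intro n f ε₀ ε₁ Q L R M₀ M₀' M₁ M₁' _ _ _ _ _ _ _ _ _ _ _ _ _ _ _ P hP
    exact ⟨P.toCDQS, rfl, hP.toCDQS_isCorrect, hP.toCDQS_isSecure⟩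
  · intro n f ε δ Q L R MA MB _ _ _ _ _ _ _ _ _ _ _ nM nE P hε hδ hMA hMB hE
    exact ⟨P.exists_frProtocol_of_isPure hε hδ hMA hMB hE,
      P.exists_frProtocol_purification hε hδ hMA hMB hE⟩
  · exact NLQC.exists_cost_bounds
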